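/- Let $\mathbf k$ be a field, let $n,d\ge 0$ be integers, and let $I=I_{P_n}=\langle x_1x_2,\,x_2x_3,\dots,x_{n-1}x_n\rangle\subseteq S=\mathbf k[x_1,\dots,x_n]$ be the edge ideal of the path $P_n$ on the vertices $1,\dots,n$. Let $\mathrm{Newt}(I^d)\subseteq\mathbb R^n$ be the convex hull of the exponent vectors of the minimal monomial generators of $I^d$. Let $Z_n^d$ be the polyhedral complex obtained by subdividing $\mathrm{Newt}(I^d)$ by all hyperplanes $$H_{i,j}=\{y\in\mathbb R^n : y_i=j\}\quad\text{and}\quad H'_{i,j}=\Big\{y\in\mathbb R^n : \sum_{k=0}^{\lfloor (i-1)/2\rfloor} y_{i-2k}=j\Big\}\qquad(1\le i\le n,\ j\in\mathbb Z_{\ge0});$$ its cells are the nonempty faces of the pieces into which these hyperplanes cut $\mathrm{Newt}(I^d)$. Then $Z_n^d$, with the monomial labeling induced by the coordinates, supports a cellular resolution of $I^d$. Explicitly: 1. $Z_n^d$ is a finite polyhedral complex, and all its vertices lie in $\mathbb Z_{\ge0}^n$. Each vertex $v$ is labeled by $\ell(v)=x^v$ and each cell $\sigma$ by $\ell(\sigma)=\mathrm{lcm}\{\ell(v):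 v\text{ a vertex of }\sigma\}$. 2. For every choice of orientations of the cells (vertices being oriented positively), let $F_p$ be the free $S$-module with basis the $p$-dimensional cells, let $\partial:F_{p+1}\to F_p$ be given by $\partial\sigma=\sum_\tau \varepsilon(\sigma,\tau)\,\frac{\ell(\sigma)}{\ell(\tau)}\,\tau$, the sum being over the facets $\tau$ of $\sigma$ with $\varepsilon(\sigma,\tau)=\pm1$ the incidence sign determined by the orientations, and let $F_0\to S$ send each vertex $v$ to $\ell(v)$. Then the image of $F_0\to S$ is $I^d$ and $$\cdots\to F_2\to F_1\to F_0\to I^d\to 0$$ is exact. -/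

import Mathlib

noncomputable section

namespace CellRes

open scoped Classical

/-! ### Monomial ideals, edge ideals, Newton polytopes -/

/-- The edge ideal `⟨x_u x_v ∣ uv ∈ E(G)⟩` of a graph `G`. -/
def edgeIdeal (k : Type*) [Field k] {V : Type*} (G : SimpleGraph V) :
    Ideal (MvPolynomial V k) :=
  Ideal.span {m | ∃ u v : V, G.Adj u v ∧ m = MvPolynomial.X u * MvPolynomial.X v}

/-- The exponents of the minimal monomial generators of a monomial ideal: the minimal elements,
with respect to divisibility, among the monomials in `I`. -/
def minGenExponents {k : Type*} [Field k] {V : Type*} (I : Ideal (MvPolynomial V k)) :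
    Set (V →₀ ℕ) :=
  {a | Minimal (fun b : V →₀ ℕ => MvPolynomial.monomial b (1 : k) ∈ I) a}

/-- The Newton polytope of a monomial ideal: the convex hull of the exponent vectors of its
minimal monomial generators. -/
def newtonPolytope {k : Type*} [Field k] {V : Type*} (I : Ideal (MvPolynomial V k)) :
    Set (V → ℝ) :=
  convexHull ℝ ((fun (a : V →₀ ℕ) (i : V) => (a i : ℝ)) '' minGenExponents I)

/-! ### Polyhedral complexes and subdivisions by hyperplanes

A polyhedral complex is given by its set of (closed, nonempty) cells. -/

/-- A finite polyhedral complex: finitely many nonempty polytopes, closed under taking nonempty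
faces, any two of which are disjoint or meet in a common face. -/
structure IsPolyhedralComplex {n : ℕ} (X : Set (Set (Fin n → ℝ))) : Prop where
  finite : X.Finite
  polytope : ∀ σ ∈ X, ∃ s : Set (Fin n → ℝ), s.Finite ∧ s.Nonempty ∧ σ = convexHull ℝ s
  face_mem : ∀ σ ∈ X, ∀ F : Set (Fin n → ℝ), F.Nonempty → IsExposed ℝ σ F → F ∈ X
  inter_face : ∀ σ ∈ X, ∀ τ ∈ X, (σ ∩ τ).Nonempty → IsExposed ℝ σ (σ ∩ τ)

/-- The cells of the subdivision of the polytope `P` by the hyperplanes `{y ∣ f h y = c h}`: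
the nonempty faces of the pieces into which these hyperplanes cut `P`.  A piece is obtained by
choosing, for every hyperplane, one of its two closed sides; `A` is the set of hyperplanes for
which the side `c h ≤ f h y` is chosen. -/
def subdivision {n : ℕ} (P : Set (Fin n → ℝ)) {ι : Type*}
    (f : ι → (Fin n → ℝ) →ₗ[ℝ] ℝ) (c : ι → ℝ) : Set (Set (Fin n → ℝ)) :=
  {σ | σ.Nonempty ∧ ∃ A : Set ι,
    IsExposed ℝ (P ∩ {y | (∀ h ∈ A, c h ≤ f h y) ∧ ∀ h ∉ A, f h y ≤ c h}) σ}

/-- The linear form `y_i`; its level sets at `j = 0, 1, 2, …` are the hyperplanes `H_{i,j}`. -/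
def coordForm {n : ℕ} (i : Fin n) : (Fin n → ℝ) →ₗ[ℝ] ℝ := LinearMap.proj i

/-- The linear form `y_i + y_{i-2} + y_{i-4} + ⋯`, the sum being over all coordinates with
positive index at most `i` and of the parity of `i`; its level sets at `j = 0, 1, 2, …` are the
hyperplanes `H'_{i,j}`. -/
def altForm {n : ℕ} (i : Fin n) : (Fin n → ℝ) →ₗ[ℝ] ℝ :=
  ∑ m : Fin n with m ≤ i ∧ (m : ℕ) % 2 = (i : ℕ) % 2, LinearMap.proj m

/-- The complex `Z_n^d`: the common refinement of the subdivisions of the Newton polytope of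
`I_{P_n}^d` by all `H_{i,j}` and by all `H'_{i,j}`, where `1 ≤ i ≤ n` and `0 ≤ j`. -/
def complexZ (k : Type*) [Field k] (n d : ℕ) : Set (Set (Fin n → ℝ)) :=
  subdivision (newtonPolytope (edgeIdeal k (SimpleGraph.pathGraph n) ^ d))
    (ι := (Fin n × ℕ) ⊕ (Fin n × ℕ))
    (Sum.elim (fun p => coordForm p.1) (fun p => altForm p.1))
    (Sum.elim (fun p => (p.2 : ℝ)) (fun p => (p.2 : ℝ)))

/-! ### The cellular complex of a polyhedral complex labeled by coordinates -/

section Cellular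

variable {n : ℕ} (X : Set (Set (Fin n → ℝ)))

/-- The `p`-dimensional cells of `X`. -/
def Cell (p : ℕ) : Type :=
  {σ : Set (Fin n → ℝ) // σ ∈ X ∧ Module.finrank ℝ (vectorSpan ℝ σ) = p}

/-- The exponent of the monomial label `ℓ(σ) = lcm {x^v ∣ v a vertex of σ}` induced by the
coordinates (meaningful when the vertices of `X` are points of `ℕ^n` and `X` is finite). -/
def label (σ : Set (Fin n → ℝ)) : Fin n →₀ ℕ :=
  Finsupp.equivFunOnFinite.symm fun i =>
    sSup {a : ℕ | ∃ v : Fin n → ℝ, v ∈ σ ∧ {v} ∈ X ∧ v i = (a : ℝ)}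

/-- Orientations of all cells: an ordered basis of the direction space of every cell. In
particular every vertex carries the empty basis, i.e. the positive orientation. -/
def CellOrientation : Type :=
  ∀ (p : ℕ) (σ : Cell X p), Module.Basis (Fin p) ℝ (vectorSpan ℝ σ.1)

/-- Every complex can be oriented. -/
theorem nonempty_cellOrientation : Nonempty (CellOrientation X) :=
  ⟨fun _ σ => Module.finBasisOfFinrankEq ℝ _ σ.2.2⟩

variable {X}

/-- The determinant of `(x - y, b₁, …, b_p)`, where `b` is the chosen basis of the `p`-cell
`τ ⊆ σ` and `x, y ∈ σ`, with respect to the chosen basis of the `(p+1)`-cell `σ`. -/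
def orientDet (o : CellOrientation X) {p : ℕ} (σ : Cell X (p + 1)) (τ : Cell X p)
    (h : τ.1 ⊆ σ.1) (x y : Fin n → ℝ) (hx : x ∈ σ.1) (hy : y ∈ σ.1) : ℝ :=
  (o (p + 1) σ).det
    (Fin.cons (⟨x - y, vsub_mem_vectorSpan ℝ hx hy⟩ : vectorSpan ℝ σ.1)
      (fun i => Submodule.inclusion (vectorSpan_mono ℝ h) (o p τ i)))

/-- The incidence number of a `(p+1)`-cell `σ` and a `p`-cell `τ`: it is `0` unless `τ` is a facet
of `σ`, and then it is `1` or `-1` according to whether a vector `x - y` with `x ∈ τ` and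
`y ∈ σ \ τ` (that is, a vector pointing out of `σ` along `τ`), followed by the basis of `τ`, is
positively or negatively oriented in `σ`. -/
def incidence (o : CellOrientation X) {p : ℕ} (σ : Cell X (p + 1)) (τ : Cell X p) : ℤ :=
  if h : τ.1 ⊆ σ.1 then
    if ∃ (x : Fin n → ℝ) (hx : x ∈ τ.1) (y : Fin n → ℝ) (hy : y ∈ σ.1),
      0 < orientDet o σ τ h x y (h hx) hy then 1 else -1
  else 0

variable (k : Type*) [Field k]

/-- The cellular boundary map from the free module on the `(p+1)`-cells to the free module on the
`p`-cells, `∂ σ = ∑_τ ε(σ, τ) x^{ℓ(σ) - ℓ(τ)} τ`. -/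
def boundary (o : CellOrientation X) (p : ℕ) :
    (Cell X (p + 1) →₀ MvPolynomial (Fin n) k) →ₗ[MvPolynomial (Fin n) k]
      (Cell X p →₀ MvPolynomial (Fin n) k) :=
  Finsupp.linearCombination (MvPolynomial (Fin n) k) fun σ : Cell X (p + 1) =>
    ∑ᶠ τ : Cell X p, Finsupp.single τ
      (MvPolynomial.monomial (label X σ.1 - label X τ.1) ((incidence o σ τ : ℤ) : k))

variable (X)

/-- The augmentation, sending every vertex to its monomial label. -/
def augmentation :
    (Cell X 0 →₀ MvPolynomial (Fin n) k) →ₗ[MvPolynomial (Fin n) k] MvPolynomial (Fin n) k :=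
  Finsupp.linearCombination (MvPolynomial (Fin n) k) fun v : Cell X 0 =>
    MvPolynomial.monomial (label X v.1) (1 : k)

variable {k}

/-- The set of cells `X`, with the monomial labeling induced by the coordinates, supports a
cellular resolution of the ideal `I`: it is a polyhedral complex, its vertices are lattice points
with nonnegative coordinates, and, however the cells are oriented, the cellular complex
`⋯ → F_2 → F_1 → F_0 → I → 0`, with `F_p` free on the `p`-cells, is exact. -/
structure SupportsCellularResolution (I : Ideal (MvPolynomial (Fin n) k)) : Prop where
  complex : IsPolyhedralComplex X
  lattice : ∀ v : Fin n → ℝ, {v} ∈ X → ∃ a : Fin n → ℕ, v = fun i => (a i : ℝ)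
  range_augmentation : LinearMap.range (augmentation X k) = I
  exact_zero : ∀ o : CellOrientation X, Function.Exact (boundary k o 0) (augmentation X k)
  exact_succ : ∀ (o : CellOrientation X) (p : ℕ),
    Function.Exact (boundary k o (p + 1)) (boundary k o p)

end Cellular

end CellRes

end

/-! Exactness of a multigraded complex of free modules can be tested one multidegree `b` at a time,
over the field (`exact_gradedMap`). In degree `b` the labeled complex becomes the augmented chain
complex of the cells whose label divides `x^b`. Since every cell is the convex hull of its vertices,
these are the cells inside the orthant `y ≤ b` (`label_le_iff`). The hyperplanes `y_i = b_i` belong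
to the arrangement or lie beyond the polytope, so these cells subdivide a polytope again, namely the
part of the Newton polytope with `y ≤ b` (`exists_restrict_support_iff`). It therefore suffices that
a nonempty bounded polyhedron subdivided by hyperplanes has an exact augmented cellular complex
(`exactOn_restrict`).

This is proved combinatorially, without topology. After homogenization cells are cones, encoded by
sign vectors, and the zero vector plays the role of the empty cell. The incidence numbers form a
differential because an interval of length two has exactly two middle elements (`exists_isMiddle`),
and the two corresponding products are signs of determinants that differ by a transposition
(`eps_mul_eps_add`); when the lower end is the empty cell, the two ends of an edge have opposite
incidence numbers instead. The faces of a single cone are shown to be exact by sweeping along a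
generic line, as in a line shelling (`exactOn_sweepSet`). A subdivided region is then treated by
cutting along one hyperplane after another, with a Mayer–Vietoris argument (`exactOn_region`).

What is special to paths is a change of coordinates. Let `z_t` be the alternating sum `zForm t`. On
a combination of edge vectors, `z_t` is the sum of the coefficients of the first `t` edges. The
Newton polytope of `I^d` is thus `0 = z_0 ≤ z_1 ≤ ⋯ ≤ z_{n-1} = z_n = d`, and every hyperplane
prescribes an integral value of some `z_t` or of a difference of two of them. Moving together all
`z_t` with the same nonzero fractional part respects all equations valid on a cell, so vertices have
integral `z_t` (`fract_zForm_of_singleton_mem`). Hence the vertices are exactly the lattice points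
of the polytope, and these are the exponents of products of `d` edges. -/

namespace CellRes

open scoped Classical

/-! ### Exactness of ungraded complexes with a distinguished basis -/

section Exactness

variable {T k : Type*} [Field k]

/-- The boundary, with respect to the incidence matrix `ε`, of the chain `c` restricted to the
set `Q` of basis elements. -/
def bdry (ε : T → T → k) (Q : Finset T) (c : T → k) (t : T) : k :=
  ∑ s ∈ Q, c s * ε s t

/-- The incidence matrix `ε`, restricted to `Q`, squares to zero. -/
def SqZero (ε : T → T → k) (Q : Finset T) : Prop :=
  ∀ s ∈ Q, ∀ u ∈ Q, ∑ t ∈ Q, ε s t * ε t u = 0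

/-- The complex spanned by `Q` is exact: every cycle is a boundary. -/
def ExactOn (ε : T → T → k) (Q : Finset T) : Prop :=
  ∀ c : T → k, (∀ t ∈ Q, bdry ε Q c t = 0) → ∃ b : T → k, ∀ t ∈ Q, bdry ε Q b t = c t

variable {ε : T → T → k}

theorem bdry_congr {Q : Finset T} {c c' : T → k} (h : ∀ s ∈ Q, c s = c' s) (t : T) :
    bdry ε Q c t = bdry ε Q c' t :=
  Finset.sum_congr rfl fun s hs => by rw [h s hs]

theorem bdry_sub (Q : Finset T) (c c' : T → k) (t : T) :
    bdry ε Q (fun s => c s - c' s) t = bdry ε Q c t - bdry ε Q c' t := by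
  simp only [bdry, sub_mul, Finset.sum_sub_distrib]

theorem bdry_zero {Q : Finset T} {c : T → k} (h : ∀ s ∈ Q, c s = 0) (t : T) :
    bdry ε Q c t = 0 :=
  Finset.sum_eq_zero fun s hs => by rw [h s hs, zero_mul]

theorem bdry_of_vanish {Q : Finset T} {c : T → k} {t : T} (h : ∀ s ∈ Q, ε s t = 0) :
    bdry ε Q c t = 0 :=
  Finset.sum_eq_zero fun s hs => by rw [h s hs, mul_zero]

theorem SqZero.bdry_bdry {Q : Finset T} (h : SqZero ε Q) (c : T → k) {u : T} (hu : u ∈ Q) :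
    bdry ε Q (bdry ε Q c) u = 0 := by
  simp only [bdry, Finset.sum_mul]
  rw [Finset.sum_comm]
  refine Finset.sum_eq_zero fun s hs => ?_
  simp only [mul_assoc, ← Finset.mul_sum, h s hs u hu, mul_zero]

theorem exactOn_empty : ExactOn ε (∅ : Finset T) := fun c _ => ⟨c, by simp⟩

variable [DecidableEq T]

theorem bdry_union {Q₁ Q₂ : Finset T} (hd : Disjoint Q₁ Q₂) (c : T → k) (t : T) :
    bdry ε (Q₁ ∪ Q₂) c t = bdry ε Q₁ c t + bdry ε Q₂ c t :=
  Finset.sum_union hd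

/-- By `hε` boundaries of `Q₁` stay in `Q₁`: it is a subcomplex, with quotient `Q₂`. This is the
step "sub and quotient exact, hence the total complex exact" of the long exact sequence. -/
theorem ExactOn.union {Q₁ Q₂ : Finset T} (hd : Disjoint Q₁ Q₂)
    (hε : ∀ s ∈ Q₁, ∀ t ∈ Q₂, ε s t = 0) (hsq : SqZero ε (Q₁ ∪ Q₂))
    (h₁ : ExactOn ε Q₁) (h₂ : ExactOn ε Q₂) : ExactOn ε (Q₁ ∪ Q₂) := by
  intro c hc
  obtain ⟨b₂, hb₂⟩ := h₂ c fun t ht => by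
    have := hc t (Finset.mem_union_right _ ht)
    rwa [bdry_union hd, bdry_of_vanish fun s hs => hε s hs t ht, zero_add] at this
  set b₂' : T → k := fun s => if s ∈ Q₂ then b₂ s else 0 with hb₂'
  have hb₂₁ : ∀ s ∈ Q₁, b₂' s = 0 := fun s hs => by
    simp [hb₂', Finset.disjoint_left.mp hd hs]
  have hb₂₂ : ∀ s ∈ Q₂, b₂' s = b₂ s := fun s hs => by simp [hb₂', hs]
  have hval₂ : ∀ t ∈ Q₂, bdry ε (Q₁ ∪ Q₂) b₂' t = c t := fun t ht => by
    rw [bdry_union hd, bdry_zero hb₂₁, zero_add, bdry_congr hb₂₂, hb₂ t ht]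
  -- After subtracting the boundary of the lift `b₂'`, the cycle is supported on the subcomplex
  -- `Q₁`.
  obtain ⟨b₁, hb₁⟩ := h₁ (fun t => c t - bdry ε (Q₁ ∪ Q₂) b₂' t) fun t ht => by
    have h0 := hc t (Finset.mem_union_left _ ht)
    have h1 := hsq.bdry_bdry b₂' (Finset.mem_union_left Q₂ ht)
    have h2 : bdry ε (Q₁ ∪ Q₂) (fun t => c t - bdry ε (Q₁ ∪ Q₂) b₂' t) t = 0 := by
      rw [bdry_sub, h0, h1, sub_zero]
    rw [bdry_union hd] at h2
    rwa [bdry_zero (Q := Q₂) fun s hs => by rw [hval₂ s hs, sub_self], add_zero] at h2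
  refine ⟨fun s => if s ∈ Q₁ then b₁ s else b₂ s, fun t ht => ?_⟩
  rw [bdry_union hd, bdry_congr (Q := Q₁) (c' := b₁) fun s hs => by simp [hs],
    bdry_congr (Q := Q₂) (c' := b₂) fun s hs => by simp [Finset.disjoint_right.mp hd hs]]
  rcases Finset.mem_union.mp ht with h | h
  · rw [hb₁ t h, bdry_union hd, bdry_zero hb₂₁, zero_add, bdry_congr hb₂₂, sub_add_cancel]
  · rw [bdry_of_vanish fun s hs => hε s hs t h, zero_add, hb₂ t h]

/-- The same long exact sequence, solved for the quotient. A cycle of `Q₂`, extended by zero, has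
its boundary in `Q₁`; there that boundary is a cycle, hence the boundary of some `e`, and
subtracting `e` produces a cycle of the total complex. -/
theorem ExactOn.of_union {Q₁ Q₂ : Finset T} (hd : Disjoint Q₁ Q₂)
    (hε : ∀ s ∈ Q₁, ∀ t ∈ Q₂, ε s t = 0) (hsq : SqZero ε (Q₁ ∪ Q₂))
    (h : ExactOn ε (Q₁ ∪ Q₂)) (h₁ : ExactOn ε Q₁) : ExactOn ε Q₂ := by
  intro c hc
  set c' : T → k := fun s => if s ∈ Q₂ then c s else 0 with hc'
  have hc₁ : ∀ s ∈ Q₁, c' s = 0 := fun s hs => by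
    simp [hc', Finset.disjoint_left.mp hd hs]
  have hc₂ : ∀ s ∈ Q₂, c' s = c s := fun s hs => by simp [hc', hs]
  have hb : ∀ t, bdry ε (Q₁ ∪ Q₂) c' t = bdry ε Q₂ c t := fun t => by
    rw [bdry_union hd, bdry_zero hc₁, zero_add, bdry_congr hc₂]
  obtain ⟨e, he⟩ := h₁ (bdry ε (Q₁ ∪ Q₂) c') fun t ht => by
    have := hsq.bdry_bdry c' (Finset.mem_union_left Q₂ ht)
    rwa [bdry_union hd, bdry_zero (Q := Q₂) fun s hs => by rw [hb, hc s hs], add_zero] at this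
  obtain ⟨b, hb'⟩ := h (fun s => if s ∈ Q₁ then - e s else c s) fun t ht => by
    rw [bdry_union hd, bdry_congr (Q := Q₂) (c' := c) fun s hs => by
      simp [Finset.disjoint_right.mp hd hs],
      bdry_congr (Q := Q₁) (c' := fun s => 0 - e s) fun s hs => by simp [hs], bdry_sub,
      bdry_zero (fun _ _ => rfl)]
    rcases Finset.mem_union.mp ht with h' | h'
    · rw [he t h', hb]; ring
    · rw [bdry_of_vanish fun s hs => hε s hs t h', hc t h']; ring
  refine ⟨b, fun t ht => ?_⟩
  have := hb' t (Finset.mem_union_right _ ht)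
  rwa [bdry_union hd, bdry_of_vanish fun s hs => hε s hs t ht, zero_add,
    if_neg (Finset.disjoint_right.mp hd ht)] at this

theorem exactOn_pair {a b : T} (hne : a ≠ b) (hab : ε a b ≠ 0) (hba : ε b a = 0)
    (haa : ε a a = 0) (hbb : ε b b = 0) : ExactOn ε {a, b} := by
  intro c hc
  have h1 : ∀ (c : T → k) t, bdry ε {a, b} c t = c a * ε a t + c b * ε b t := fun c t =>
    Finset.sum_pair hne
  have hca : c a = 0 := by
    have := hc b (by simp)
    rw [h1, hbb, mul_zero, add_zero] at this
    exact (mul_eq_zero.mp this).resolve_right hab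
  refine ⟨fun s => if s = a then c b / ε a b else 0, fun t ht => ?_⟩
  rw [h1]
  rcases Finset.mem_insert.mp ht with rfl | ht
  · simp [haa, hba, hca]
  · rw [Finset.mem_singleton.mp ht]
    simp [hbb, hab]

/-- The differential does not increase `φ`, so the sublevel sets of `φ` filter the complex and the
fibers are the graded pieces. The fiber over the maximum is a quotient, and it is split off at each
step of the induction. -/
theorem ExactOn.of_fibers (φ : T → ℝ) : ∀ (N : ℕ) {Q : Finset T}, Q.card ≤ N →
    (∀ s ∈ Q, ∀ t ∈ Q, ε s t ≠ 0 → φ t ≤ φ s) → SqZero ε Q →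
    (∀ c : ℝ, ExactOn ε (Q.filter fun s => φ s = c)) → ExactOn ε Q := by
  intro N
  induction N with
  | zero =>
    intro Q hQ _ _ _
    rw [Finset.card_eq_zero.mp (Nat.le_zero.mp hQ)]
    exact exactOn_empty
  | succ N ih =>
    intro Q hQ hmono hsq hfib
    rcases Q.eq_empty_or_nonempty with rfl | hne
    · exact exactOn_empty
    obtain ⟨m, hm, hmax⟩ := Q.exists_max_image φ hne
    set Q₁ := Q.filter fun s => φ s ≠ φ m with hQ₁
    set Q₂ := Q.filter fun s => φ s = φ m with hQ₂
    have hQu : Q₁ ∪ Q₂ = Q := by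
      rw [Finset.union_comm]; exact Finset.filter_union_filter_not_eq _ _
    have hd : Disjoint Q₁ Q₂ := (Finset.disjoint_filter_filter_not Q Q _).symm
    have hε : ∀ s ∈ Q₁, ∀ t ∈ Q₂, ε s t = 0 := by
      intro s hs t ht
      by_contra hst
      rw [hQ₁, Finset.mem_filter] at hs
      rw [hQ₂, Finset.mem_filter] at ht
      have := hmono s hs.1 t ht.1 hst
      exact hs.2 (le_antisymm (hmax s hs.1) (ht.2 ▸ this))
    have hsq₁ : SqZero ε Q₁ := by
      intro s hs u hu
      rw [← hsq s (Finset.mem_of_mem_filter _ hs) u (Finset.mem_of_mem_filter _ hu), ← hQu,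
        Finset.sum_union hd, left_eq_add]
      exact Finset.sum_eq_zero fun t ht => by rw [hε s hs t ht, zero_mul]
    have hsub : Q₁ ⊆ Q := Finset.filter_subset _ _
    have hlt : Q₁.card < Q.card := Finset.card_lt_card
      ⟨hsub, fun h => (Finset.mem_filter.mp (h hm)).2 rfl⟩
    have h₁ : ExactOn ε Q₁ := by
      refine ih (by omega) (fun s hs t ht => hmono s (hsub hs) t (hsub ht)) hsq₁ fun c => ?_
      by_cases hc : c = φ m
      · have : (Q₁.filter fun s => φ s = c) = ∅ := Finset.filter_eq_empty_iff.mpr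
          fun s hs h => (Finset.mem_filter.mp hs).2 (h.trans hc)
        rw [this]
        exact exactOn_empty
      · have : (Q₁.filter fun s => φ s = c) = Q.filter fun s => φ s = c := by
          ext s
          simp only [hQ₁, Finset.mem_filter]
          constructor
          · rintro ⟨⟨h1, _⟩, h2⟩; exact ⟨h1, h2⟩
          · rintro ⟨h1, h2⟩; exact ⟨⟨h1, h2 ▸ hc⟩, h2⟩
        rw [this]
        exact hfib c
    rw [← hQu]
    exact ExactOn.union hd hε (hQu.symm ▸ hsq) h₁ (hfib _)

end Exactness

/-! ### Sign vectors of linear arrangements -/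

section Arrangement

variable {ι W : Type*} [AddCommGroup W] [Module ℝ W]

/-- The sign vector of a point with respect to a family of linear forms. -/
noncomputable def signVec (a : ι → W →ₗ[ℝ] ℝ) (w : W) : ι → SignType := fun h => SignType.sign (a h w)

/-- The face order on sign vectors: `t` arises from `s` by replacing some entries by `0`. -/
def Conf (t s : ι → SignType) : Prop := ∀ h, t h = 0 ∨ t h = s h

/-- The subspace on which all forms vanish that vanish on the cone of sign vector `s`. -/
noncomputable def flat (a : ι → W →ₗ[ℝ] ℝ) (s : ι → SignType) : Submodule ℝ W :=
  ⨅ h, ⨅ (_ : s h = 0), LinearMap.ker (a h)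

/-- The dimension of the cone of sign vector `s`. -/
noncomputable def rk (a : ι → W →ₗ[ℝ] ℝ) (s : ι → SignType) : ℕ := Module.finrank ℝ (flat a s)

theorem Conf.refl (s : ι → SignType) : Conf s s := fun _ => Or.inr rfl

theorem Conf.trans {s t u : ι → SignType} (h₁ : Conf u t) (h₂ : Conf t s) : Conf u s := by
  intro h
  rcases h₁ h with h' | h'
  · exact Or.inl h'
  · rw [h']; exact h₂ h

theorem Conf.zero {s t : ι → SignType} (h₁ : Conf t s) {h : ι} (hs : s h = 0) : t h = 0 := by
  rcases h₁ h with h' | h'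
  · exact h'
  · rw [h', hs]

theorem Conf.eq_of_ne {s t : ι → SignType} (h₁ : Conf t s) {h : ι} (ht : t h ≠ 0) :
    t h = s h := (h₁ h).resolve_left ht

theorem Conf.antisymm {s t : ι → SignType} (h₁ : Conf t s) (h₂ : Conf s t) : t = s := by
  funext h
  rcases h₁ h with h' | h'
  · rw [h', h₂.zero h']
  · exact h'

theorem conf_zero (s : ι → SignType) : Conf 0 s := fun _ => Or.inl rfl

variable {a : ι → W →ₗ[ℝ] ℝ}

theorem mem_flat {s : ι → SignType} {w : W} : w ∈ flat a s ↔ ∀ h, s h = 0 → a h w = 0 := by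
  simp [flat, Submodule.mem_iInf]

theorem signVec_eq_zero {w : W} {h : ι} : signVec a w h = 0 ↔ a h w = 0 := sign_eq_zero_iff

theorem mem_flat_signVec (w : W) : w ∈ flat a (signVec a w) :=
  mem_flat.mpr fun _ => signVec_eq_zero.mp

theorem Conf.mem_flat {s : ι → SignType} {w : W} (h : Conf (signVec a w) s) : w ∈ flat a s :=
  CellRes.mem_flat.mpr fun _ hs => signVec_eq_zero.mp (h.zero hs)

theorem Conf.flat_le {s t : ι → SignType} (h : Conf t s) : flat a t ≤ flat a s :=
  fun _ hw => CellRes.mem_flat.mpr fun _ hs => CellRes.mem_flat.mp hw _ (h.zero hs)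

theorem signVec_zero : signVec a 0 = 0 := by funext h; simp [signVec]

theorem signVec_smul {c : ℝ} (hc : 0 < c) (w : W) : signVec a (c • w) = signVec a w := by
  funext h; simp [signVec, sign_mul, sign_pos hc]

/-- Realizability of `s` is essential: if the flats agreed, the point `w` would lie in the flat of
`t`, so every form that is zero in `t` would be zero in `s`. -/
theorem rk_lt [FiniteDimensional ℝ W] {s t : ι → SignType} (h : Conf t s) (hne : t ≠ s) {w : W}
    (hw : signVec a w = s) : rk a t < rk a s := by
  refine Submodule.finrank_lt_finrank_of_lt (lt_of_le_of_ne h.flat_le fun heq => hne ?_)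
  refine h.antisymm fun i => ?_
  by_cases hi : t i = 0
  · left
    have : w ∈ flat a t := heq ▸ hw ▸ mem_flat_signVec w
    rw [← hw, signVec_eq_zero]
    exact mem_flat.mp this i hi
  · exact Or.inr (h.eq_of_ne hi).symm

theorem eventually_sign_add_smul (x y : ℝ) : ∀ᶠ δ in nhdsWithin (0 : ℝ) (Set.Ioi 0),
    SignType.sign (x + δ * y) = if x = 0 then SignType.sign y else SignType.sign x := by
  by_cases hx : x = 0
  · filter_upwards [self_mem_nhdsWithin] with δ hδ
    simp [hx, sign_mul, sign_pos (Set.mem_Ioi.mp hδ)]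
  · have hc : Filter.Tendsto (fun δ : ℝ => x + δ * y) (nhdsWithin 0 (Set.Ioi 0)) (nhds x) := by
      have : Continuous fun δ : ℝ => x + δ * y := by fun_prop
      have := this.tendsto 0
      simp only [zero_mul, add_zero] at this
      exact this.mono_left nhdsWithin_le_nhds
    rw [if_neg hx]
    rcases lt_or_gt_of_ne hx with h | h
    · filter_upwards [hc.eventually (gt_mem_nhds h)] with δ hδ
      rw [sign_neg h, sign_neg hδ]
    · filter_upwards [hc.eventually (lt_mem_nhds h)] with δ hδ
      rw [sign_pos h, sign_pos hδ]

theorem exists_signVec_add_smul [Finite ι] (w v : W) : ∃ δ : ℝ, 0 < δ ∧ ∀ h,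
    signVec a (w + δ • v) h = if signVec a w h = 0 then signVec a v h else signVec a w h := by
  have : ∀ᶠ δ in nhdsWithin (0 : ℝ) (Set.Ioi 0), ∀ h,
      SignType.sign (a h w + δ * a h v) =
        if a h w = 0 then SignType.sign (a h v) else SignType.sign (a h w) :=
    Filter.eventually_all.mpr fun h => eventually_sign_add_smul _ _
  obtain ⟨δ, h1, h2⟩ := (this.and self_mem_nhdsWithin).exists
  refine ⟨δ, h2, fun h => ?_⟩
  simp only [signVec_eq_zero]
  simpa [signVec] using h1 h

/-- A point of a subspace at which finitely many forms are positive can be perturbed so that,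
moreover, none of finitely many further forms vanishes at it, unless it vanishes on the whole
subspace. -/
theorem exists_generic [Finite ι] {κ : Type*} (L : Submodule ℝ W) (b : κ → W →ₗ[ℝ] ℝ)
    (J : Finset κ) {x₀ : W} (hx₀ : x₀ ∈ L) : ∃ x ∈ L, (∀ h, a h x₀ ≠ 0 →
      signVec a x h = signVec a x₀ h) ∧ ∀ j ∈ J, (∃ v ∈ L, b j v ≠ 0) → b j x ≠ 0 := by
  induction J using Finset.induction_on with
  | empty => exact ⟨x₀, hx₀, fun _ _ => rfl, by simp⟩
  | insert j J hj ih =>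
    obtain ⟨x, hx, h1, h2⟩ := ih
    by_cases hjx : (∃ v ∈ L, b j v ≠ 0) ∧ b j x = 0
    · obtain ⟨⟨v, hv, hbv⟩, hbx⟩ := hjx
      -- The forms already treated join the family, so that one small step preserves all their
      -- nonzero signs while it makes `b j` nonzero.
      let a' : ι ⊕ J ⊕ Unit → W →ₗ[ℝ] ℝ :=
        Sum.elim a (Sum.elim (fun i => b i.1) fun _ => b j)
      obtain ⟨δ, hδ, h3⟩ := exists_signVec_add_smul (a := a') x v
      refine ⟨x + δ • v, L.add_mem hx (L.smul_mem _ hv), fun h hh => ?_, fun i hi hiv => ?_⟩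
      · have h4 := h3 (Sum.inl h)
        have h5 : signVec a x h ≠ 0 := by
          rw [h1 h hh]; exact fun h0 => hh (signVec_eq_zero.mp h0)
        have h6 : signVec a' x (Sum.inl h) = signVec a x h := rfl
        rw [h6, if_neg h5, h1 h hh] at h4
        exact h4
      · rcases Finset.mem_insert.mp hi with rfl | hi
        · have h4 : b i x + δ * b i v ≠ 0 := by
            rw [hbx, zero_add]; exact mul_ne_zero hδ.ne' hbv
          simpa using h4
        · have h4 := h3 (Sum.inr (Sum.inl ⟨i, hi⟩))
          have h5 : signVec a' x (Sum.inr (Sum.inl ⟨i, hi⟩)) ≠ 0 := fun h0 =>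
            h2 i hi hiv (signVec_eq_zero (a := a').mp h0)
          rw [if_neg h5] at h4
          exact fun h0 => h5 (h4 ▸ signVec_eq_zero (a := a').mpr h0)
    · refine ⟨x, hx, h1, fun i hi hiv => ?_⟩
      rcases Finset.mem_insert.mp hi with rfl | hi
      · exact fun h0 => hjx ⟨hiv, h0⟩
      · exact h2 i hi hiv

end Arrangement

/-! ### Exactness of the faces of one cone, by a line sweep -/

section Sweep

variable {ι W k : Type*} [AddCommGroup W] [Module ℝ W] [Field k]

/-- `ε` is a system of incidence numbers for the cones whose sign vectors form the set `R`, which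
is closed under passing to faces. -/
structure IsIncidence (a : ι → W →ₗ[ℝ] ℝ) (R : Finset (ι → SignType))
    (ε : (ι → SignType) → (ι → SignType) → k) : Prop where
  real : ∀ s ∈ R, ∃ w, signVec a w = s
  down : ∀ s ∈ R, ∀ w, Conf (signVec a w) s → signVec a w ∈ R
  ne_zero_iff : ∀ s ∈ R, ∀ t ∈ R, ε s t ≠ 0 ↔ Conf t s ∧ rk a s = rk a t + 1
  sqZero : SqZero ε R

variable {a : ι → W →ₗ[ℝ] ℝ} {R : Finset (ι → SignType)}
  {ε : (ι → SignType) → (ι → SignType) → k}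

/-- A middle term contributing to the square lies between its two ends in the face order, so an
order-convex subset misses none of them. -/
theorem IsIncidence.sqZero_of_convex (hε : IsIncidence a R ε) {Q : Finset (ι → SignType)}
    (hQ : Q ⊆ R) (hconv : ∀ s ∈ Q, ∀ u ∈ Q, ∀ t ∈ R, Conf u t → Conf t s → t ∈ Q) :
    SqZero ε Q := by
  intro s hs u hu
  rw [← hε.sqZero s (hQ hs) u (hQ hu)]
  refine Finset.sum_subset hQ fun t ht htQ => ?_
  by_contra hne
  have h1 := left_ne_zero_of_mul hne
  have h2 := right_ne_zero_of_mul hne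
  exact htQ (hconv s hs u hu t ht ((hε.ne_zero_iff t ht u (hQ hu)).mp h2).1
    ((hε.ne_zero_iff s (hQ hs) t ht).mp h1).1)

theorem IsIncidence.mono (hε : IsIncidence a R ε) {Q : Finset (ι → SignType)}
    (hQ : Q ⊆ R) (hdown : ∀ s ∈ Q, ∀ w, Conf (signVec a w) s → signVec a w ∈ Q) :
    IsIncidence a Q ε where
  real s hs := hε.real s (hQ hs)
  down := hdown
  ne_zero_iff s hs t ht := hε.ne_zero_iff s (hQ hs) t (hQ ht)
  sqZero := hε.sqZero_of_convex hQ fun s hs u _ t ht _ hts => by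
    obtain ⟨w, rfl⟩ := hε.real t ht
    exact hdown s hs w hts

theorem finrank_inf_ker [FiniteDimensional ℝ W] (L : Submodule ℝ W) (f : W →ₗ[ℝ] ℝ) {v : W}
    (hv : v ∈ L) (hfv : f v ≠ 0) :
    Module.finrank ℝ (L ⊓ LinearMap.ker f : Submodule ℝ W) + 1 = Module.finrank ℝ L := by
  have h1 : f.domRestrict L ≠ 0 := fun h0 => hfv (by
    have := LinearMap.congr_fun h0 ⟨v, hv⟩
    simpa using this)
  have h2 := Module.Dual.finrank_ker_add_one_of_ne_zero h1
  have h3 : (L ⊓ LinearMap.ker f : Submodule ℝ W) =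
      (LinearMap.ker (f.domRestrict L)).map L.subtype := by
    ext w
    simp [and_comm]
  rw [h3, Submodule.finrank_map_subtype_eq]
  exact h2

/-- The faces `s` of the cone `κ` that contain the face `g` and lie only in such facets of `κ`
whose hyperplane does not weakly separate `y` from `κ`. -/
noncomputable def sweepSet (a : ι → W →ₗ[ℝ] ℝ) (R : Finset (ι → SignType)) (κ g : ι → SignType)
    (y : W) : Finset (ι → SignType) :=
  R.filter fun s => Conf g s ∧ Conf s κ ∧ ∀ h, s h = 0 → κ h ≠ 0 → signVec a y h = κ h

theorem mem_sweepSet {κ g s : ι → SignType} {y : W} : s ∈ sweepSet a R κ g y ↔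
    s ∈ R ∧ Conf g s ∧ Conf s κ ∧ ∀ h, s h = 0 → κ h ≠ 0 → signVec a y h = κ h :=
  Finset.mem_filter

/-- The facet of `κ` that is met, at time `c`, by a line that crosses the hyperplane `h` at
time `τ h`. -/
noncomputable def lineFacet (κ : ι → SignType) (τ : ι → ℝ) (c : ℝ) : ι → SignType :=
  fun h => if κ h ≠ 0 ∧ τ h = c then 0 else κ h

theorem conf_lineFacet (κ : ι → SignType) (τ : ι → ℝ) (c : ℝ) : Conf (lineFacet κ τ c) κ := by
  intro h
  unfold lineFacet
  split_ifs
  · exact Or.inl rfl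
  · exact Or.inr rfl

/-- The line through `x` and `y` is in general position with respect to the cone of `x`. -/
structure IsGenericLine (a : ι → W →ₗ[ℝ] ℝ) (κ : ι → SignType) (x y : W) (τ : ι → ℝ) :
    Prop where
  sign_x : signVec a x = κ
  mem_y : y ∈ flat a κ
  time : ∀ h, κ h ≠ 0 → a h y = τ h * a h x
  prop : ∀ h h', κ h ≠ 0 → κ h' ≠ 0 → τ h = τ h' → 0 < τ h → ∀ v ∈ flat a κ, a h v = 0 →
    a h' v = 0

variable {κ : ι → SignType} {x y : W} {τ : ι → ℝ}

/-- The line is run through as `c ↦ y - c • x`. Along it the form `h` has the value `(τ h - c) * a h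
x`, so the point is on the side of `κ` before time `τ h` and on the other side afterwards. -/
theorem IsGenericLine.sign_sub (hl : IsGenericLine a κ x y τ) {h : ι} (hh : κ h ≠ 0) (c : ℝ) :
    SignType.sign (a h (y - c • x)) = SignType.sign (τ h - c) * κ h := by
  rw [map_sub, map_smul, hl.time h hh, smul_eq_mul, ← sub_mul, sign_mul, ← hl.sign_x]
  rfl

theorem IsGenericLine.sign_y (hl : IsGenericLine a κ x y τ) {h : ι} (hh : κ h ≠ 0) :
    signVec a y h = κ h ↔ 0 < τ h := by
  have := hl.sign_sub hh 0
  rw [zero_smul, sub_zero, sub_zero] at this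
  rw [signVec, this, ← sign_eq_one_iff]
  generalize SignType.sign (τ h) = u
  revert hh
  generalize κ h = v
  revert u v
  decide

theorem IsGenericLine.exists [Finite ι] {x₀ : W} (hx₀ : signVec a x₀ = κ) (hy : y ∈ flat a κ) :
    ∃ x τ, IsGenericLine a κ x y τ := by
  have hfin := Fintype.ofFinite ι
  -- For `h`, `h'` nonzero on `κ`, the form indexed by `(h, h')` vanishes at `x` exactly when the
  -- two crossing times agree. Genericity of `x` then makes it vanish on the whole flat, so
  -- hyperplanes crossed at the same positive time cut out the same subspace of the flat.
  obtain ⟨x, hx, h1, h2⟩ := exists_generic (a := a) (flat a κ)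
    (fun p : ι × ι => a p.1 y • a p.2 - a p.2 y • a p.1) Finset.univ (hx₀ ▸ mem_flat_signVec x₀)
  have hsx : signVec a x = κ := by
    funext h
    by_cases hh : κ h = 0
    · rw [hh, signVec_eq_zero]; exact mem_flat.mp hx h hh
    · rw [h1 h fun h0 => hh (hx₀ ▸ signVec_eq_zero.mpr h0), hx₀]
  have hax : ∀ h, κ h ≠ 0 → a h x ≠ 0 := fun h hh h0 =>
    hh (hsx ▸ signVec_eq_zero.mpr h0)
  have htime : ∀ h, κ h ≠ 0 → a h y = a h y / a h x * a h x := fun h hh => by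
    rw [div_mul_cancel₀ _ (hax h hh)]
  refine ⟨x, fun h => a h y / a h x, hsx, hy, htime, fun h h' hh hh' heq hpos v hv hav => ?_⟩
  have hay : a h y ≠ 0 := fun h0 => by simp [h0] at hpos
  by_contra hne
  refine h2 (h, h') (Finset.mem_univ _) ⟨v, hv, ?_⟩ ?_
  · simp [hav, hay, hne]
  · have e1 := htime h hh
    have e2 := htime h' hh'
    simp only [LinearMap.sub_apply, LinearMap.smul_apply, smul_eq_mul]
    rw [e1, e2, ← heq]
    ring

/-- A point at which the line leaves the cone exhibits a facet. -/
theorem IsGenericLine.exists_lineFacet [Finite ι] (hl : IsGenericLine a κ x y τ) {h₀ : ι}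
    (hh₀ : κ h₀ ≠ 0) (hτ : 0 < τ h₀) {p : W} (hp : Conf (signVec a p) κ) (hp₀ : a h₀ p = 0)
    (η : ℝ) (hη : η ≠ 0) (hpη : ∀ h, a h p = 0 → κ h ≠ 0 → 0 ≤ η * (τ h - τ h₀)) :
    ∃ w, signVec a w = lineFacet κ τ (τ h₀) := by
  -- The vector `y - τ h₀ • x` lies in all hyperplanes crossed at time `τ h₀`. A small step along
  -- it, with the sign of `η`, pushes `p` to the side of `κ` of every other hyperplane containing
  -- `p`, by `hpη`.
  obtain ⟨δ, _, hδ⟩ := exists_signVec_add_smul (a := a) p (η • (y - τ h₀ • x))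
  refine ⟨_, funext fun h => (hδ h).trans ?_⟩
  have hpL := hp.mem_flat
  unfold lineFacet
  by_cases hh : κ h = 0
  · have h1 : signVec a p h = 0 := hp.zero hh
    have hx : a h x = 0 := by rw [← signVec_eq_zero, hl.sign_x, hh]
    have hy := mem_flat.mp hl.mem_y h hh
    rw [if_pos h1, if_neg (by simp [hh]), hh, signVec_eq_zero]
    simp [hx, hy]
  by_cases hp0 : a h p = 0
  · rw [if_pos (signVec_eq_zero.mpr hp0)]
    have h2 := hpη h hp0 hh
    have h3 : signVec a (η • (y - τ h₀ • x)) h = SignType.sign (η * (τ h - τ h₀)) * κ h := by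
      rw [signVec, map_smul, smul_eq_mul, sign_mul, hl.sign_sub hh, sign_mul, mul_assoc]
    rw [h3]
    by_cases he : τ h = τ h₀
    · rw [if_pos ⟨hh, he⟩, he, sub_self, mul_zero, sign_zero, zero_mul]
    · rw [if_neg (by simp [he]), sign_pos, one_mul]
      exact lt_of_le_of_ne h2 (mul_ne_zero hη (sub_ne_zero.mpr he)).symm
  · have h1 : signVec a p h ≠ 0 := fun h0 => hp0 (signVec_eq_zero.mp h0)
    rw [if_neg h1, if_neg, hp.eq_of_ne h1]
    rintro ⟨_, he⟩
    exact hp0 (hl.prop h₀ h hh₀ hh he.symm hτ p hpL hp₀)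

theorem IsGenericLine.rk_lineFacet [FiniteDimensional ℝ W] (hl : IsGenericLine a κ x y τ)
    {h₀ : ι} (hh₀ : κ h₀ ≠ 0) (hτ : 0 < τ h₀) :
    rk a κ = rk a (lineFacet κ τ (τ h₀)) + 1 := by
  have hx0 : a h₀ x ≠ 0 := fun h0 => hh₀ (hl.sign_x ▸ signVec_eq_zero.mpr h0)
  have hxL : x ∈ flat a κ := hl.sign_x ▸ mem_flat_signVec x
  have : flat a (lineFacet κ τ (τ h₀)) = flat a κ ⊓ LinearMap.ker (a h₀) := by
    ext v
    rw [Submodule.mem_inf, LinearMap.mem_ker]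
    constructor
    · intro hv
      exact ⟨(conf_lineFacet κ τ _).flat_le hv, mem_flat.mp hv h₀ (by simp [lineFacet])⟩
    · rintro ⟨hv, hv₀⟩
      refine mem_flat.mpr fun h hh => ?_
      unfold lineFacet at hh
      split_ifs at hh with hc
      · exact hl.prop h₀ h hh₀ hc.1 hc.2.symm hτ v hv hv₀
      · exact mem_flat.mp hv h hh
  rw [rk, rk, this, finrank_inf_ker _ _ hxL hx0]

-- Filter the faces by the earliest time `c` at which the line crosses one of their hyperplanes. The
-- faces first met at time `c` all lie in one facet `κc` of `κ`, and among the faces of `κc` they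
-- form the sweep set for the viewpoint `y - c • x`; this is exact by induction on the dimension. At
-- the latest crossing of a hyperplane through `g`, only `κ` itself and one facet remain, and they
-- cancel.
set_option maxHeartbeats 1000000 in
theorem IsIncidence.exactOn_sweepSet [Finite ι] [FiniteDimensional ℝ W]
    (hε : IsIncidence a R ε) {g : ι → SignType} (hgR : g ∈ R) : ∀ (N : ℕ) {κ : ι → SignType} {y : W},
    rk a κ ≤ N → κ ∈ R → Conf g κ → y ∈ flat a κ →
    (∃ h, g h = 0 ∧ κ h ≠ 0 ∧ signVec a y h = κ h) → ExactOn ε (sweepSet a R κ g y) := by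
  have hfin := Fintype.ofFinite ι
  intro N
  induction N with
  | zero =>
    rintro κ y hN hκ hgκ hy ⟨h, hg0, hκ0, hs⟩
    exfalso
    have h0 : flat a κ = ⊥ := Submodule.finrank_eq_zero.mp (Nat.le_zero.mp hN)
    rw [h0, Submodule.mem_bot] at hy
    rw [hy, signVec_zero] at hs
    exact hκ0 hs.symm
  | succ N ih =>
    rintro κ y hN hκ hgκ hy hex
    obtain ⟨x₀, hx₀⟩ := hε.real κ hκ
    obtain ⟨x, τ, hl⟩ := IsGenericLine.exists hx₀ hy
    obtain ⟨pg, hpg⟩ := hε.real g hgR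
    -- the hyperplane that is crossed last
    obtain ⟨hm, hmH, hmax⟩ := (Finset.univ.filter fun h => g h = 0 ∧ κ h ≠ 0 ∧
      signVec a y h = κ h).exists_max_image τ (by
        obtain ⟨h, hh⟩ := hex; exact ⟨h, by simpa using hh⟩)
    simp only [Finset.mem_filter, Finset.mem_univ, true_and] at hmH hmax
    obtain ⟨hmg, hmκ, hmy⟩ := hmH
    have hmpos : 0 < τ hm := (hl.sign_y hmκ).mp hmy
    have hle : ∀ h, g h = 0 → κ h ≠ 0 → τ h ≤ τ hm := fun h h1 h2 => by
      by_cases h3 : 0 < τ h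
      · exact hmax h ⟨h1, h2, (hl.sign_y h2).mpr h3⟩
      · linarith
    -- Including `hm` gives the cone `κ`, which lies in no further hyperplane, the last time `τ hm`;
    -- it thus falls into the same fiber as the last facet.
    let Z : (ι → SignType) → Finset ι := fun s =>
      insert hm (Finset.univ.filter fun h => s h = 0 ∧ κ h ≠ 0)
    let φ : (ι → SignType) → ℝ := fun s => (Z s).inf' (Finset.insert_nonempty _ _) τ
    have hQR : sweepSet a R κ g y ⊆ R := fun s hs => (mem_sweepSet.mp hs).1
    have hmono : ∀ s ∈ sweepSet a R κ g y, ∀ t ∈ sweepSet a R κ g y, ε s t ≠ 0 → φ t ≤ φ s := by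
      intro s hs t ht hst
      have hc := ((hε.ne_zero_iff s (hQR hs) t (hQR ht)).mp hst).1
      refine Finset.inf'_mono τ ?_ _
      refine Finset.insert_subset_insert _ fun h hh => ?_
      simp only [Finset.mem_filter, Finset.mem_univ, true_and] at hh ⊢
      exact ⟨hc.zero hh.1, hh.2⟩
    have hsq : SqZero ε (sweepSet a R κ g y) := by
      refine hε.sqZero_of_convex hQR fun s hs u hu t ht hut hts => ?_
      rw [mem_sweepSet] at hs hu ⊢
      exact ⟨ht, hu.2.1.trans hut, hts.trans hs.2.2.1,
        fun h h0 h1 => hu.2.2.2 h (hut.zero h0) h1⟩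
    refine ExactOn.of_fibers φ _ le_rfl hmono hsq fun c => ?_
    have hφle : ∀ s h, s h = 0 → κ h ≠ 0 → φ s ≤ τ h := fun s h h1 h2 =>
      Finset.inf'_le τ (by simp [Z, h1, h2])
    have hφm : ∀ s, φ s ≤ τ hm := fun s => Finset.inf'_le τ (by simp [Z])
    have hφex : ∀ s, φ s = τ hm ∨ ∃ h, s h = 0 ∧ κ h ≠ 0 ∧ φ s = τ h := fun s => by
      obtain ⟨h, hh, he⟩ := Finset.exists_mem_eq_inf' (s := Z s) (Finset.insert_nonempty _ _) τ
      rcases Finset.mem_insert.mp hh with rfl | hh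
      · exact Or.inl he
      · simp only [Finset.mem_filter, Finset.mem_univ, true_and] at hh
        exact Or.inr ⟨h, hh.1, hh.2, he⟩
    -- once a face lies in one hyperplane crossed at time `c`, it lies in all of them
    have hprop : ∀ s ∈ R, Conf s κ → ∀ h, s h = 0 → κ h ≠ 0 → 0 < τ h →
        Conf s (lineFacet κ τ (τ h)) := by
      intro s hs hsκ h h0 h1 h2 h'
      obtain ⟨w, rfl⟩ := hε.real s hs
      by_cases hc : κ h' ≠ 0 ∧ τ h' = τ h
      · left
        rw [signVec_eq_zero]
        exact hl.prop h h' h1 hc.1 hc.2.symm h2 w hsκ.mem_flat (signVec_eq_zero.mp h0)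
      · simp only [lineFacet, if_neg hc]
        exact hsκ h'
    by_cases hcm : c = τ hm
    · subst hcm
      -- the last facet forms an acyclic pair with `κ`
      obtain ⟨w, hw⟩ := hl.exists_lineFacet hmκ hmpos (p := pg) (hpg.symm ▸ hgκ)
        (signVec_eq_zero.mp (hpg.symm ▸ hmg)) (-1) (by norm_num) fun h h1 h2 => by
          have := hle h (hpg ▸ signVec_eq_zero.mpr h1) h2
          linarith
      set κm := lineFacet κ τ (τ hm) with hκm
      have hconf : Conf κm κ := conf_lineFacet κ τ _
      have hκmR : κm ∈ R := hw ▸ hε.down κ hκ w (hw.symm ▸ hconf)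
      have hrk : rk a κ = rk a κm + 1 := hl.rk_lineFacet hmκ hmpos
      have hne : κ ≠ κm := fun h => by
        rw [← h] at hrk; omega
      have hzero : ∀ h, κm h = 0 → κ h ≠ 0 → τ h = τ hm := fun h h1 h2 => by
        rw [hκm, lineFacet] at h1
        split_ifs at h1 with hc
        · exact hc.2
        · exact absurd h1 h2
      have hgκm : Conf g κm := hprop g hgR hgκ hm hmg hmκ hmpos
      have hset : (sweepSet a R κ g y).filter (fun s => φ s = τ hm) = {κ, κm} := by
        ext s
        rw [Finset.mem_filter, mem_sweepSet, Finset.mem_insert, Finset.mem_singleton]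
        constructor
        · rintro ⟨⟨hsR, hgs, hsκ, hsy⟩, hφs⟩
          by_cases hz : ∃ h, s h = 0 ∧ κ h ≠ 0
          · right
            obtain ⟨h, h1, h2⟩ := hz
            have heq : ∀ h, s h = 0 → κ h ≠ 0 → τ h = τ hm := fun h h1 h2 =>
              le_antisymm (hle h (hgs.zero h1) h2) (hφs ▸ hφle s h h1 h2)
            have hs1 := hprop s hsR hsκ h h1 h2 (heq h h1 h2 ▸ hmpos)
            rw [heq h h1 h2] at hs1
            refine hs1.antisymm fun h' => ?_
            by_cases h3 : s h' = 0
            · by_cases h4 : κ h' = 0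
              · left; exact hconf.zero h4
              · left
                exact if_pos ⟨h4, heq h' h3 h4⟩
            · right; exact (hs1.eq_of_ne h3).symm
          · left
            push Not at hz
            refine hsκ.antisymm fun h => ?_
            by_cases h1 : s h = 0
            · exact Or.inl (hz h h1)
            · exact Or.inr (hsκ.eq_of_ne h1).symm
        · rintro (rfl | rfl)
          · refine ⟨⟨hκ, hgκ, Conf.refl _, fun h h0 h1 => absurd h0 h1⟩, ?_⟩
            rcases hφex s with h | ⟨h, h1, h2, _⟩
            · exact h
            · exact absurd h1 h2
          · refine ⟨⟨hκmR, hgκm, hconf, fun h h0 h1 => ?_⟩, ?_⟩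
            · rw [hl.sign_y h1, hzero h h0 h1]; exact hmpos
            · rcases hφex κm with h | ⟨h, h1, h2, h3⟩
              · exact h
              · rw [h3, hzero h h1 h2]
      rw [hset]
      have h0 : ∀ s ∈ R, ∀ t ∈ R, rk a s ≠ rk a t + 1 → ε s t = 0 := fun s hs t ht h => by
        by_contra hne
        exact h ((hε.ne_zero_iff s hs t ht).mp hne).2
      exact exactOn_pair hne ((hε.ne_zero_iff κ hκ κm hκmR).mpr ⟨hconf, hrk⟩)
        (h0 _ hκmR _ hκ (by omega)) (h0 _ hκ _ hκ (by omega)) (h0 _ hκmR _ hκmR (by omega))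
    · rcases ((sweepSet a R κ g y).filter fun s => φ s = c).eq_empty_or_nonempty with he | ⟨s₀, hs₀⟩
      · rw [he]; exact exactOn_empty
      rw [Finset.mem_filter, mem_sweepSet] at hs₀
      obtain ⟨⟨hs₀R, hgs₀, hs₀κ, hs₀y⟩, hφs₀⟩ := hs₀
      obtain ⟨h₀, h01, h02, h03⟩ := (hφex s₀).resolve_left fun h => hcm (hφs₀.symm.trans h)
      rw [hφs₀] at h03
      subst h03
      have hcpos : 0 < τ h₀ := (hl.sign_y h02).mp (hs₀y h₀ h01 h02)
      have hclt : τ h₀ < τ hm := lt_of_le_of_ne (hφs₀ ▸ hφm s₀) hcm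
      obtain ⟨p, hp⟩ := hε.real s₀ hs₀R
      obtain ⟨w, hw⟩ := hl.exists_lineFacet h02 hcpos (p := p) (hp.symm ▸ hs₀κ)
        (signVec_eq_zero.mp (hp.symm ▸ h01)) 1 one_ne_zero fun h h1 h2 => by
          have := hφle s₀ h (hp ▸ signVec_eq_zero.mpr h1) h2
          rw [hφs₀] at this
          linarith
      set κc := lineFacet κ τ (τ h₀) with hκc
      have hconf : Conf κc κ := conf_lineFacet κ τ _
      have hκcR : κc ∈ R := hw ▸ hε.down κ hκ w (hw.symm ▸ hconf)
      have hrk : rk a κ = rk a κc + 1 := hl.rk_lineFacet h02 hcpos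
      have hgκc : Conf g κc := hgs₀.trans (hprop s₀ hs₀R hs₀κ h₀ h01 h02 hcpos)
      have hκc0 : κc h₀ = 0 := by simp [hκc, lineFacet]
      have hκcne : ∀ h, κ h ≠ 0 → τ h ≠ τ h₀ → κc h = κ h := fun h _ h2 => by
        simp [hκc, lineFacet, h2]
      have hκcne' : ∀ h, κc h ≠ 0 → κ h ≠ 0 ∧ τ h ≠ τ h₀ := fun h h1 => by
        by_contra hc
        apply h1
        by_cases h2 : κ h = 0
        · exact hconf.zero h2
        · have : τ h = τ h₀ := by by_contra h3; exact hc ⟨h2, h3⟩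
          simp [hκc, lineFacet, this]
      -- A face of `κc` has earliest crossing time exactly `τ h₀` when its remaining hyperplanes are
      -- crossed strictly later, that is, when `y - τ h₀ • x` is still on the side of `κ`.
      have hset : (sweepSet a R κ g y).filter (fun s => φ s = τ h₀) =
          sweepSet a R κc g (y - τ h₀ • x) := by
        ext s
        rw [Finset.mem_filter, mem_sweepSet, mem_sweepSet]
        constructor
        · rintro ⟨⟨hsR, hgs, hsκ, hsy⟩, hφs⟩
          obtain ⟨h, h1, h2, h3⟩ := (hφex s).resolve_left fun h => hcm (hφs.symm.trans h)
          have hsκc := hprop s hsR hsκ h h1 h2 (h3 ▸ hφs.symm ▸ hcpos)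
          rw [← h3, hφs] at hsκc
          refine ⟨hsR, hgs, hsκc, fun h' h1' h2' => ?_⟩
          obtain ⟨h3', h4'⟩ := hκcne' h' h2'
          have h5 := hφle s h' h1' h3'
          rw [hφs] at h5
          rw [signVec, hl.sign_sub h3', sign_pos (sub_pos.mpr (lt_of_le_of_ne h5 h4'.symm)),
            one_mul, hκcne h' h3' h4']
        · rintro ⟨hsR, hgs, hsκc, hsy⟩
          have hkey : ∀ h, s h = 0 → κ h ≠ 0 → τ h₀ ≤ τ h := fun h h1 h2 => by
            by_cases h3 : τ h = τ h₀
            · exact h3.ge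
            · have h4 := hκcne h h2 h3
              have h5 := hsy h h1 (h4.symm ▸ h2)
              rw [signVec, hl.sign_sub h2, h4] at h5
              have h6 : SignType.sign (τ h - τ h₀) = 1 := by
                revert h5 h2
                generalize SignType.sign (τ h - τ h₀) = u
                generalize κ h = v
                revert u v
                decide
              exact (sub_pos.mp (sign_eq_one_iff.mp h6)).le
          refine ⟨⟨hsR, hgs, hsκc.trans hconf, fun h h1 h2 => ?_⟩, ?_⟩
          · exact (hl.sign_y h2).mpr (hcpos.trans_le (hkey h h1 h2))
          · refine le_antisymm (hφle s h₀ (hsκc.zero hκc0) h02) ?_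
            rcases hφex s with h | ⟨h, h1, h2, h3⟩
            · rw [h]; exact hclt.le
            · rw [h3]; exact hkey h h1 h2
      rw [hset]
      -- The hyperplane `hm` is crossed after time `τ h₀`, so it witnesses the nondegeneracy
      -- hypothesis for the facet.
      refine ih (by omega) hκcR hgκc ?_ ⟨hm, hmg, ?_, ?_⟩
      · refine mem_flat.mpr fun h hh => ?_
        by_cases h1 : κ h = 0
        · have hx : a h x = 0 := by rw [← signVec_eq_zero, hl.sign_x, h1]
          rw [map_sub, map_smul, hx, mem_flat.mp hl.mem_y h h1]; simp
        · have h2 : τ h = τ h₀ := by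
            by_contra h2; exact h1 (hκcne h h1 h2 ▸ hh)
          have := hl.sign_sub h1 (τ h₀)
          rw [h2, sub_self, sign_zero, zero_mul] at this
          exact sign_eq_zero_iff.mp this
      · rw [hκcne hm hmκ hclt.ne']; exact hmκ
      · rw [signVec, hl.sign_sub hmκ, sign_pos (sub_pos.mpr hclt), one_mul,
          hκcne hm hmκ hclt.ne']

end Sweep

/-! ### Exactness of subdivided pointed cones -/

section Region

variable {ι W k : Type*} [AddCommGroup W] [Module ℝ W] [Field k]

/-- The sign conditions describing a region: nonnegative on `Np`, nonpositive on `Nm`. -/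
def SignCond (Np Nm : Finset ι) (s : ι → SignType) : Prop :=
  (∀ h ∈ Np, 0 ≤ s h) ∧ ∀ h ∈ Nm, s h ≤ 0

theorem SignCond.conf {Np Nm : Finset ι} {s t : ι → SignType} (hs : SignCond Np Nm s)
    (hts : Conf t s) : SignCond Np Nm t := by
  constructor <;> intro h hh <;> rcases hts h with h' | h' <;> rw [h']
  · exact hs.1 h hh
  · exact hs.2 h hh

variable {a : ι → W →ₗ[ℝ] ℝ}

theorem zero_le_signVec {w : W} {h : ι} : 0 ≤ signVec a w h ↔ 0 ≤ a h w := sign_nonneg_iff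

theorem signVec_le_zero {w : W} {h : ι} : signVec a w h ≤ 0 ↔ a h w ≤ 0 := sign_nonpos_iff

theorem signCond_signVec {Np Nm : Finset ι} {w : W} : SignCond Np Nm (signVec a w) ↔
    (∀ h ∈ Np, 0 ≤ a h w) ∧ ∀ h ∈ Nm, a h w ≤ 0 := by
  simp only [SignCond, zero_le_signVec, signVec_le_zero]

variable [Fintype ι]

/-- The sign vectors of all cones in a region. -/
noncomputable def region (a : ι → W →ₗ[ℝ] ℝ) (Np Nm : Finset ι) : Finset (ι → SignType) :=
  Finset.univ.filter fun s => (∃ w, signVec a w = s) ∧ SignCond Np Nm s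

theorem mem_region {Np Nm : Finset ι} {s : ι → SignType} :
    s ∈ region a Np Nm ↔ (∃ w, signVec a w = s) ∧ SignCond Np Nm s := by
  simp [region]

theorem signVec_mem_region {Np Nm : Finset ι} {w : W} : signVec a w ∈ region a Np Nm ↔
    (∀ h ∈ Np, 0 ≤ a h w) ∧ ∀ h ∈ Nm, a h w ≤ 0 := by
  rw [mem_region, signCond_signVec]; simp

theorem zero_mem_region {Np Nm : Finset ι} : (0 : ι → SignType) ∈ region a Np Nm := by
  rw [← signVec_zero (a := a), signVec_mem_region]; simp

theorem region_down {Np Nm : Finset ι} : ∀ s ∈ region a Np Nm, ∀ w, Conf (signVec a w) s →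
    signVec a w ∈ region a Np Nm :=
  fun _ hs w hw => mem_region.mpr ⟨⟨w, rfl⟩, (mem_region.mp hs).2.conf hw⟩

theorem region_mono {Np Nm Np' Nm' : Finset ι} (hp : Np ⊆ Np') (hm : Nm ⊆ Nm') :
    region a Np' Nm' ⊆ region a Np Nm := fun _ hs =>
  mem_region.mpr ⟨(mem_region.mp hs).1, fun h hh => (mem_region.mp hs).2.1 h (hp hh),
    fun h hh => (mem_region.mp hs).2.2 h (hm hh)⟩

/-- A region in which every form has constant sign: the faces of a single cone. -/
theorem exactOn_region_of_union_eq_univ [FiniteDimensional ℝ W]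
    {ε : (ι → SignType) → (ι → SignType) → k} {Np Nm : Finset ι}
    (hε : IsIncidence a (region a Np Nm) ε) (hu : ∀ h, h ∈ Np ∨ h ∈ Nm)
    (hne : ∃ s ∈ region a Np Nm, s ≠ 0) : ExactOn ε (region a Np Nm) := by
  choose! r hr using fun s (hs : s ∈ region a Np Nm) => (mem_region.mp hs).1
  -- The sum of one representative per cone: since no form changes sign on the region, nothing
  -- cancels, and the sum is interior to the largest cone.
  set w := ∑ s ∈ region a Np Nm, r s with hw
  have hp : ∀ s ∈ region a Np Nm, ∀ h ∈ Np, 0 ≤ a h (r s) := fun s hs h hh =>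
    (signVec_mem_region.mp ((hr s hs).symm ▸ hs)).1 h hh
  have hm : ∀ s ∈ region a Np Nm, ∀ h ∈ Nm, a h (r s) ≤ 0 := fun s hs h hh =>
    (signVec_mem_region.mp ((hr s hs).symm ▸ hs)).2 h hh
  have hκ : signVec a w ∈ region a Np Nm := by
    rw [signVec_mem_region]
    refine ⟨fun h hh => ?_, fun h hh => ?_⟩ <;> rw [hw, map_sum]
    · exact Finset.sum_nonneg fun s hs => hp s hs h hh
    · exact Finset.sum_nonpos fun s hs => hm s hs h hh
  have hle : ∀ s ∈ region a Np Nm, Conf s (signVec a w) := by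
    intro s hs h
    by_cases h0 : s h = 0
    · exact Or.inl h0
    right
    have h1 : a h (r s) ≠ 0 := fun h1 => h0 (by rw [← hr s hs, signVec_eq_zero, h1])
    conv_lhs => rw [← hr s hs]
    rw [signVec, signVec, hw, map_sum]
    rcases hu h with hh | hh
    · rw [sign_pos (lt_of_le_of_ne (hp s hs h hh) h1.symm), sign_pos]
      exact Finset.sum_pos' (fun t ht => hp t ht h hh)
        ⟨s, hs, lt_of_le_of_ne (hp s hs h hh) h1.symm⟩
    · rw [sign_neg (lt_of_le_of_ne (hm s hs h hh) h1), sign_neg]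
      rw [← neg_pos, ← Finset.sum_neg_distrib]
      exact Finset.sum_pos' (fun t ht => neg_nonneg.mpr (hm t ht h hh))
        ⟨s, hs, neg_pos.mpr (lt_of_le_of_ne (hm s hs h hh) h1)⟩
  have hset : region a Np Nm = sweepSet a (region a Np Nm) (signVec a w) 0 w := by
    ext s
    rw [mem_sweepSet]
    exact ⟨fun hs => ⟨hs, conf_zero _, hle s hs, fun _ _ _ => rfl⟩, fun hs => hs.1⟩
  -- The viewpoint is an interior point of the cone and `g = 0`, so the sweep set is the whole face
  -- poset.
  rw [hset]
  refine hε.exactOn_sweepSet zero_mem_region _ le_rfl hκ (conf_zero _) (mem_flat_signVec w) ?_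
  obtain ⟨s, hs, hs0⟩ := hne
  obtain ⟨h, hh⟩ := Function.ne_iff.mp hs0
  exact ⟨h, rfl, (hle s hs).eq_of_ne hh ▸ hh, rfl⟩

/-- The cones of a pointed region form an exact complex. -/
theorem exactOn_region [FiniteDimensional ℝ W] {ε : (ι → SignType) → (ι → SignType) → k} (h₀ : ι) :
    ∀ (N : ℕ) {Np Nm : Finset ι}, (Finset.univ.filter fun h => ¬ (h ∈ Np ∨ h ∈ Nm)).card ≤ N →
    IsIncidence a (region a Np Nm) ε → h₀ ∈ Np → (∀ s ∈ region a Np Nm, s h₀ = 0 → s = 0) →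
    (∃ s ∈ region a Np Nm, s ≠ 0) → ExactOn ε (region a Np Nm) := by
  intro N
  induction N with
  | zero =>
    intro Np Nm hN hε _ _ hne
    refine exactOn_region_of_union_eq_univ hε (fun h => ?_) hne
    by_contra hh
    rw [Nat.le_zero, Finset.card_eq_zero] at hN
    have : h ∈ (∅ : Finset ι) := hN ▸ Finset.mem_filter.mpr ⟨Finset.mem_univ _, hh⟩
    simp at this
  | succ N ih =>
    intro Np Nm hN hε h₀p hpt hne
    by_cases hall : ∀ h, h ∈ Np ∨ h ∈ Nm
    · exact exactOn_region_of_union_eq_univ hε hall hne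
    push Not at hall
    obtain ⟨h, hhp, hhm⟩ := hall
    have hcard : ∀ {Np' Nm' : Finset ι}, Np ⊆ Np' → Nm ⊆ Nm' → (h ∈ Np' ∨ h ∈ Nm') →
        (Finset.univ.filter fun h => ¬ (h ∈ Np' ∨ h ∈ Nm')).card ≤ N := by
      intro Np' Nm' h1 h2 h3
      have : (Finset.univ.filter fun h => ¬ (h ∈ Np' ∨ h ∈ Nm')) ⊂
          Finset.univ.filter fun h => ¬ (h ∈ Np ∨ h ∈ Nm) := by
        refine ⟨fun i hi => ?_, fun hsub => ?_⟩
        · simp only [Finset.mem_filter, Finset.mem_univ, true_and] at hi ⊢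
          exact fun hc => hi (hc.imp (@h1 i) (@h2 i))
        · have := hsub (Finset.mem_filter.mpr ⟨Finset.mem_univ h, by simp [hhp, hhm]⟩)
          exact (Finset.mem_filter.mp this).2 h3
      have := Finset.card_lt_card this
      omega
    have hex : ∀ {Np' Nm' : Finset ι}, Np ⊆ Np' → Nm ⊆ Nm' → (h ∈ Np' ∨ h ∈ Nm') →
        (∃ s ∈ region a Np' Nm', s ≠ 0) → ExactOn ε (region a Np' Nm') :=
      fun h1 h2 h3 h4 => ih (hcard h1 h2 h3) (hε.mono (region_mono h1 h2) region_down) (h1 h₀p)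
        (fun s hs => hpt s (region_mono h1 h2 hs)) h4
    set Np' := insert h Np with hNp'
    set Nm' := insert h Nm with hNm'
    have hp : Np ⊆ Np' := Finset.subset_insert _ _
    have hm : Nm ⊆ Nm' := Finset.subset_insert _ _
    have hhp' : h ∈ Np' := Finset.mem_insert_self _ _
    have hhm' : h ∈ Nm' := Finset.mem_insert_self _ _
    have hmemp : ∀ {Nm} s, s ∈ region a Np Nm → 0 ≤ s h → s ∈ region a Np' Nm := by
      intro Nm s hs h0
      refine mem_region.mpr ⟨(mem_region.mp hs).1, fun i hi => ?_, (mem_region.mp hs).2.2⟩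
      rcases Finset.mem_insert.mp hi with rfl | hi
      · exact h0
      · exact (mem_region.mp hs).2.1 i hi
    have hmemm : ∀ {Np} s, s ∈ region a Np Nm → s h ≤ 0 → s ∈ region a Np Nm' := by
      intro Np s hs h0
      refine mem_region.mpr ⟨(mem_region.mp hs).1, (mem_region.mp hs).2.1, fun i hi => ?_⟩
      rcases Finset.mem_insert.mp hi with rfl | hi
      · exact h0
      · exact (mem_region.mp hs).2.2 i hi
    -- Mayer–Vietoris along the hyperplane `h`. The zero cone alone does not form an exact complex,
    -- so the case in which the two halves share only that cone has to be treated separately.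
    by_cases h0 : ∃ s ∈ region a Np' Nm', s ≠ 0
    · have e0 := hex hp hm (Or.inl hhp') h0
      obtain ⟨s0, hs0, hs0'⟩ := h0
      have ep := hex hp (Finset.Subset.refl Nm) (Or.inl hhp')
        ⟨s0, region_mono (Finset.Subset.refl _) hm hs0, hs0'⟩
      have em := hex (Finset.Subset.refl Np) hm (Or.inr hhm')
        ⟨s0, region_mono hp (Finset.Subset.refl _) hs0, hs0'⟩
      set D := region a Np Nm' \ region a Np' Nm' with hD
      have hDneg : ∀ s ∈ D, s h < 0 := by
        intro s hs
        rw [hD, Finset.mem_sdiff] at hs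
        by_contra hc
        exact hs.2 (hmemp s hs.1 (not_lt.mp hc))
      have hDX : D ⊆ region a Np Nm := fun s hs =>
        region_mono (Finset.Subset.refl _) hm (Finset.mem_sdiff.mp hs).1
      have hvan : ∀ s ∈ region a Np' Nm, ∀ t ∈ D, ε s t = 0 := by
        intro s hs t ht
        by_contra hst
        have h1 := ((hε.ne_zero_iff s (region_mono hp (Finset.Subset.refl _) hs) t
          (hDX ht)).mp hst).1
        have h2 := hDneg t ht
        have h3 := (mem_region.mp hs).2.1 h hhp'
        rw [h1.eq_of_ne h2.ne] at h2
        exact absurd h3 (not_le.mpr h2)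
      have hsplit : region a Np' Nm' ∪ D = region a Np Nm' :=
        Finset.union_sdiff_of_subset (region_mono hp (Finset.Subset.refl _))
      have hX : region a Np' Nm ∪ D = region a Np Nm := by
        ext s
        rw [Finset.mem_union]
        constructor
        · rintro (hs | hs)
          · exact region_mono hp (Finset.Subset.refl _) hs
          · exact hDX hs
        · intro hs
          by_cases h1 : 0 ≤ s h
          · exact Or.inl (hmemp s hs h1)
          · refine Or.inr (Finset.mem_sdiff.mpr ⟨hmemm s hs (not_le.mp h1).le, fun h2 => h1 ?_⟩)
            exact (mem_region.mp h2).2.1 h hhp'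
      -- `D`, the part strictly on the negative side, is the quotient of the negative half by the
      -- intersection, and also the quotient of the whole region by the positive half.
      have eD : ExactOn ε D := by
        refine ExactOn.of_union (Q₁ := region a Np' Nm') Finset.disjoint_sdiff
          (fun s hs => hvan s (region_mono (Finset.Subset.refl _) hm hs)) ?_ ?_ e0
        · rw [hsplit]
          exact (hε.mono (region_mono (Finset.Subset.refl _) hm) region_down).sqZero
        · rw [hsplit]; exact em
      rw [← hX]
      refine ExactOn.union ?_ hvan (hX.symm ▸ hε.sqZero) ep eD
      refine Finset.disjoint_left.mpr fun s hs hsD => ?_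
      exact absurd ((mem_region.mp hs).2.1 h hhp') (not_le.mpr (hDneg s hsD))
    · -- the region lies on one side of the hyperplane
      push Not at h0
      have hone : (∀ s ∈ region a Np Nm, 0 ≤ s h) ∨ ∀ s ∈ region a Np Nm, s h ≤ 0 := by
        by_contra hc
        push Not at hc
        obtain ⟨⟨s, hs, hsh⟩, t, ht, hth⟩ := hc
        obtain ⟨u, rfl⟩ := (mem_region.mp hs).1
        obtain ⟨v, rfl⟩ := (mem_region.mp ht).1
        have hu : a h u < 0 :=
          not_le.mp fun hc => absurd (zero_le_signVec.mpr hc) (not_le.mpr hsh)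
        have hv : 0 < a h v :=
          not_le.mp fun hc => absurd (signVec_le_zero.mpr hc) (not_le.mpr hth)
        rw [signVec_mem_region] at hs ht
        -- With points on both sides, this positive combination lies in the hyperplane `h`. Its cone
        -- must be zero, so `h₀` vanishes at `u`, and pointedness gives the contradiction.
        have hmem : signVec a (a h v • u + (-a h u) • v) ∈ region a Np' Nm' := by
          have hz : a h (a h v • u + (-a h u) • v) = 0 := by
            simp only [map_add, map_smul, smul_eq_mul]; ring
          have hz' := signVec_eq_zero.mpr hz
          refine hmemp _ (hmemm _ (signVec_mem_region.mpr ⟨fun i hi => ?_, fun i hi => ?_⟩)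
            hz'.le) hz'.ge
          · have h1 := mul_nonneg hv.le (hs.1 i hi)
            have h2 := mul_nonneg (neg_nonneg.mpr hu.le) (ht.1 i hi)
            simp only [map_add, map_smul, smul_eq_mul]
            linarith
          · have h1 := mul_nonpos_of_nonneg_of_nonpos hv.le (hs.2 i hi)
            have h2 := mul_nonpos_of_nonneg_of_nonpos (neg_nonneg.mpr hu.le) (ht.2 i hi)
            simp only [map_add, map_smul, smul_eq_mul]
            linarith
        have h1 : a h₀ (a h v • u + (-a h u) • v) = 0 :=
          signVec_eq_zero.mp (congrFun (h0 _ hmem) h₀)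
        simp only [map_add, map_smul, smul_eq_mul] at h1
        have h2 : 0 ≤ a h₀ u := hs.1 h₀ h₀p
        have h3 : 0 ≤ a h₀ v := ht.1 h₀ h₀p
        have h4 : a h₀ u = 0 := by nlinarith [mul_nonneg hv.le h2, mul_nonneg (neg_nonneg.mpr hu.le) h3]
        have h5 := congrFun (hpt _ (signVec_mem_region.mpr hs) (signVec_eq_zero.mpr h4)) h
        rw [h5] at hsh
        exact absurd hsh (lt_irrefl _)
      rcases hone with hone | hone
      · have : region a Np Nm = region a Np' Nm := le_antisymm (fun s hs => hmemp s hs (hone s hs))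
          (region_mono hp (Finset.Subset.refl _))
        rw [this] at hne ⊢
        exact hex hp (Finset.Subset.refl _) (Or.inl hhp') hne
      · have : region a Np Nm = region a Np Nm' := le_antisymm (fun s hs => hmemm s hs (hone s hs))
          (region_mono (Finset.Subset.refl _) hm)
        rw [this] at hne ⊢
        exact hex (Finset.Subset.refl _) hm (Or.inr hhm') hne

end Region

/-! ### The diamond property of the face order -/

section Diamond

variable {ι W : Type*} [AddCommGroup W] [Module ℝ W] {a : ι → W →ₗ[ℝ] ℝ}

/-- A cone `t` between `u` and `s`, of codimension one in `s`, together with a vector `w` in its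
span that points from `u` into `t`, and a vector `w'` that points from `t` into `s`. -/
structure IsMiddle (a : ι → W →ₗ[ℝ] ℝ) (u t s : ι → SignType) (w w' : W) : Prop where
  real : ∃ p, signVec a p = t
  conf_left : Conf u t
  conf_right : Conf t s
  rk_eq : rk a t = rk a u + 1
  mem : w ∈ flat a t
  into : ∀ h, u h = 0 → t h ≠ 0 → signVec a w h = t h
  into' : ∀ h, t h = 0 → s h ≠ 0 → signVec a w' h = s h

theorem rk_eq_of_conf [FiniteDimensional ℝ W] {u t s : ι → SignType} (hut : Conf u t)
    (hts : Conf t s) (hne : u ≠ t) (hne' : t ≠ s) (ht : ∃ p, signVec a p = t)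
    (hs : ∃ p, signVec a p = s) (hrk : rk a s = rk a u + 2) : rk a t = rk a u + 1 := by
  obtain ⟨p, hp⟩ := ht
  obtain ⟨q, hq⟩ := hs
  have h1 := rk_lt hut hne hp
  have h2 := rk_lt hts hne' hq
  omega

theorem Conf.eq_of_zero {t t' s : ι → SignType} (h : Conf t s) (h' : Conf t' s)
    (hz : ∀ i, t i = 0 ↔ t' i = 0) : t = t' := by
  funext i
  by_cases h0 : t i = 0
  · rw [h0, (hz i).mp h0]
  · rw [h.eq_of_ne h0, h'.eq_of_ne fun h1 => h0 ((hz i).mpr h1)]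

theorem sign_mul_eq_self {u v : SignType} (hv : v ≠ 0) : u * v = v ↔ u = 1 := by
  revert u v; decide

/-- Modulo the flat of `u`, the cone `s` is a planar cone, and a form `h` cuts the plane of `x` and
`v` in a line of slope `r h`. Extreme slopes bound the cone. The vector `η • (v - r hm • x)` runs
along the side of slope `r hm`, and the corresponding vector for the opposite extreme `hM` points
from that side into `s`. -/
theorem exists_isMiddle_of_slope [Finite ι] [FiniteDimensional ℝ W] {u s : ι → SignType}
    (hus : Conf u s) (hu : ∃ p, signVec a p = u) (hrk : rk a s = rk a u + 2)
    {x v : W} (hx : signVec a x = s) (hv : v ∈ flat a s) {r : ι → ℝ}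
    (hr : ∀ h, s h ≠ 0 → a h v = r h * a h x) {hm hM : ι}
    (hm1 : u hm = 0) (hm2 : s hm ≠ 0) (hM1 : u hM = 0) (hM2 : s hM ≠ 0)
    (η : ℝ) (hle : ∀ h, u h = 0 → s h ≠ 0 → 0 ≤ η * (r h - r hm)) (hlt : 0 < η * (r hM - r hm)) :
    ∃ t, IsMiddle a u t s (η • (v - r hm • x)) (-η • (v - r hM • x)) ∧
      ∀ h, t h = 0 ↔ u h = 0 ∧ (s h = 0 ∨ r h = r hm) := by
  obtain ⟨p, rfl⟩ := hu
  obtain ⟨δ, _, hδ⟩ := exists_signVec_add_smul (a := a) p (η • (v - r hm • x))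
  set t := signVec a (p + δ • η • (v - r hm • x)) with ht
  have hxL : x ∈ flat a s := hx ▸ mem_flat_signVec x
  have hη : η ≠ 0 := fun h0 => by simp [h0] at hlt
  have hsgn : ∀ (θ : ℝ) (c : ℝ) h, s h ≠ 0 → signVec a (θ • (v - c • x)) h =
      SignType.sign (θ * (r h - c)) * s h := fun θ c h hh => by
    have e : a h (θ • (v - c • x)) = θ * (r h - c) * a h x := by
      simp only [map_smul, map_sub, hr h hh, smul_eq_mul]; ring
    rw [signVec, e, sign_mul, ← hx]
    rfl
  have hsgn0 : ∀ h, s h = 0 → signVec a (η • (v - r hm • x)) h = 0 := fun h hh => by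
    rw [signVec_eq_zero, map_smul, map_sub, map_smul, mem_flat.mp hv h hh,
      mem_flat.mp hxL h hh]; simp
  have htz : ∀ h, t h = 0 ↔ signVec a p h = 0 ∧ (s h = 0 ∨ r h = r hm) := by
    intro h
    rw [hδ h]
    split_ifs with h0
    · by_cases hh : s h = 0
      · simp [hh, h0, hsgn0 h hh]
      · rw [hsgn η _ h hh]
        simp [h0, hh, sign_eq_zero_iff, hη, sub_eq_zero]
    · simp [h0]
  have hut : Conf (signVec a p) t := fun h => by
    rw [hδ h]
    split_ifs with h0
    · exact Or.inl h0
    · exact Or.inr rfl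
  have hts : Conf t s := fun h => by
    by_cases h1 : t h = 0
    · exact Or.inl h1
    right
    rw [hδ h]
    split_ifs with h0
    · have hh : s h ≠ 0 := fun hh => h1 ((htz h).mpr ⟨h0, Or.inl hh⟩)
      rw [hsgn η _ h hh, sign_mul_eq_self hh, sign_eq_one_iff]
      refine lt_of_le_of_ne (hle h h0 hh) (mul_ne_zero hη (sub_ne_zero.mpr fun he => ?_)).symm
      exact h1 ((htz h).mpr ⟨h0, Or.inr he⟩)
    · exact hus.eq_of_ne h0
  have htm : t hm = 0 := (htz hm).mpr ⟨hm1, Or.inr rfl⟩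
  have htM : t hM ≠ 0 := fun h0 => by
    rcases ((htz hM).mp h0).2 with h1 | h1
    · exact hM2 h1
    · simp [h1] at hlt
  refine ⟨t, ⟨⟨_, rfl⟩, hut, hts, ?_, ?_, ?_, ?_⟩, htz⟩
  · refine rk_eq_of_conf hut hts ?_ ?_ ⟨_, rfl⟩ ⟨x, hx⟩ hrk
    · intro h0; rw [← h0] at htM; exact htM hM1
    · intro h0; rw [h0] at htm; exact hm2 htm
  · refine mem_flat.mpr fun h h0 => ?_
    rcases ((htz h).mp h0).2 with hh | hh
    · exact signVec_eq_zero.mp (hsgn0 h hh)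
    · by_cases hh' : s h = 0
      · exact signVec_eq_zero.mp (hsgn0 h hh')
      · rw [← signVec_eq_zero, hsgn η _ h hh', hh]; simp
  · intro h h0 h1
    rw [hδ h, if_pos h0]
  · intro h h0 h1
    have hh := (((htz h).mp h0).2).resolve_left h1
    rw [hsgn _ _ h h1, hh, sign_mul_eq_self h1, sign_eq_one_iff]
    linarith

/-- An interval of length two in the face order of an arrangement has exactly two middle
elements. -/
theorem exists_isMiddle [Finite ι] [FiniteDimensional ℝ W] {u s : ι → SignType}
    (hus : Conf u s) (hu : ∃ p, signVec a p = u) (hs : ∃ x, signVec a x = s)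
    (hrk : rk a s = rk a u + 2) : ∃ t₁ t₂ w₁ w₂, t₁ ≠ t₂ ∧ IsMiddle a u t₁ s w₁ w₂ ∧
      IsMiddle a u t₂ s w₂ w₁ ∧ ∀ p, Conf u (signVec a p) → Conf (signVec a p) s →
        rk a (signVec a p) = rk a u + 1 → signVec a p = t₁ ∨ signVec a p = t₂ := by
  have hfin := Fintype.ofFinite ι
  obtain ⟨x, hx⟩ := hs
  have hne : ∃ h, u h = 0 ∧ s h ≠ 0 := by
    by_contra hc
    push Not at hc
    have : u = s := hus.eq_of_zero (Conf.refl s) fun i => ⟨hc i, hus.zero⟩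
    rw [this] at hrk
    omega
  have hax : ∀ h, s h ≠ 0 → a h x ≠ 0 := fun h hh h0 => hh (hx ▸ signVec_eq_zero.mpr h0)
  have hxL : x ∈ flat a s := hx ▸ mem_flat_signVec x
  have hxu : x ∉ flat a u := fun h0 => by
    obtain ⟨h, h1, h2⟩ := hne
    exact hax h h2 (mem_flat.mp h0 h h1)
  -- The flat of `s` is spanned by that of `u` together with `x` and one more vector `v`, because
  -- the ranks differ by two.
  set L := flat a u ⊔ Submodule.span ℝ {x} with hL
  have hLrk : Module.finrank ℝ L = rk a u + 1 := Submodule.finrank_sup_span_singleton hxu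
  have hLle : L ≤ flat a s := sup_le hus.flat_le (by simpa using hxL)
  obtain ⟨v, hv, hvL⟩ : ∃ v ∈ flat a s, v ∉ L := by
    by_contra hc
    push Not at hc
    have := Submodule.finrank_mono (show flat a s ≤ L from hc)
    rw [hLrk] at this
    have : rk a s ≤ rk a u + 1 := this
    omega
  have hspan : flat a s = L ⊔ Submodule.span ℝ {v} := by
    refine (Submodule.eq_of_le_of_finrank_eq (sup_le hLle (by simpa using hv)) ?_).symm
    rw [Submodule.finrank_sup_span_singleton hvL, hLrk]
    exact hrk.symm
  set r : ι → ℝ := fun h => a h v / a h x with hrdef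
  have hr : ∀ h, s h ≠ 0 → a h v = r h * a h x := fun h hh => by
    rw [hrdef]; field_simp [hax h hh]
  obtain ⟨hm, hmH, hmin⟩ := (Finset.univ.filter fun h => u h = 0 ∧ s h ≠ 0).exists_min_image r
    (by obtain ⟨h, hh⟩ := hne; exact ⟨h, by simpa using hh⟩)
  obtain ⟨hM, hMH, hmax⟩ := (Finset.univ.filter fun h => u h = 0 ∧ s h ≠ 0).exists_max_image r
    (by obtain ⟨h, hh⟩ := hne; exact ⟨h, by simpa using hh⟩)
  simp only [Finset.mem_filter, Finset.mem_univ, true_and] at hmH hMH hmin hmax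
  have hlt : r hm < r hM := by
    by_contra hc
    have heq : ∀ h, u h = 0 → s h ≠ 0 → r h = r hm := fun h h1 h2 =>
      le_antisymm ((hmax h ⟨h1, h2⟩).trans (not_lt.mp hc)) (hmin h ⟨h1, h2⟩)
    refine hvL ?_
    have : v - r hm • x ∈ flat a u := mem_flat.mpr fun h h0 => by
      rw [map_sub, map_smul, smul_eq_mul]
      by_cases hh : s h = 0
      · rw [mem_flat.mp hv h hh, mem_flat.mp hxL h hh]; simp
      · rw [hr h hh, heq h h0 hh, sub_self]
    rw [← sub_add_cancel v (r hm • x)]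
    exact Submodule.add_mem_sup this (Submodule.smul_mem _ _ (Submodule.mem_span_singleton_self x))
  obtain ⟨t₁, ht₁, hz₁⟩ := exists_isMiddle_of_slope hus hu hrk hx hv hr hmH.1 hmH.2 hMH.1 hMH.2 1
    (fun h h1 h2 => by have := hmin h ⟨h1, h2⟩; linarith) (by linarith)
  -- With `η = -1` and the extremes interchanged, the two witness vectors are those of `t₁` in the
  -- opposite order; this becomes the transposition in the orientation argument.
  obtain ⟨t₂, ht₂, hz₂⟩ := exists_isMiddle_of_slope hus hu hrk hx hv hr hMH.1 hMH.2 hmH.1 hmH.2 (-1)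
    (fun h h1 h2 => by have := hmax h ⟨h1, h2⟩; linarith) (by linarith)
  rw [neg_neg] at ht₂
  refine ⟨t₁, t₂, _, _, ?_, ht₁, ht₂, ?_⟩
  · rintro rfl
    rcases ((hz₂ hm).mp ((hz₁ hm).mpr ⟨hmH.1, Or.inr rfl⟩)).2 with h | h
    · exact hmH.2 h
    · exact hlt.ne h
  intro p hup hps hrkp
  have hpL := hps.mem_flat
  rw [hspan, hL] at hpL
  obtain ⟨q, hq, z, hz, rfl⟩ := Submodule.mem_sup.mp hpL
  obtain ⟨l, hl, z', hz', rfl⟩ := Submodule.mem_sup.mp hq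
  obtain ⟨α, rfl⟩ := Submodule.mem_span_singleton.mp hz'
  obtain ⟨β, rfl⟩ := Submodule.mem_span_singleton.mp hz
  set t := signVec a (l + α • x + β • v) with ht
  have hsgn : ∀ h, u h = 0 → s h ≠ 0 → t h = SignType.sign (α + β * r h) * s h := fun h h1 h2 => by
    have e : a h (l + α • x + β • v) = (α + β * r h) * a h x := by
      simp only [map_add, map_smul, mem_flat.mp hl h h1, hr h h2, smul_eq_mul]; ring
    rw [ht, signVec, e, sign_mul, ← hx]
    rfl
  have hnn : ∀ h, u h = 0 → s h ≠ 0 → 0 ≤ α + β * r h := fun h h1 h2 => by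
    have h3 := hsgn h h1 h2
    rcases hps h with h4 | h4
    · rw [h3, mul_eq_zero, or_iff_left h2, sign_eq_zero_iff] at h4
      exact h4.ge
    · rw [h3, sign_mul_eq_self h2, sign_eq_one_iff] at h4
      exact h4.le
  have hzero : ∀ h, u h = 0 → s h ≠ 0 → (t h = 0 ↔ α + β * r h = 0) := fun h h1 h2 => by
    rw [hsgn h h1 h2, mul_eq_zero, or_iff_left h2, sign_eq_zero_iff]
  obtain ⟨h1, h11, h12, h13⟩ : ∃ h, u h = 0 ∧ s h ≠ 0 ∧ t h = 0 := by
    by_contra hc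
    push Not at hc
    have : t = s := hps.eq_of_zero (Conf.refl s) fun i => ⟨fun h0 => by
      by_contra h1
      exact hc i (hup.zero h0) h1 h0, hps.zero⟩
    rw [this] at hrkp
    omega
  obtain ⟨h2, h21, h22, h23⟩ : ∃ h, u h = 0 ∧ s h ≠ 0 ∧ t h ≠ 0 := by
    by_contra hc
    push Not at hc
    have : u = t := hup.eq_of_zero (Conf.refl t) fun i => ⟨fun h0 => by
      by_cases h1 : s i = 0
      · exact hps.zero h1
      · exact hc i h0 h1, hup.zero⟩
    rw [← this] at hrkp
    omega
  have hfinal : ∀ t' c, Conf t' s → (∀ h, t' h = 0 ↔ u h = 0 ∧ (s h = 0 ∨ r h = c)) →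
      (∀ h, u h = 0 → s h ≠ 0 → (α + β * r h = 0 ↔ r h = c)) → t = t' := by
    intro t' c ht' hz' hc
    refine hps.eq_of_zero ht' fun h => ?_
    rw [hz' h]
    constructor
    · intro h0
      refine ⟨hup.zero h0, ?_⟩
      by_cases hh : s h = 0
      · exact Or.inl hh
      · exact Or.inr ((hc h (hup.zero h0) hh).mp ((hzero h (hup.zero h0) hh).mp h0))
    · rintro ⟨h0, h1⟩
      by_cases hh : s h = 0
      · exact hps.zero hh
      · exact (hzero h h0 hh).mpr ((hc h h0 hh).mpr (h1.resolve_left hh))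
  have e1 := (hzero h1 h11 h12).mp h13
  -- The affine function `α + β * r` is nonnegative on all slopes and vanishes at one but not at all
  -- of them, so it vanishes exactly at the largest or exactly at the smallest slope, depending on
  -- the sign of `β`.
  rcases lt_trichotomy β 0 with hβ | hβ | hβ
  · right
    refine hfinal t₂ (r hM) ht₂.conf_right hz₂ ?_
    have e2 : r h1 = r hM := by
      have := hnn hM hMH.1 hMH.2
      have := hmax h1 ⟨h11, h12⟩
      nlinarith
    intro h _ _
    rw [← e2]
    constructor
    · intro h0
      have : β * (r h - r h1) = 0 := by linarith
      rcases mul_eq_zero.mp this with h | h <;> linarith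
    · intro h0; rw [h0]; exact e1
  · exfalso
    rw [hβ, zero_mul, add_zero] at e1
    exact h23 ((hzero h2 h21 h22).mpr (by rw [hβ, e1]; simp))
  · left
    refine hfinal t₁ (r hm) ht₁.conf_right hz₁ ?_
    have e2 : r h1 = r hm := by
      have := hnn hm hmH.1 hmH.2
      have := hmin h1 ⟨h11, h12⟩
      nlinarith
    intro h _ _
    rw [← e2]
    constructor
    · intro h0
      have : β * (r h - r h1) = 0 := by linarith
      rcases mul_eq_zero.mp this with h | h <;> linarith
    · intro h0; rw [h0]; exact e1

end Diamond

/-! ### Affine arrangements and the polyhedral complex of their cells -/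

theorem conf_signVec_iff {ι W : Type*} [AddCommGroup W] [Module ℝ W] {a : ι → W →ₗ[ℝ] ℝ} {w : W}
    {s : ι → SignType} : Conf (signVec a w) s ↔
      ∀ h, (0 ≤ s h → 0 ≤ a h w) ∧ (s h ≤ 0 → a h w ≤ 0) := by
  refine forall_congr' fun h => ?_
  rw [← zero_le_signVec, ← signVec_le_zero]
  generalize signVec a w h = u
  generalize s h = v
  revert u v
  decide

/-- A finite family of affine hyperplanes `form h y = const h` in `ℝ^n`, together with the
polyhedron defined by `const h ≤ form h y` for `h ∈ pos` and `form h y ≤ const h` for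
`h ∈ neg`. -/
structure Arrangement (n : ℕ) (ι : Type*) where
  form : ι → (Fin n → ℝ) →ₗ[ℝ] ℝ
  const : ι → ℝ
  pos : Finset ι
  neg : Finset ι

namespace Arrangement

variable {n : ℕ} {ι : Type*} (A : Arrangement n ι)

/-- The homogenization of the arrangement; the hyperplane at infinity has the index `none`. -/
noncomputable def hom : Option ι → ((Fin n → ℝ) × ℝ) →ₗ[ℝ] ℝ
  | none => LinearMap.snd ℝ _ ℝ
  | some h => A.form h ∘ₗ LinearMap.fst ℝ _ ℝ - A.const h • LinearMap.snd ℝ _ ℝ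

@[simp] theorem hom_none (w : (Fin n → ℝ) × ℝ) : A.hom none w = w.2 := rfl

@[simp] theorem hom_some (h : ι) (w : (Fin n → ℝ) × ℝ) :
    A.hom (some h) w = A.form h w.1 - A.const h * w.2 := rfl

/-- The sign vector of a point. -/
noncomputable def sgn (y : Fin n → ℝ) : Option ι → SignType := signVec A.hom (y, 1)

/-- The closed cell of a sign vector. -/
def cell (s : Option ι → SignType) : Set (Fin n → ℝ) := {y | Conf (A.sgn y) s}

/-- The polyhedron that is subdivided. -/
def support : Set (Fin n → ℝ) :=
  {y | (∀ h ∈ A.pos, A.const h ≤ A.form h y) ∧ ∀ h ∈ A.neg, A.form h y ≤ A.const h}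

/-- The cells of the subdivision. -/
def cells : Set (Set (Fin n → ℝ)) := {σ | ∃ y ∈ A.support, σ = A.cell (A.sgn y)}

theorem sgn_none (y : Fin n → ℝ) : A.sgn y none = 1 := by simp [sgn, signVec]

theorem mem_cell_self (y : Fin n → ℝ) : y ∈ A.cell (A.sgn y) := Conf.refl _

theorem sgn_eq_zero {y : Fin n → ℝ} {h : Option ι} : A.sgn y h = 0 ↔ A.hom h (y, 1) = 0 :=
  signVec_eq_zero

theorem mem_cell_iff {s : Option ι → SignType} {y : Fin n → ℝ} : y ∈ A.cell s ↔
    ∀ h, (0 ≤ s h → 0 ≤ A.hom h (y, 1)) ∧ (s h ≤ 0 → A.hom h (y, 1) ≤ 0) := conf_signVec_iff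

theorem cell_subset_cell {s t : Option ι → SignType} (h : Conf s t) : A.cell s ⊆ A.cell t :=
  fun _ hy => Conf.trans hy h

theorem cell_sgn_subset_cell {y : Fin n → ℝ} {s : Option ι → SignType} :
    A.cell (A.sgn y) ⊆ A.cell s ↔ Conf (A.sgn y) s :=
  ⟨fun h => h (A.mem_cell_self y), A.cell_subset_cell⟩

theorem cell_sgn_injective {y z : Fin n → ℝ} (h : A.cell (A.sgn y) = A.cell (A.sgn z)) :
    A.sgn y = A.sgn z :=
  (A.cell_sgn_subset_cell.mp h.le).antisymm (A.cell_sgn_subset_cell.mp h.ge)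

theorem hom_convex {x y : Fin n → ℝ} {r s : ℝ} (hrs : r + s = 1) (h : Option ι) :
    A.hom h (r • x + s • y, 1) = r * A.hom h (x, 1) + s * A.hom h (y, 1) := by
  have : ((r • x + s • y, 1) : (Fin n → ℝ) × ℝ) = r • (x, 1) + s • (y, 1) := by
    simp [hrs]
  rw [this, map_add, map_smul, map_smul, smul_eq_mul, smul_eq_mul]

theorem convex_cell (s : Option ι → SignType) : Convex ℝ (A.cell s) := by
  intro x hx y hy r t hr ht hrt
  rw [mem_cell_iff] at hx hy ⊢
  intro h
  rw [A.hom_convex hrt]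
  refine ⟨fun h0 => ?_, fun h0 => ?_⟩
  · exact add_nonneg (mul_nonneg hr ((hx h).1 h0)) (mul_nonneg ht ((hy h).1 h0))
  · exact add_nonpos (mul_nonpos_of_nonneg_of_nonpos hr ((hx h).2 h0))
      (mul_nonpos_of_nonneg_of_nonpos ht ((hy h).2 h0))

theorem continuous_hom (h : Option ι) : Continuous fun y : Fin n → ℝ => A.hom h (y, 1) :=
  (LinearMap.continuous_of_finiteDimensional (A.hom h)).comp (by fun_prop)

theorem isClosed_cell (s : Option ι → SignType) : IsClosed (A.cell s) := by
  have : A.cell s = ⋂ h, ({y | 0 ≤ s h → 0 ≤ A.hom h (y, 1)} ∩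
      {y | s h ≤ 0 → A.hom h (y, 1) ≤ 0}) := by
    ext y
    rw [mem_cell_iff, Set.mem_iInter]
    rfl
  rw [this]
  refine isClosed_iInter fun h => IsClosed.inter ?_ ?_
  · by_cases h0 : 0 ≤ s h
    · simp only [h0, true_imp_iff]
      exact isClosed_le continuous_const (A.continuous_hom h)
    · simp [h0]
  · by_cases h0 : s h ≤ 0
    · simp only [h0, true_imp_iff]
      exact isClosed_le (A.continuous_hom h) continuous_const
    · simp [h0]

theorem cell_subset_support {y : Fin n → ℝ} (hy : y ∈ A.support) :
    A.cell (A.sgn y) ⊆ A.support := by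
  intro z hz
  rw [mem_cell_iff] at hz
  refine ⟨fun h hh => ?_, fun h hh => ?_⟩
  · have h1 : 0 ≤ A.sgn y (some h) := zero_le_signVec.mpr (by simpa using hy.1 h hh)
    simpa using (hz (some h)).1 h1
  · have h1 : A.sgn y (some h) ≤ 0 := signVec_le_zero.mpr (by simpa using hy.2 h hh)
    simpa using (hz (some h)).2 h1

/-- A convex union of cells none of which is properly crossed by a hyperplane. -/
structure IsCellular (B : Set (Fin n → ℝ)) : Prop where
  convex : Convex ℝ B
  compat : ∀ x ∈ B, ∀ y ∈ B, ∀ h, A.sgn x h ≠ 0 → A.sgn y h ≠ 0 → A.sgn x h = A.sgn y h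
  closed : ∀ x ∈ B, ∀ y, Conf (A.sgn y) (A.sgn x) → y ∈ B

theorem isCellular_cell (s : Option ι → SignType) : A.IsCellular (A.cell s) where
  convex := A.convex_cell s
  compat _ hx _ hy _ h1 h2 := (Conf.eq_of_ne hx h1).trans (Conf.eq_of_ne hy h2).symm
  closed _ hx _ hy := hy.trans hx

variable {A}

theorem IsCellular.inter {B C : Set (Fin n → ℝ)} (hB : A.IsCellular B) (hC : A.IsCellular C) :
    A.IsCellular (B ∩ C) where
  convex := hB.convex.inter hC.convex
  compat x hx y hy := hB.compat x hx.1 y hy.1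
  closed x hx y hy := ⟨hB.closed x hx.1 y hy, hC.closed x hx.2 y hy⟩

/-- From a point in the relative interior of a cell one can move away from any other point of
the cell. -/
theorem exists_sgn_add_smul [Finite ι] {x y : Fin n → ℝ} (hxy : Conf (A.sgn y) (A.sgn x)) :
    ∃ δ : ℝ, 0 < δ ∧ A.sgn (x + δ • (x - y)) = A.sgn x := by
  obtain ⟨δ, hδ, h⟩ := exists_signVec_add_smul (a := A.hom) (x, 1) (x - y, 0)
  refine ⟨δ, hδ, funext fun i => ?_⟩
  have e : ((x, 1) + δ • (x - y, 0) : (Fin n → ℝ) × ℝ) = (x + δ • (x - y), 1) := by simp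
  have h1 := h i
  rw [e] at h1
  rw [sgn, sgn, h1, ite_eq_right_iff]
  intro h0
  rw [h0, signVec_eq_zero]
  have e' : ((x - y, 0) : (Fin n → ℝ) × ℝ) = (x, 1) - (y, 1) := by simp
  rw [e', map_sub, signVec_eq_zero.mp h0, signVec_eq_zero.mp (hxy.zero h0), sub_zero]

/-- A point of `F` with as few zero signs as possible plays the part of a relative interior point;
`F` turns out to be the cell of that point. -/
theorem IsCellular.exists_eq_cell [Finite ι] {B F : Set (Fin n → ℝ)} (hB : A.IsCellular B)
    (hF : IsExposed ℝ B F) (hne : F.Nonempty) : ∃ x ∈ F, F = A.cell (A.sgn x) := by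
  have hfin := Fintype.ofFinite ι
  have hFB := hF.subset
  have hFc := hF.convex hB.convex
  obtain ⟨l, hl⟩ := hF hne
  let N : (Fin n → ℝ) → ℕ := fun x => (Finset.univ.filter fun h => A.sgn x h = 0).card
  obtain ⟨x, hx, hmin⟩ : ∃ x ∈ F, ∀ y ∈ F, N x ≤ N y := by
    have := WellFounded.has_min (measure N).wf F hne
    obtain ⟨x, hx, h⟩ := this
    exact ⟨x, hx, fun y hy => not_lt.mp (h y hy)⟩
  refine ⟨x, hx, Set.Subset.antisymm (fun y hy => ?_) fun y hy => ?_⟩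
  · intro h
    by_contra hc
    push Not at hc
    obtain ⟨h1, h2⟩ := hc
    have h3 : A.sgn x h = 0 := by
      by_contra h3
      exact h2 (hB.compat y (hFB hy) x (hFB hx) h h1 h3)
    -- If `y` were off a hyperplane containing `x`, the midpoint would have fewer zero signs than
    -- `x`; no other sign cancels, because signs in `B` are compatible.
    have hz : (1 / 2 : ℝ) • x + (1 / 2 : ℝ) • y ∈ F :=
      hFc hx hy (by norm_num) (by norm_num) (by norm_num)
    refine absurd (hmin _ hz) (not_le.mpr (Finset.card_lt_card ⟨fun i hi => ?_, fun hsub => ?_⟩))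
    · simp only [Finset.mem_filter, Finset.mem_univ, true_and] at hi ⊢
      rw [sgn_eq_zero, A.hom_convex (by norm_num)] at hi
      by_contra h0
      by_cases h0' : A.sgn y i = 0
      · rw [sgn_eq_zero] at h0 h0'
        rw [h0'] at hi
        exact h0 (by linarith)
      · have h4 := hB.compat x (hFB hx) y (hFB hy) i h0 h0'
        unfold sgn signVec at h4 h0
        have h5 : A.hom i (x, 1) = -A.hom i (y, 1) := by linarith
        rw [h5, Left.sign_neg] at h4
        rw [h5, Left.sign_neg] at h0
        revert h4 h0
        generalize SignType.sign (A.hom i (y, 1)) = u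
        revert u
        decide
    · have h5 := hsub (Finset.mem_filter.mpr ⟨Finset.mem_univ h, h3⟩)
      have h6 := (Finset.mem_filter.mp h5).2
      rw [sgn_eq_zero, A.hom_convex (by norm_num), A.sgn_eq_zero.mp h3] at h6
      exact h1 (A.sgn_eq_zero.mpr (by linarith))
  · rw [hl] at hx ⊢
    -- The segment from `y` to `x` continues beyond `x` inside `B`. As `l` is maximal at `x`, it
    -- cannot be smaller at `y`.
    obtain ⟨δ, hδ, h⟩ := exists_sgn_add_smul hy
    have hy' := hB.closed x hx.1 y hy
    have h1 := hx.2 _ (hB.closed x hx.1 (x + δ • (x - y)) (h ▸ Conf.refl _))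
    rw [map_add, map_smul, map_sub, smul_eq_mul] at h1
    have h2 : l x ≤ l y := by nlinarith
    exact ⟨hy', fun z hz => (hx.2 z hz).trans h2⟩

/-- Each hyperplane through `x` has `B` on one side. The sum of the correspondingly signed forms is
minimal on `B` exactly where all of them vanish, which is the cell of `x`; its negative exposes that
cell. -/
theorem IsCellular.isExposed_cell [Finite ι] {B : Set (Fin n → ℝ)} (hB : A.IsCellular B)
    {x : Fin n → ℝ} (hx : x ∈ B) : IsExposed ℝ B (A.cell (A.sgn x)) := by
  have hfin := Fintype.ofFinite ι
  intro _
  let η : ι → ℝ := fun h => if ∃ y ∈ B, A.sgn y (some h) = 1 then 1 else -1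
  have hη : ∀ h, ∀ y ∈ B, 0 ≤ η h * A.hom (some h) (y, 1) := by
    intro h y hy
    by_cases hc : ∃ y ∈ B, A.sgn y (some h) = 1
    · simp only [η, if_pos hc, one_mul]
      obtain ⟨z, hz, hz1⟩ := hc
      by_contra h0
      have h1 : A.sgn y (some h) = -1 := sign_neg (not_le.mp h0)
      have := hB.compat y hy z hz (some h) (by rw [h1]; decide) (by rw [hz1]; decide)
      rw [h1, hz1] at this
      exact absurd this (by decide)
    · simp only [η, if_neg hc]
      by_contra h0
      exact hc ⟨y, hy, sign_pos (by linarith)⟩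
  have hη0 : ∀ h, η h ≠ 0 := fun h => by
    simp only [η]; split_ifs <;> norm_num
  set Z : Finset ι := Finset.univ.filter fun h => A.sgn x (some h) = 0 with hZ
  let m : (Fin n → ℝ) →ₗ[ℝ] ℝ := -∑ h ∈ Z, η h • A.form h
  have hm : ∀ y, m y = -(∑ h ∈ Z, η h * A.hom (some h) (y, 1)) - ∑ h ∈ Z, η h * A.const h := by
    intro y
    simp only [m, LinearMap.neg_apply, LinearMap.sum_apply, LinearMap.smul_apply, smul_eq_mul,
      hom_some, mul_one, mul_sub, Finset.sum_sub_distrib]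
    ring
  have hm0 : ∀ y, Conf (A.sgn y) (A.sgn x) → ∑ h ∈ Z, η h * A.hom (some h) (y, 1) = 0 := by
    intro y hy
    refine Finset.sum_eq_zero fun h hh => ?_
    rw [A.sgn_eq_zero.mp (hy.zero (Finset.mem_filter.mp hh).2), mul_zero]
  refine ⟨LinearMap.toContinuousLinearMap m, Set.Subset.antisymm (fun y hy => ?_) ?_⟩
  · refine ⟨hB.closed x hx y hy, fun z hz => ?_⟩
    simp only [LinearMap.coe_toContinuousLinearMap', hm, hm0 y hy]
    have := Finset.sum_nonneg fun h (_ : h ∈ Z) => hη h z hz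
    linarith
  · rintro y ⟨hy, hmax⟩
    have h1 := hmax x hx
    simp only [LinearMap.coe_toContinuousLinearMap', hm, hm0 x (Conf.refl _)] at h1
    have h2 : ∑ h ∈ Z, η h * A.hom (some h) (y, 1) = 0 :=
      le_antisymm (by linarith) (Finset.sum_nonneg fun h _ => hη h y hy)
    rw [Finset.sum_eq_zero_iff_of_nonneg fun h _ => hη h y hy] at h2
    intro h
    by_cases h0 : A.sgn y h = 0
    · exact Or.inl h0
    right
    refine hB.compat y hy x hx h h0 fun h3 => h0 ?_
    cases h with
    | none => rw [sgn_none] at h3; exact absurd h3 (by decide)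
    | some h =>
      exact A.sgn_eq_zero.mpr
        ((mul_eq_zero.mp (h2 h (Finset.mem_filter.mpr ⟨Finset.mem_univ _, h3⟩))).resolve_left
          (hη0 h))

theorem eq_cell_of_mem_extremePoints [Finite ι] {s : Option ι → SignType} {x : Fin n → ℝ}
    (hx : x ∈ (A.cell s).extremePoints ℝ) : A.cell (A.sgn x) = {x} := by
  refine Set.Subset.antisymm (fun y hy => ?_) (by simpa using A.mem_cell_self x)
  obtain ⟨δ, hδ, h⟩ := exists_sgn_add_smul hy
  have hz : x + δ • (x - y) ∈ A.cell s := by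
    have : Conf (A.sgn (x + δ • (x - y))) (A.sgn x) := h ▸ Conf.refl _
    exact this.trans hx.1
  refine (hx.2 (A.cell_subset_cell hx.1 hy) hz ?_)
  -- The weights that write `x` as a convex combination of `y` and `x + δ • (x - y)`.
  refine ⟨δ / (1 + δ), 1 / (1 + δ), by positivity, by positivity, by field_simp; ring, ?_⟩
  ext i
  simp only [Pi.add_apply, Pi.smul_apply, Pi.sub_apply, smul_eq_mul]
  field_simp
  ring

variable (A)

theorem finite_cells [Finite ι] : A.cells.Finite := by
  refine (Set.finite_range A.cell).subset ?_
  rintro σ ⟨y, _, rfl⟩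
  exact ⟨_, rfl⟩

theorem finite_vertices [Finite ι] : {v : Fin n → ℝ | {v} ∈ A.cells}.Finite :=
  A.finite_cells.preimage Set.singleton_injective.injOn

theorem isCompact_cell (hb : Bornology.IsBounded A.support) {y : Fin n → ℝ}
    (hy : y ∈ A.support) : IsCompact (A.cell (A.sgn y)) :=
  Metric.isCompact_of_isClosed_isBounded (A.isClosed_cell _)
    (hb.subset (A.cell_subset_support hy))

/-- Every cell is the convex hull of its vertices. -/
theorem convexHull_vertices [Finite ι] (hb : Bornology.IsBounded A.support)
    {σ : Set (Fin n → ℝ)} (hσ : σ ∈ A.cells) : convexHull ℝ {v | v ∈ σ ∧ {v} ∈ A.cells} = σ := by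
  obtain ⟨y, hy, rfl⟩ := hσ
  refine Set.Subset.antisymm (convexHull_min (fun v hv => hv.1) (A.convex_cell _)) ?_
  have hfin : {v | v ∈ A.cell (A.sgn y) ∧ {v} ∈ A.cells}.Finite :=
    A.finite_vertices.subset fun v hv => hv.2
  -- Krein–Milman; extreme points are zero-dimensional cells, and there are finitely many, so no
  -- closure is needed afterwards.
  conv_lhs => rw [← closure_convexHull_extremePoints (A.isCompact_cell hb hy) (A.convex_cell _)]
  refine closure_minimal (convexHull_mono fun v hv => ⟨hv.1, v, ?_, ?_⟩)
    (hfin.isCompact_convexHull ℝ).isClosed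
  · exact A.cell_subset_support hy hv.1
  · exact (eq_cell_of_mem_extremePoints hv).symm

theorem cell_mem_cells_of_mem {σ : Set (Fin n → ℝ)} (hσ : σ ∈ A.cells) {x : Fin n → ℝ}
    (hx : x ∈ σ) : A.cell (A.sgn x) ∈ A.cells := by
  obtain ⟨y, hy, rfl⟩ := hσ
  exact ⟨x, A.cell_subset_support hy hx, rfl⟩

theorem isPolyhedralComplex_cells [Finite ι] (hb : Bornology.IsBounded A.support) :
    IsPolyhedralComplex A.cells where
  finite := A.finite_cells
  polytope σ hσ := by
    have hfin : {v | v ∈ σ ∧ {v} ∈ A.cells}.Finite := A.finite_vertices.subset fun v hv => hv.2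
    refine ⟨_, hfin, ?_, (A.convexHull_vertices hb hσ).symm⟩
    rw [← convexHull_nonempty_iff (𝕜 := ℝ), A.convexHull_vertices hb hσ]
    obtain ⟨y, hy, rfl⟩ := hσ
    exact ⟨y, A.mem_cell_self y⟩
  face_mem σ hσ F hF hσF := by
    have hσ' := hσ
    obtain ⟨y, hy, rfl⟩ := hσ'
    obtain ⟨x, hx, rfl⟩ := (A.isCellular_cell _).exists_eq_cell hσF hF
    exact A.cell_mem_cells_of_mem hσ (hσF.subset hx)
  inter_face σ hσ τ hτ hne := by
    obtain ⟨y, hy, rfl⟩ := hσ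
    obtain ⟨z, hz, rfl⟩ := hτ
    obtain ⟨x, hx, h⟩ := ((A.isCellular_cell (A.sgn y)).inter
      (A.isCellular_cell (A.sgn z))).exists_eq_cell (IsExposed.refl _) hne
    rw [h]
    exact (A.isCellular_cell _).isExposed_cell hx.1

/-- The subdivision of a polyhedron by possibly infinitely many hyperplanes of which those not
belonging to the arrangement lie beyond the polyhedron. -/
theorem subdivision_eq_cells [Finite ι] {κ : Type*} (g : κ → (Fin n → ℝ) →ₗ[ℝ] ℝ) (d : κ → ℝ)
    (hg : ∀ i, (∃ h, g i = A.form h ∧ d i = A.const h) ∨ ∀ y ∈ A.support, g i y < d i)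
    (hA : ∀ h, h ∈ A.pos ∨ h ∈ A.neg ∨ ∃ i, g i = A.form h ∧ d i = A.const h) :
    subdivision A.support g d = A.cells := by
  -- Every piece is a cellular set, so its faces are cells; a hyperplane outside the arrangement
  -- does not meet the polyhedron and imposes no real choice of side.
  have hcell : ∀ D : Set κ, A.IsCellular
      (A.support ∩ {y | (∀ i ∈ D, d i ≤ g i y) ∧ ∀ i ∉ D, g i y ≤ d i}) := by
    intro D
    refine ⟨?_, ?_, ?_⟩
    · intro x hx y hy r t hr ht hrt
      have key : ∀ (f : (Fin n → ℝ) →ₗ[ℝ] ℝ) (c : ℝ), c ≤ f x → c ≤ f y →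
          c ≤ f (r • x + t • y) := fun f c h1 h2 => by
        rw [map_add, map_smul, map_smul, smul_eq_mul, smul_eq_mul]
        have : c = r * c + t * c := by rw [← add_mul, hrt, one_mul]
        nlinarith
      have key' : ∀ (f : (Fin n → ℝ) →ₗ[ℝ] ℝ) (c : ℝ), f x ≤ c → f y ≤ c →
          f (r • x + t • y) ≤ c := fun f c h1 h2 => by
        have := key (-f) (-c) (by simpa using h1) (by simpa using h2)
        simpa only [LinearMap.neg_apply, neg_le_neg_iff] using this
      exact ⟨⟨fun h hh => key _ _ (hx.1.1 h hh) (hy.1.1 h hh),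
        fun h hh => key' _ _ (hx.1.2 h hh) (hy.1.2 h hh)⟩,
        fun i hi => key _ _ (hx.2.1 i hi) (hy.2.1 i hi),
        fun i hi => key' _ _ (hx.2.2 i hi) (hy.2.2 i hi)⟩
    · intro x hx y hy h h1 h2
      have hnn : 0 ≤ A.sgn x h → 0 ≤ A.sgn y h → A.sgn x h = A.sgn y h := by
        revert h1 h2
        generalize A.sgn x h = u
        generalize A.sgn y h = v
        revert u v; decide
      have hnp : A.sgn x h ≤ 0 → A.sgn y h ≤ 0 → A.sgn x h = A.sgn y h := by
        revert h1 h2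
        generalize A.sgn x h = u
        generalize A.sgn y h = v
        revert u v; decide
      cases h with
      | none => rw [sgn_none, sgn_none]
      | some h =>
        have hnn' : A.const h ≤ A.form h x → A.const h ≤ A.form h y →
            A.sgn x (some h) = A.sgn y (some h) := fun e1 e2 =>
          hnn (zero_le_signVec.mpr (by simpa using e1)) (zero_le_signVec.mpr (by simpa using e2))
        have hnp' : A.form h x ≤ A.const h → A.form h y ≤ A.const h →
            A.sgn x (some h) = A.sgn y (some h) := fun e1 e2 =>
          hnp (signVec_le_zero.mpr (by simpa using e1)) (signVec_le_zero.mpr (by simpa using e2))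
        rcases hA h with hh | hh | ⟨i, hi, hi'⟩
        · exact hnn' (hx.1.1 h hh) (hy.1.1 h hh)
        · exact hnp' (hx.1.2 h hh) (hy.1.2 h hh)
        · rw [← hi, ← hi'] at hnn' hnp'
          by_cases hD : i ∈ D
          · exact hnn' (hx.2.1 i hD) (hy.2.1 i hD)
          · exact hnp' (hx.2.2 i hD) (hy.2.2 i hD)
    · intro x hx y hy
      have hys := A.cell_subset_support hx.1 hy
      have hy' := A.mem_cell_iff.mp hy
      refine ⟨hys, fun i hi => ?_, fun i hi => ?_⟩
      · rcases hg i with ⟨h, hh, hh'⟩ | hh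
        · have h1 := hx.2.1 i hi
          rw [hh, hh'] at h1 ⊢
          have h2 := (hy' (some h)).1 (zero_le_signVec.mpr (by simpa using h1))
          simpa using h2
        · exact absurd (hx.2.1 i hi) (not_le.mpr (hh x hx.1))
      · rcases hg i with ⟨h, hh, hh'⟩ | hh
        · have h1 := hx.2.2 i hi
          rw [hh, hh'] at h1 ⊢
          have h2 := (hy' (some h)).2 (signVec_le_zero.mpr (by simpa using h1))
          simpa using h2
        · exact (hh y hys).le
  ext σ
  constructor
  · rintro ⟨hne, D, hD⟩
    obtain ⟨x, hx, rfl⟩ := (hcell D).exists_eq_cell hD hne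
    exact ⟨x, (hD.subset hx).1, rfl⟩
  · rintro ⟨y, hy, rfl⟩
    refine ⟨⟨y, A.mem_cell_self y⟩, {i | d i ≤ g i y}, (hcell _).isExposed_cell ⟨hy, ?_, ?_⟩⟩
    · exact fun i hi => hi
    · exact fun i hi => (not_le.mp hi).le

end Arrangement

/-! ### Orientations -/

section Orientation

variable {L : Type*} [AddCommGroup L] [Module ℝ L] {p : ℕ}

theorem det_cons_ne_zero (b : Module.Basis (Fin (p + 1)) ℝ L) {v : Fin p → L}
    (hv : LinearIndependent ℝ v) (l : L →ₗ[ℝ] ℝ) (hl : ∀ i, l (v i) = 0) {q : L} (hq : l q ≠ 0) :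
    b.det (Fin.cons q v : Fin (p + 1) → L) ≠ 0 := by
  have hli : LinearIndependent ℝ (Fin.cons q v : Fin (p + 1) → L) := by
    refine linearIndependent_finCons.mpr ⟨hv, fun hmem => hq ?_⟩
    have : Submodule.span ℝ (Set.range v) ≤ LinearMap.ker l :=
      Submodule.span_le.mpr (by rintro _ ⟨i, rfl⟩; exact hl i)
    exact this hmem
  have hfd : FiniteDimensional ℝ L := b.finiteDimensional_of_finite
  have hsp := hli.span_eq_top_of_card_eq_finrank (by rw [Module.finrank_eq_card_basis b])
  exact (b.is_basis_iff_det.mp ⟨hli, hsp⟩).ne_zero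

theorem det_cons_eq_zero (b : Module.Basis (Fin (p + 1)) ℝ L) {v : Fin p → L}
    (l : L →ₗ[ℝ] ℝ) (hl : ∀ i, l (v i) = 0) {q r : L} (hq : l q ≠ 0) (hr : l r = 0) :
    b.det (Fin.cons r v : Fin (p + 1) → L) = 0 := by
  by_contra h
  have hsp := (b.is_basis_iff_det.mpr (isUnit_iff_ne_zero.mpr h)).2
  have : Submodule.span ℝ (Set.range (Fin.cons r v : Fin (p + 1) → L)) ≤ LinearMap.ker l := by
    refine Submodule.span_le.mpr ?_
    rintro _ ⟨i, rfl⟩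
    refine Fin.cases ?_ (fun i => ?_) i
    · simpa using hr
    · simpa using hl i
  rw [hsp] at this
  exact hq (this Submodule.mem_top)

/-- Only the component of the first vector transverse to the hyperplane of `v` matters, and `l`
measures it. So incidence numbers do not depend on the chosen outward vector. -/
theorem det_cons_eq_mul (b : Module.Basis (Fin (p + 1)) ℝ L) {v : Fin p → L}
    (l : L →ₗ[ℝ] ℝ) (hl : ∀ i, l (v i) = 0) {q : L} (hq : l q ≠ 0) (r : L) :
    b.det (Fin.cons r v : Fin (p + 1) → L) = l r / l q * b.det (Fin.cons q v : Fin (p + 1) → L) := by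
  have h1 := det_cons_eq_zero b l hl hq (r := r - (l r / l q) • q) (by
    rw [map_sub, map_smul, smul_eq_mul, div_mul_cancel₀ _ hq, sub_self])
  have h2 : ∀ x, b.det (Fin.cons x v : Fin (p + 1) → L) = b.det.curryLeft x v := fun _ => rfl
  rw [h2, map_sub, map_smul, AlternatingMap.sub_apply, AlternatingMap.smul_apply, smul_eq_mul,
    sub_eq_zero] at h1
  rw [h2, h1, h2]

theorem det_cons_mul_det (b : Module.Basis (Fin (p + 1)) ℝ L) {M : Type*} [AddCommGroup M]
    [Module ℝ M] (b' : Module.Basis (Fin p) ℝ M) (j : M →ₗ[ℝ] L) (q : L) (m : Fin p → M) :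
    b.det (Fin.cons q (fun i => j (b' i)) : Fin (p + 1) → L) * b'.det m =
      b.det (Fin.cons q (fun i => j (m i)) : Fin (p + 1) → L) := by
  have h := DFunLike.congr_fun
    (((b.det.curryLeft q).compLinearMap j).eq_smul_basis_det b') m
  exact h.symm

end Orientation

/-! ### Incidence numbers as signs of determinants -/

namespace Arrangement

variable {n : ℕ} {ι : Type*} (A : Arrangement n ι)

/-- The directions of the cell of a sign vector. -/
noncomputable def dir (s : Option ι → SignType) : Submodule ℝ (Fin n → ℝ) :=
  (flat A.hom s).comap (LinearMap.inl ℝ _ ℝ)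

variable {A}

theorem mem_dir {s : Option ι → SignType} {v : Fin n → ℝ} :
    v ∈ A.dir s ↔ (v, (0 : ℝ)) ∈ flat A.hom s := Iff.rfl

theorem hom_sub (h : Option ι) (x y : Fin n → ℝ) :
    A.hom h (x - y, 0) = A.hom h (x, 1) - A.hom h (y, 1) := by
  rw [← map_sub]; simp

/-- A small step from `y` in a direction of the flat changes no sign, so every such direction is
realized inside the cell. -/
theorem vectorSpan_cell [Finite ι] (y : Fin n → ℝ) :
    vectorSpan ℝ (A.cell (A.sgn y)) = A.dir (A.sgn y) := by
  refine le_antisymm ?_ fun v hv => ?_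
  · rw [vectorSpan_def, Submodule.span_le]
    rintro _ ⟨x, hx, z, hz, rfl⟩
    refine mem_dir.mpr (mem_flat.mpr fun h hh => ?_)
    change A.hom h (x - z, 0) = 0
    rw [hom_sub, A.sgn_eq_zero.mp (Conf.zero hx hh),
      A.sgn_eq_zero.mp (Conf.zero hz hh), sub_zero]
  · obtain ⟨δ, hδ, h⟩ := exists_signVec_add_smul (a := A.hom) (y, 1) (v, 0)
    have e : ((y, 1) + δ • (v, 0) : (Fin n → ℝ) × ℝ) = (y + δ • v, 1) := by simp
    have hmem : y + δ • v ∈ A.cell (A.sgn y) := by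
      have : A.sgn (y + δ • v) = A.sgn y := by
        funext i
        have h1 := h i
        rw [e] at h1
        rw [sgn, sgn, h1, ite_eq_right_iff]
        intro h0
        rw [h0, signVec_eq_zero]
        exact mem_flat.mp (mem_dir.mp hv) i h0
      exact this ▸ Conf.refl _
    have h1 := vsub_mem_vectorSpan ℝ hmem (A.mem_cell_self y)
    rw [vsub_eq_sub, add_sub_cancel_left] at h1
    have h2 := Submodule.smul_mem _ δ⁻¹ h1
    rwa [smul_smul, inv_mul_cancel₀ hδ.ne', one_smul] at h2

theorem rk_sgn [Finite ι] (y : Fin n → ℝ) :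
    rk A.hom (A.sgn y) = Module.finrank ℝ (vectorSpan ℝ (A.cell (A.sgn y))) + 1 := by
  rw [vectorSpan_cell, rk, ← finrank_inf_ker (flat A.hom (A.sgn y)) (LinearMap.snd ℝ _ ℝ)
    (v := (y, 1)) (mem_flat_signVec _) (by simp)]
  have : flat A.hom (A.sgn y) ⊓ LinearMap.ker (LinearMap.snd ℝ _ ℝ) =
      (A.dir (A.sgn y)).map (LinearMap.inl ℝ _ ℝ) := by
    ext w
    rw [Submodule.mem_inf, LinearMap.mem_ker, Submodule.mem_map]
    constructor
    · rintro ⟨h1, h2⟩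
      have h3 : w = (w.1, 0) := Prod.ext rfl h2
      exact ⟨w.1, mem_dir.mpr (h3 ▸ h1), h3.symm⟩
    · rintro ⟨v, hv, rfl⟩
      exact ⟨hv, rfl⟩
  rw [this, ← (Submodule.equivMapOfInjective _ LinearMap.inl_injective _).finrank_eq]

section Incidence

variable {X : Set (Set (Fin n → ℝ))} (o : CellOrientation X) {p : ℕ}

/-- The determinant, in the cell `σ`, of a vector followed by the basis of the cell `τ ⊆ σ`. -/
noncomputable def consDet (σ : Cell X (p + 1)) (τ : Cell X p) (h : τ.1 ⊆ σ.1)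
    (q : vectorSpan ℝ σ.1) : ℝ :=
  (o (p + 1) σ).det (Fin.cons q fun i => Submodule.inclusion (vectorSpan_mono ℝ h) (o p τ i))

/-- The restriction of a linear form on the homogenization to the directions of a cell. -/
noncomputable def dirForm (A : Arrangement n ι) (h : Option ι) (σ : Set (Fin n → ℝ)) :
    vectorSpan ℝ σ →ₗ[ℝ] ℝ :=
  A.hom h ∘ₗ LinearMap.inl ℝ _ ℝ ∘ₗ (vectorSpan ℝ σ).subtype

theorem dirForm_apply (h : Option ι) (σ : Set (Fin n → ℝ)) (v : vectorSpan ℝ σ) :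
    A.dirForm h σ v = A.hom h (v.1, 0) := rfl

/-- The vector `q` points from the facet into `σ`, as tested by one form `h` that vanishes on the
facet only. All determinants in the definition of the incidence number are nonnegative multiples of
the one for `-q`. -/
theorem incidence_eq_sign [Finite ι] (σ : Cell X (p + 1)) (τ : Cell X p) {y z : Fin n → ℝ}
    (hσ : σ.1 = A.cell (A.sgn y)) (hτ : τ.1 = A.cell (A.sgn z))
    (hsub : τ.1 ⊆ σ.1) (q : vectorSpan ℝ σ.1) {h : Option ι} (hz : A.sgn z h = 0)
    (hy : A.sgn y h ≠ 0) (hq : SignType.sign (A.hom h (q.1, 0)) = A.sgn y h) :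
    consDet o σ τ hsub (-q) ≠ 0 ∧
      incidence o σ τ = (SignType.sign (consDet o σ τ hsub (-q)) : ℤ) := by
  set l := A.dirForm h σ.1 with hl
  have hl0 : ∀ i, l (Submodule.inclusion (vectorSpan_mono ℝ hsub) (o p τ i)) = 0 := by
    intro i
    have := (o p τ i).2
    simp only [hτ, vectorSpan_cell] at this
    exact mem_flat.mp (mem_dir.mp this) h hz
  have hlq : l (-q) ≠ 0 := by
    rw [map_neg, neg_ne_zero]
    intro h0
    rw [hl, dirForm_apply] at h0
    rw [h0, sign_zero] at hq
    exact hy hq.symm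
  have hli : LinearIndependent ℝ
      fun i => Submodule.inclusion (vectorSpan_mono ℝ hsub) (o p τ i) :=
    (o p τ).linearIndependent.map' _ (Submodule.ker_inclusion _ _ _)
  have hne : consDet o σ τ hsub (-q) ≠ 0 := det_cons_ne_zero _ hli l hl0 hlq
  refine ⟨hne, ?_⟩
  have hdet : ∀ (x w : Fin n → ℝ) (hx : x ∈ τ.1) (hw : w ∈ σ.1),
      orientDet o σ τ hsub x w (hsub hx) hw =
        A.hom h (w, 1) / A.hom h (q.1, 0) * consDet o σ τ hsub (-q) := by
    intro x w hx hw
    rw [orientDet, det_cons_eq_mul _ l hl0 hlq, map_neg, hl, dirForm_apply, dirForm_apply,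
      hom_sub]
    have hx' : Conf (A.sgn x) (A.sgn z) := by rw [hτ] at hx; exact hx
    rw [A.sgn_eq_zero.mp (hx'.zero hz), zero_sub, neg_div_neg_eq]
    rfl
  have hnn : ∀ w ∈ σ.1, 0 ≤ A.hom h (w, 1) / A.hom h (q.1, 0) := by
    intro w hw
    rw [hσ] at hw
    have hw' := A.mem_cell_iff.mp hw h
    rcases lt_trichotomy (A.sgn y h) 0 with h1 | h1 | h1
    · refine div_nonneg_of_nonpos (hw'.2 h1.le) ?_
      rw [← sign_nonpos_iff, hq]; exact h1.le
    · exact absurd h1 hy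
    · refine div_nonneg (hw'.1 h1.le) ?_
      rw [← sign_nonneg_iff, hq]; exact h1.le
  rw [incidence, dif_pos hsub]
  rcases lt_or_gt_of_ne hne with hneg | hpos
  · rw [sign_neg hneg, if_neg]
    · rfl
    · rintro ⟨x, hx, w, hw, hpos⟩
      rw [hdet x w hx hw] at hpos
      exact absurd hpos (not_lt.mpr (mul_nonpos_of_nonneg_of_nonpos (hnn w hw) hneg.le))
  · have hzτ : z ∈ τ.1 := by rw [hτ]; exact A.mem_cell_self z
    have hyσ : y ∈ σ.1 := by rw [hσ]; exact A.mem_cell_self y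
    rw [sign_pos hpos, if_pos]
    · rfl
    · refine ⟨z, hzτ, y, hyσ, ?_⟩
      rw [hdet z y hzτ hyσ]
      refine mul_pos (lt_of_le_of_ne (hnn y hyσ) (div_ne_zero ?_ ?_).symm) hpos
      · exact fun h0 => hy (A.sgn_eq_zero.mpr h0)
      · intro h0
        rw [h0, sign_zero] at hq
        exact hy hq.symm

/-- The orientation of `τ` enters both factors and cancels. What is left depends on `τ` only through
the order of the two vectors put in front of the basis of `υ`. -/
theorem incidence_mul_incidence [Finite ι] (σ : Cell X (p + 2)) (τ : Cell X (p + 1))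
    (υ : Cell X p) {y z x : Fin n → ℝ}
    (hσ : σ.1 = A.cell (A.sgn y)) (hτ : τ.1 = A.cell (A.sgn z)) (hυ : υ.1 = A.cell (A.sgn x))
    (hzy : Conf (A.sgn z) (A.sgn y)) (hxz : Conf (A.sgn x) (A.sgn z))
    (hne : A.sgn z ≠ A.sgn y) (hne' : A.sgn x ≠ A.sgn z) (hυσ : υ.1 ⊆ σ.1)
    (w w' : vectorSpan ℝ σ.1) (hw : w.1 ∈ A.dir (A.sgn z))
    (hwi : ∀ h, A.sgn x h = 0 → A.sgn z h ≠ 0 → SignType.sign (A.hom h (w.1, 0)) = A.sgn z h)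
    (hwi' : ∀ h, A.sgn z h = 0 → A.sgn y h ≠ 0 →
      SignType.sign (A.hom h (w'.1, 0)) = A.sgn y h) :
    incidence o σ τ * incidence o τ υ = (SignType.sign ((o (p + 2) σ).det
      (Matrix.vecCons (-w') (Matrix.vecCons (-w) fun i =>
        Submodule.inclusion (vectorSpan_mono ℝ hυσ) (o p υ i)))) : ℤ) := by
  have ex : ∀ {s t : Option ι → SignType}, Conf t s → t ≠ s → ∃ h, t h = 0 ∧ s h ≠ 0 := by
    intro s t hc hn
    by_contra h0
    push Not at h0
    exact hn (hc.eq_of_zero (Conf.refl s) fun i => ⟨h0 i, hc.zero⟩)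
  obtain ⟨h, h1, h2⟩ := ex hzy hne
  obtain ⟨h', h1', h2'⟩ := ex hxz hne'
  have hτσ : τ.1 ⊆ σ.1 := by rw [hτ, hσ]; exact A.cell_subset_cell hzy
  have hυτ : υ.1 ⊆ τ.1 := by rw [hτ, hυ]; exact A.cell_subset_cell hxz
  have hwτ : w.1 ∈ vectorSpan ℝ τ.1 := by rw [hτ, vectorSpan_cell]; exact hw
  obtain ⟨_, e1⟩ := incidence_eq_sign o σ τ hσ hτ hτσ w' h1 h2 (hwi' h h1 h2)
  obtain ⟨_, e2⟩ := incidence_eq_sign o τ υ hτ hυ hυτ ⟨w.1, hwτ⟩ h1' h2' (hwi h' h1' h2')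
  have key := det_cons_mul_det (o (p + 2) σ) (o (p + 1) τ)
    (Submodule.inclusion (vectorSpan_mono ℝ hτσ)) (-w')
    (Fin.cons (-⟨w.1, hwτ⟩) fun i => Submodule.inclusion (vectorSpan_mono ℝ hυτ) (o p υ i))
  have hfam : (fun i => Submodule.inclusion (vectorSpan_mono ℝ hτσ)
      ((Fin.cons (-⟨w.1, hwτ⟩) fun i => Submodule.inclusion (vectorSpan_mono ℝ hυτ) (o p υ i) :
        Fin (p + 1) → vectorSpan ℝ τ.1) i)) =
      Matrix.vecCons (-w) fun i => Submodule.inclusion (vectorSpan_mono ℝ hυσ) (o p υ i) := by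
    funext i
    refine Fin.cases ?_ (fun i => ?_) i
    · exact Subtype.ext rfl
    · exact Subtype.ext rfl
  rw [hfam] at key
  have e3 : Matrix.vecCons (-w') (Matrix.vecCons (-w) fun i =>
        Submodule.inclusion (vectorSpan_mono ℝ hυσ) (o p υ i)) =
      (Fin.cons (-w') (Matrix.vecCons (-w) fun i =>
        Submodule.inclusion (vectorSpan_mono ℝ hυσ) (o p υ i)) :
          Fin (p + 2) → vectorSpan ℝ σ.1) := rfl
  rw [e1, e2, e3, ← key, sign_mul]
  push_cast
  rfl

end Incidence

end Arrangement

/-! ### The augmented incidence matrix squares to zero -/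

/-- The incidence number of two sets, `0` unless they are cells of consecutive dimensions. -/
noncomputable def incSet {n : ℕ} {X : Set (Set (Fin n → ℝ))} (o : CellOrientation X)
    (σ τ : Set (Fin n → ℝ)) : ℤ :=
  if h : σ ∈ X ∧ τ ∈ X ∧
      Module.finrank ℝ (vectorSpan ℝ σ) = Module.finrank ℝ (vectorSpan ℝ τ) + 1 then
    incidence o (p := Module.finrank ℝ (vectorSpan ℝ τ)) ⟨σ, h.1, h.2.2⟩ ⟨τ, h.2.1, rfl⟩
  else 0

theorem incSet_eq {n : ℕ} {X : Set (Set (Fin n → ℝ))} (o : CellOrientation X) {p : ℕ}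
    (σ : Cell X (p + 1)) (τ : Cell X p) : incSet o σ.1 τ.1 = incidence o σ τ := by
  obtain ⟨τ, hτ, rfl⟩ := τ
  rw [incSet, dif_pos ⟨σ.2.1, hτ, σ.2.2⟩]
  rfl

theorem incidence_ne_zero {n : ℕ} {X : Set (Set (Fin n → ℝ))} (o : CellOrientation X) {p : ℕ}
    (σ : Cell X (p + 1)) (τ : Cell X p) (h : τ.1 ⊆ σ.1) :
    incidence o σ τ = 1 ∨ incidence o σ τ = -1 := by
  rw [incidence, dif_pos h]
  split_ifs
  · exact Or.inl rfl
  · exact Or.inr rfl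

theorem incidence_eq_zero {n : ℕ} {X : Set (Set (Fin n → ℝ))} (o : CellOrientation X) {p : ℕ}
    (σ : Cell X (p + 1)) (τ : Cell X p) (h : ¬ τ.1 ⊆ σ.1) : incidence o σ τ = 0 := by
  rw [incidence, dif_neg h]

namespace Arrangement

variable {n : ℕ} {ι : Type*} {A : Arrangement n ι}

theorem cell_mem_cells {y : Fin n → ℝ} (hy : y ∈ A.support) : A.cell (A.sgn y) ∈ A.cells :=
  ⟨y, hy, rfl⟩

theorem sgn_ne_zero (y : Fin n → ℝ) : A.sgn y ≠ 0 := fun h => by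
  have := A.sgn_none y
  rw [h] at this
  exact zero_ne_one (α := SignType) this

variable (A) [Fintype ι]

/-- The sign vectors of the cells, together with the zero vector, which stands for the empty
cell. -/
noncomputable def homRegion : Finset (Option ι → SignType) :=
  region A.hom (Finset.insertNone A.pos) (A.neg.map Function.Embedding.some)

variable {A}

theorem signVec_mem_homRegion {w : (Fin n → ℝ) × ℝ} : signVec A.hom w ∈ A.homRegion ↔
    0 ≤ w.2 ∧ (∀ h ∈ A.pos, 0 ≤ A.hom (some h) w) ∧ ∀ h ∈ A.neg, A.hom (some h) w ≤ 0 := by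
  rw [homRegion, signVec_mem_region]
  simp only [Finset.forall_mem_insertNone, Finset.mem_map, Function.Embedding.some_apply,
    forall_exists_index, and_imp, forall_apply_eq_imp_iff₂, hom_none, and_assoc]

theorem sgn_mem_homRegion {y : Fin n → ℝ} : A.sgn y ∈ A.homRegion ↔ y ∈ A.support := by
  rw [sgn, signVec_mem_homRegion]
  simp [support]

/-- A nonzero such `v` would be a direction in which the polyhedron is unbounded. This is what makes
the homogenized cone pointed. -/
theorem eq_zero_of_recession (hb : Bornology.IsBounded A.support) (hne : A.support.Nonempty)
    {v : Fin n → ℝ} (hv : signVec A.hom (v, 0) ∈ A.homRegion) : v = 0 := by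
  obtain ⟨p, hp⟩ := hne
  rw [signVec_mem_homRegion] at hv
  simp only [hom_some, mul_zero, sub_zero] at hv
  obtain ⟨C, hC⟩ := hb.exists_norm_le
  have hmem : ∀ t : ℝ, 0 ≤ t → p + t • v ∈ A.support := by
    intro t ht
    refine ⟨fun h hh => ?_, fun h hh => ?_⟩ <;> rw [map_add, map_smul, smul_eq_mul]
    · have := mul_nonneg ht (hv.2.1 h hh)
      linarith [hp.1 h hh]
    · have := mul_nonpos_of_nonneg_of_nonpos ht (hv.2.2 h hh)
      linarith [hp.2 h hh]
  by_contra h0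
  have hpos : 0 < ‖v‖ := norm_pos_iff.mpr h0
  have hCp : ‖p‖ ≤ C := hC p hp
  have hpn := norm_nonneg p
  have ht : 0 ≤ (C + ‖p‖ + 1) / ‖v‖ := div_nonneg (by linarith) hpos.le
  have h1 := hC _ (hmem _ ht)
  have h2 := norm_sub_norm_le (((C + ‖p‖ + 1) / ‖v‖) • v) (-p)
  rw [sub_neg_eq_add, add_comm _ p, norm_neg, norm_smul, Real.norm_eq_abs, abs_of_nonneg ht,
    div_mul_cancel₀ _ hpos.ne'] at h2
  linarith

theorem eq_zero_of_none (hb : Bornology.IsBounded A.support) (hne : A.support.Nonempty)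
    {s : Option ι → SignType} (hs : s ∈ A.homRegion) (h0 : s none = 0) : s = 0 := by
  obtain ⟨⟨v, r⟩, rfl⟩ := (mem_region.mp hs).1
  have hr : r = 0 := by simpa using signVec_eq_zero.mp h0
  subst hr
  rw [eq_zero_of_recession hb hne hs]
  exact signVec_zero

theorem exists_sgn_eq (hb : Bornology.IsBounded A.support) (hne : A.support.Nonempty)
    {s : Option ι → SignType} (hs : s ∈ A.homRegion) (h0 : s ≠ 0) :
    ∃ y ∈ A.support, A.sgn y = s := by
  obtain ⟨⟨v, r⟩, rfl⟩ := (mem_region.mp hs).1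
  have hr0 : r ≠ 0 := fun hr => h0 (eq_zero_of_none hb hne hs (signVec_eq_zero.mpr hr))
  have hr : 0 < r := lt_of_le_of_ne (signVec_mem_homRegion.mp hs).1 hr0.symm
  have : A.sgn (r⁻¹ • v) = signVec A.hom (v, r) := by
    rw [sgn, ← signVec_smul (inv_pos.mpr hr) (v, r)]
    congr 1
    simp [inv_mul_cancel₀ hr0]
  exact ⟨r⁻¹ • v, sgn_mem_homRegion.mp (this ▸ hs), this⟩

theorem rk_zero (hb : Bornology.IsBounded A.support) (hne : A.support.Nonempty) :
    rk A.hom 0 = 0 := by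
  rw [rk, Submodule.finrank_eq_zero, Submodule.eq_bot_iff]
  rintro ⟨v, r⟩ hv
  have hr : r = 0 := mem_flat.mp hv none rfl
  subst hr
  have h0 : signVec A.hom (v, 0) = 0 := by
    funext h
    exact signVec_eq_zero.mpr (mem_flat.mp hv h rfl)
  have hv0 : v = 0 := eq_zero_of_recession hb hne (by rw [h0]; exact zero_mem_region)
  rw [hv0]
  rfl

variable (A)

/-- The incidence numbers of the cells and the empty cell, indexed by sign vectors. -/
noncomputable def eps (o : CellOrientation A.cells) (s t : Option ι → SignType) : ℤ :=
  if t = 0 then if rk A.hom s = 1 then 1 else 0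
  else if Conf t s ∧ rk A.hom s = rk A.hom t + 1 then incSet o (A.cell s) (A.cell t) else 0

variable {A} (o : CellOrientation A.cells)

/-- The cell of a point, with its dimension. -/
def cellAt {y : Fin n → ℝ} (hy : y ∈ A.support) {p : ℕ} (hp : rk A.hom (A.sgn y) = p + 1) :
    Cell A.cells p :=
  ⟨A.cell (A.sgn y), cell_mem_cells hy, by have := rk_sgn (A := A) y; omega⟩

theorem eps_cellAt {y z : Fin n → ℝ} (hy : y ∈ A.support) (hz : z ∈ A.support) {p : ℕ}
    (hyp : rk A.hom (A.sgn y) = p + 1 + 1) (hzp : rk A.hom (A.sgn z) = p + 1) :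
    A.eps o (A.sgn y) (A.sgn z) = incidence o (cellAt hy hyp) (cellAt hz hzp) := by
  rw [eps, if_neg (sgn_ne_zero z), ← incSet_eq]
  split_ifs with h
  · rfl
  · rw [incSet_eq, incidence_eq_zero]
    exact fun hsub => h ⟨A.cell_sgn_subset_cell.mp hsub, by rw [hyp, hzp]⟩

theorem eps_ne_zero_iff (hb : Bornology.IsBounded A.support) (hne : A.support.Nonempty)
    {s t : Option ι → SignType} (hs : s ∈ A.homRegion) (ht : t ∈ A.homRegion) :
    ((Conf t s ∧ rk A.hom s = rk A.hom t + 1) → A.eps o s t = 1 ∨ A.eps o s t = -1) ∧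
      (¬ (Conf t s ∧ rk A.hom s = rk A.hom t + 1) → A.eps o s t = 0) := by
  by_cases ht0 : t = 0
  · subst ht0
    have e : A.eps o s 0 = if rk A.hom s = 1 then 1 else 0 := if_pos rfl
    rw [rk_zero hb hne, e]
    constructor
    · rintro ⟨_, h⟩
      exact Or.inl (if_pos h)
    · intro h
      exact if_neg fun h' => h ⟨conf_zero s, h'⟩
  · constructor
    · rintro ⟨h1, h2⟩
      have hs0 : s ≠ 0 := by
        rintro rfl
        exact ht0 (funext fun i => h1.zero rfl)
      obtain ⟨y, hy, rfl⟩ := exists_sgn_eq hb hne hs hs0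
      obtain ⟨z, hz, rfl⟩ := exists_sgn_eq hb hne ht ht0
      have h3 := rk_sgn (A := A) z
      rw [eps_cellAt o hy hz (h2.trans (by rw [h3])) h3]
      exact incidence_ne_zero o _ _ (A.cell_subset_cell h1)
    · intro h
      rw [eps, if_neg ht0, if_neg h]

/-- For a nonempty lower end, both products are signs of determinants with the same columns, the
first two transposed. For the empty lower end, the vectors pointing into the edge from its two
vertices are opposite. -/
theorem eps_mul_eps_add [Finite ι] {u s t₁ t₂ : Option ι → SignType}
    (hb : Bornology.IsBounded A.support) (hne : A.support.Nonempty)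
    (hu : u ∈ A.homRegion) (hs : s ∈ A.homRegion) (ht₁ : t₁ ∈ A.homRegion)
    (ht₂ : t₂ ∈ A.homRegion) (hrk : rk A.hom s = rk A.hom u + 2) {w₁ w₂ : (Fin n → ℝ) × ℝ}
    (h₁ : IsMiddle A.hom u t₁ s w₁ w₂) (h₂ : IsMiddle A.hom u t₂ s w₂ w₁) :
    A.eps o s t₁ * A.eps o t₁ u + A.eps o s t₂ * A.eps o t₂ u = 0 := by
  have hut : ∀ {t w w'}, IsMiddle A.hom u t s w w' → u ≠ t ∧ t ≠ s := fun h =>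
    ⟨fun e => by have := h.rk_eq; rw [← e] at this; omega,
      fun e => by have := h.rk_eq; rw [e] at this; omega⟩
  have hr₁ := h₁.rk_eq
  have hr₂ := h₂.rk_eq
  have hpos : ∀ {t}, rk A.hom t = rk A.hom u + 1 → t ≠ 0 := fun h e => by
    rw [e, rk_zero hb hne] at h; omega
  obtain ⟨y, hy, rfl⟩ := exists_sgn_eq hb hne hs fun e => by
    rw [e, rk_zero hb hne] at hrk; omega
  obtain ⟨z₁, hz₁, rfl⟩ := exists_sgn_eq hb hne ht₁ (hpos hr₁)
  obtain ⟨z₂, hz₂, rfl⟩ := exists_sgn_eq hb hne ht₂ (hpos hr₂)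
  by_cases hu0 : u = 0
  · -- an edge and its two vertices
    subst hu0
    rw [rk_zero hb hne] at hrk hr₁ hr₂
    have e1 : A.eps o (A.sgn z₁) 0 = 1 := by rw [eps, if_pos rfl, if_pos hr₁]
    have e2 : A.eps o (A.sgn z₂) 0 = 1 := by rw [eps, if_pos rfl, if_pos hr₂]
    rw [e1, e2, mul_one, mul_one, eps_cellAt o hy hz₁ hrk hr₁, eps_cellAt o hy hz₂ hrk hr₂]
    set σ := cellAt hy hrk with hσ
    have hz₁σ : z₁ ∈ σ.1 := h₁.conf_right
    have hz₂σ : z₂ ∈ σ.1 := h₂.conf_right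
    let q : vectorSpan ℝ σ.1 := ⟨z₂ - z₁, vsub_mem_vectorSpan ℝ hz₂σ hz₁σ⟩
    have key : ∀ {z z' : Fin n → ℝ} {w w'}, IsMiddle A.hom 0 (A.sgn z) (A.sgn y) w w' →
        IsMiddle A.hom 0 (A.sgn z') (A.sgn y) w' w → ∃ h, A.sgn z h = 0 ∧ A.sgn y h ≠ 0 ∧
          SignType.sign (A.hom h (z' - z, 0)) = A.sgn y h := by
      intro z z' w w' hm hm'
      obtain ⟨h, h1, h2⟩ : ∃ h, A.sgn z h = 0 ∧ A.sgn y h ≠ 0 := by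
        by_contra h0
        push Not at h0
        exact (hut hm).2 (hm.conf_right.eq_of_zero (Conf.refl _)
          fun i => ⟨h0 i, hm.conf_right.zero⟩)
      refine ⟨h, h1, h2, ?_⟩
      rw [hom_sub, A.sgn_eq_zero.mp h1, sub_zero]
      refine hm'.conf_right.eq_of_ne fun h3 => h2 ?_
      rw [← hm.into' h h1 h2, signVec_eq_zero]
      exact mem_flat.mp hm'.mem h h3
    obtain ⟨h, k1, k2, k3⟩ := key h₁ h₂
    obtain ⟨h', k1', k2', k3'⟩ := key h₂ h₁
    obtain ⟨_, e3⟩ := incidence_eq_sign o σ (cellAt hz₁ hr₁) (A := A) rfl rfl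
      (A.cell_subset_cell h₁.conf_right) q k1 k2 k3
    obtain ⟨_, e4⟩ := incidence_eq_sign o σ (cellAt hz₂ hr₂) (A := A) rfl rfl
      (A.cell_subset_cell h₂.conf_right) (-q) k1' k2' (by
        have : ((-q : vectorSpan ℝ σ.1) : Fin n → ℝ) = z₁ - z₂ := neg_sub z₂ z₁
        rw [this]; exact k3')
    rw [e3, e4]
    have e5 : ∀ (τ τ' : Cell A.cells 0) (h : τ.1 ⊆ σ.1) (h' : τ'.1 ⊆ σ.1),
        consDet o σ τ h (-q) = - consDet o σ τ' h' (-(-q)) := by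
      intro τ τ' h h'
      have e : ∀ (τ : Cell A.cells 0) (h : τ.1 ⊆ σ.1) (q : vectorSpan ℝ σ.1),
          consDet o σ τ h q = (o 1 σ).det.curryLeft q Fin.elim0 := fun τ h q => by
        have : (fun i => Submodule.inclusion (vectorSpan_mono ℝ h) (o 0 τ i)) = Fin.elim0 :=
          funext fun i => i.elim0
        rw [consDet, this]
        rfl
      rw [e, e, map_neg _ (-q), AlternatingMap.neg_apply, neg_neg]
    rw [e5 (cellAt hz₁ hr₁) (cellAt hz₂ hr₂) (A.cell_subset_cell h₁.conf_right)
      (A.cell_subset_cell h₂.conf_right), Left.sign_neg]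
    push_cast
    ring
  · obtain ⟨x, hx, rfl⟩ := exists_sgn_eq hb hne hu hu0
    have hp := rk_sgn (A := A) x
    rw [hp] at hrk hr₁ hr₂
    rw [eps_cellAt o hy hz₁ hrk hr₁, eps_cellAt o hy hz₂ hrk hr₂, eps_cellAt o hz₁ hx hr₁ hp,
      eps_cellAt o hz₂ hx hr₂ hp]
    set σ := cellAt hy hrk with hσ
    have hxy : Conf (A.sgn x) (A.sgn y) := h₁.conf_left.trans h₁.conf_right
    have hxflat : ∀ {t}, Conf (A.sgn x) t → (x, (1 : ℝ)) ∈ flat A.hom t := fun h => h.mem_flat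
    -- The witness vectors live in the homogenization. Subtracting a multiple of `(x, 1)` brings
    -- them to height zero, without changing the forms that vanish at `x`.
    have hflat : ∀ {z w w'}, IsMiddle A.hom (A.sgn x) (A.sgn z) (A.sgn y) w w' →
        (w.1 - w.2 • x, (0 : ℝ)) ∈ flat A.hom (A.sgn z) := by
      intro z w w' hm
      have : (w.1 - w.2 • x, (0 : ℝ)) = w - w.2 • (x, (1 : ℝ)) := by
        ext <;> simp
      rw [this]
      exact Submodule.sub_mem _ hm.mem (Submodule.smul_mem _ _ (hxflat hm.conf_left))
    have hval : ∀ (w : (Fin n → ℝ) × ℝ) h, A.sgn x h = 0 →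
        A.hom h (w.1 - w.2 • x, 0) = A.hom h w := by
      intro w h h0
      have : (w.1 - w.2 • x, (0 : ℝ)) = w - w.2 • (x, (1 : ℝ)) := by
        ext <;> simp
      rw [this, map_sub, map_smul, A.sgn_eq_zero.mp h0, smul_zero, sub_zero]
    have hmem : ∀ {z w w'}, IsMiddle A.hom (A.sgn x) (A.sgn z) (A.sgn y) w w' →
        w.1 - w.2 • x ∈ vectorSpan ℝ σ.1 := by
      intro z w w' hm
      have : vectorSpan ℝ σ.1 = A.dir (A.sgn y) := vectorSpan_cell y
      rw [this]
      exact hm.conf_right.flat_le (hflat hm)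
    let v₁ : vectorSpan ℝ σ.1 := ⟨_, hmem h₁⟩
    let v₂ : vectorSpan ℝ σ.1 := ⟨_, hmem h₂⟩
    have hsub : (cellAt hx hp).1 ⊆ σ.1 := A.cell_subset_cell hxy
    rw [incidence_mul_incidence o σ (cellAt hz₁ hr₁) (cellAt hx hp) (A := A) rfl rfl rfl
      h₁.conf_right h₁.conf_left (hut h₁).2 (hut h₁).1 hsub v₁ v₂ (hflat h₁)
      (fun h h0 h1 => by rw [hval w₁ h h0]; exact h₁.into h h0 h1)
      (fun h h0 h1 => by rw [hval w₂ h (h₁.conf_left.zero h0)]; exact h₁.into' h h0 h1),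
      incidence_mul_incidence o σ (cellAt hz₂ hr₂) (cellAt hx hp) (A := A) rfl rfl rfl
      h₂.conf_right h₂.conf_left (hut h₂).2 (hut h₂).1 hsub v₂ v₁ (hflat h₂)
      (fun h h0 h1 => by rw [hval w₂ h h0]; exact h₂.into h h0 h1)
      (fun h h0 h1 => by rw [hval w₁ h (h₂.conf_left.zero h0)]; exact h₂.into' h h0 h1)]
    generalize (fun i => Submodule.inclusion (vectorSpan_mono ℝ hsub) (o _ (cellAt hx hp) i)) = b
    have hswap := (o _ σ).det.map_swap (Matrix.vecCons (-v₂) (Matrix.vecCons (-v₁) b))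
      (i := 0) (j := 1) (by simp)
    have hcomp : Matrix.vecCons (-v₂) (Matrix.vecCons (-v₁) b) ∘ Equiv.swap 0 1 =
        Matrix.vecCons (-v₁) (Matrix.vecCons (-v₂) b) := by
      funext i
      refine Fin.cases ?_ (fun i => ?_) i
      · simp
      · refine Fin.cases ?_ (fun i => ?_) i
        · simp
        · rw [Function.comp_apply, Equiv.swap_apply_of_ne_of_ne]
          · rfl
          · exact Fin.succ_ne_zero _
          · rw [← Fin.succ_zero_eq_one]
            exact fun h => Fin.succ_ne_zero _ (Fin.succ_injective _ h)
    rw [hcomp] at hswap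
    rw [hswap, Left.sign_neg]
    push_cast
    ring

theorem isIncidence_eps (k : Type*) [Field k] (hb : Bornology.IsBounded A.support)
    (hne : A.support.Nonempty) :
    IsIncidence A.hom A.homRegion fun s t => ((A.eps o s t : ℤ) : k) where
  real s hs := (mem_region.mp hs).1
  down := region_down
  ne_zero_iff s hs t ht := by
    have h := eps_ne_zero_iff o hb hne hs ht
    constructor
    · intro h0
      by_contra hc
      exact h0 (by rw [h.2 hc, Int.cast_zero])
    · intro hc
      rcases h.1 hc with h | h <;> simp [h]
  sqZero := by
    intro s hs u hu
    have key : ∑ t ∈ A.homRegion, A.eps o s t * A.eps o t u = 0 := by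
      have hnz : ∀ {s t}, s ∈ A.homRegion → t ∈ A.homRegion → A.eps o s t ≠ 0 →
          Conf t s ∧ rk A.hom s = rk A.hom t + 1 := fun hs ht h => by
        by_contra hc
        exact h ((eps_ne_zero_iff o hb hne hs ht).2 hc)
      by_cases hc : Conf u s ∧ rk A.hom s = rk A.hom u + 2
      · obtain ⟨t₁, t₂, w₁, w₂, hne', h₁, h₂, hall⟩ := exists_isMiddle hc.1
          (mem_region.mp hu).1 (mem_region.mp hs).1 hc.2
        have hmem : ∀ {t w w'}, IsMiddle A.hom u t s w w' → t ∈ A.homRegion := fun h => by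
          obtain ⟨p, hp⟩ := h.real
          exact hp ▸ region_down s hs p (hp.symm ▸ h.conf_right)
        rw [← Finset.sum_subset (s₁ := {t₁, t₂}), Finset.sum_pair hne']
        · exact eps_mul_eps_add o hb hne hu hs (hmem h₁) (hmem h₂) hc.2 h₁ h₂
        · intro t ht
          rcases Finset.mem_insert.mp ht with rfl | ht
          · exact hmem h₁
          · rw [Finset.mem_singleton.mp ht]; exact hmem h₂
        · intro t ht ht'
          by_contra h0
          obtain ⟨h3, h4⟩ := hnz hs ht (left_ne_zero_of_mul h0)
          obtain ⟨h5, h6⟩ := hnz ht hu (right_ne_zero_of_mul h0)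
          obtain ⟨p, rfl⟩ := (mem_region.mp ht).1
          apply ht'
          rw [Finset.mem_insert, Finset.mem_singleton]
          exact hall p h5 h3 h6
      · refine Finset.sum_eq_zero fun t ht => ?_
        by_contra h0
        obtain ⟨h3, h4⟩ := hnz hs ht (left_ne_zero_of_mul h0)
        obtain ⟨h5, h6⟩ := hnz ht hu (right_ne_zero_of_mul h0)
        exact hc ⟨h5.trans h3, by omega⟩
    have := congrArg (Int.cast : ℤ → k) key
    push_cast at this
    exact this

end Arrangement

/-! ### Exactness of subcomplexes cut out by further inequalities -/

namespace Arrangement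

variable {n : ℕ} {ι : Type*}

/-- The arrangement with further inequalities `form h y ≤ const h`, `h ∈ N`, imposed on the
polyhedron. -/
noncomputable def restrict (A : Arrangement n ι) (N : Finset ι) : Arrangement n ι where
  form := A.form
  const := A.const
  pos := A.pos
  neg := A.neg ∪ N

variable {A : Arrangement n ι}

theorem mem_restrict_support {N : Finset ι} {y : Fin n → ℝ} : y ∈ (A.restrict N).support ↔
    y ∈ A.support ∧ ∀ h ∈ N, A.form h y ≤ A.const h := by
  simp only [support, restrict, Set.mem_ofPred_eq, Finset.mem_union, or_imp, forall_and, and_assoc]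

theorem restrict_support_subset (N : Finset ι) : (A.restrict N).support ⊆ A.support :=
  fun _ hy => (mem_restrict_support.mp hy).1

theorem cell_subset_restrict_support {N : Finset ι} {y : Fin n → ℝ} :
    A.cell (A.sgn y) ⊆ (A.restrict N).support ↔ y ∈ (A.restrict N).support :=
  ⟨fun h => h (A.mem_cell_self y), fun h => (A.restrict N).cell_subset_support h⟩

/-- The sign vector of a cell. -/
noncomputable def signOf {p : ℕ} (σ : Cell A.cells p) : Option ι → SignType :=
  A.sgn (Classical.choose σ.2.1)

theorem cell_signOf {p : ℕ} (σ : Cell A.cells p) : A.cell (signOf σ) = σ.1 :=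
  (Classical.choose_spec σ.2.1).2.symm

theorem exists_signOf_eq {p : ℕ} (σ : Cell A.cells p) : ∃ y ∈ A.support, A.sgn y = signOf σ :=
  ⟨_, (Classical.choose_spec σ.2.1).1, rfl⟩

theorem signOf_eq_iff {p : ℕ} {σ : Cell A.cells p} {y : Fin n → ℝ} :
    signOf σ = A.sgn y ↔ σ.1 = A.cell (A.sgn y) := by
  constructor
  · intro h
    rw [← cell_signOf, h]
  · intro h
    obtain ⟨z, _, hz⟩ := exists_signOf_eq σ
    rw [← cell_signOf, ← hz] at h
    rw [← hz, A.cell_sgn_injective h]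

theorem signOf_injective {p : ℕ} : Function.Injective (signOf (A := A) (p := p)) :=
  fun σ τ h => Subtype.ext (by rw [← cell_signOf σ, ← cell_signOf τ, h])

theorem rk_signOf [Finite ι] {p : ℕ} (σ : Cell A.cells p) : rk A.hom (signOf σ) = p + 1 := by
  obtain ⟨y, _, hy⟩ := exists_signOf_eq σ
  rw [← hy, rk_sgn, ← signOf_eq_iff.mp hy.symm, σ.2.2]

theorem restrict_empty : A.restrict ∅ = A := by
  cases A
  simp [restrict]

variable [Fintype ι]

theorem finite_cell (p : ℕ) : Finite (Cell A.cells p) := Finite.of_injective _ signOf_injective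

theorem signOf_mem_homRegion_restrict {N : Finset ι} {p : ℕ} {σ : Cell A.cells p} :
    signOf σ ∈ (A.restrict N).homRegion ↔ σ.1 ⊆ (A.restrict N).support := by
  obtain ⟨y, _, hy⟩ := exists_signOf_eq σ
  rw [signOf_eq_iff.mp hy.symm, cell_subset_restrict_support, ← hy]
  exact sgn_mem_homRegion (A := A.restrict N)

theorem exists_signOf_of_rk (hb : Bornology.IsBounded A.support) (hne : A.support.Nonempty)
    {s : Option ι → SignType} (hs : s ∈ A.homRegion) {p : ℕ} (hp : rk A.hom s = p + 1) :
    ∃ σ : Cell A.cells p, signOf σ = s := by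
  obtain ⟨y, hy, rfl⟩ := exists_sgn_eq hb hne hs fun h0 => by
    rw [h0, rk_zero hb hne] at hp; omega
  exact ⟨cellAt hy hp, signOf_eq_iff.mpr rfl⟩

theorem eps_signOf (o : CellOrientation A.cells) {p : ℕ} (σ : Cell A.cells (p + 1))
    (τ : Cell A.cells p) : A.eps o (signOf σ) (signOf τ) = incidence o σ τ := by
  obtain ⟨y, hy, hys⟩ := exists_signOf_eq σ
  obtain ⟨z, hz, hzt⟩ := exists_signOf_eq τ
  have hyp := rk_signOf σ
  have hzp := rk_signOf τ
  rw [← hys] at hyp ⊢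
  rw [← hzt] at hzp ⊢
  rw [eps_cellAt o hy hz hyp hzp]
  congr 1
  · exact Subtype.ext (signOf_eq_iff.mp hys.symm).symm
  · exact Subtype.ext (signOf_eq_iff.mp hzt.symm).symm

theorem eps_signOf_zero (o : CellOrientation A.cells) {p : ℕ} (σ : Cell A.cells p) :
    A.eps o (signOf σ) 0 = if p = 0 then 1 else 0 := by
  have : A.eps o (signOf σ) 0 = if rk A.hom (signOf σ) = 1 then 1 else 0 := if_pos rfl
  rw [this, rk_signOf]
  simp

variable {k : Type*} [Field k] (o : CellOrientation A.cells)

theorem homRegion_restrict_subset (N : Finset ι) : (A.restrict N).homRegion ⊆ A.homRegion :=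
  region_mono (Finset.Subset.refl _) (Finset.map_subset_map.mpr Finset.subset_union_left)

/-- The height form `none` makes the region pointed, by boundedness. A point of the restricted
polyhedron supplies the required nonzero cone. -/
theorem exactOn_restrict (hb : Bornology.IsBounded A.support) {N : Finset ι}
    (hN : (A.restrict N).support.Nonempty) :
    ExactOn (fun s t => ((A.eps o s t : ℤ) : k)) (A.restrict N).homRegion := by
  have hne : A.support.Nonempty := hN.mono (restrict_support_subset N)
  have hbN := hb.subset (restrict_support_subset N)
  refine exactOn_region (none : Option ι) _ le_rfl
    ((isIncidence_eps o k hb hne).mono (homRegion_restrict_subset N) region_down)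
    (Finset.none_mem_insertNone) (fun s hs => eq_zero_of_none hbN hN hs) ?_
  obtain ⟨y, hy⟩ := hN
  exact ⟨_, (sgn_mem_homRegion (A := A.restrict N)).mpr hy, (A.restrict N).sgn_ne_zero y⟩

/-- Converts the ungraded sums over all sign vectors into sums over the cells of a single dimension.
-/
theorem sum_homRegion_eq {p : ℕ} [Fintype (Cell A.cells p)] {N : Finset ι}
    {F : (Option ι → SignType) → k} {G : Cell A.cells p → k}
    (hF : ∀ s ∈ (A.restrict N).homRegion, F s ≠ 0 → ∃ σ : Cell A.cells p, signOf σ = s)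
    (hG : ∀ σ : Cell A.cells p, G σ ≠ 0 → σ.1 ⊆ (A.restrict N).support)
    (hFG : ∀ σ : Cell A.cells p, σ.1 ⊆ (A.restrict N).support → F (signOf σ) = G σ) :
    ∑ s ∈ (A.restrict N).homRegion, F s = ∑ σ, G σ := by
  rw [← Finset.sum_filter_of_ne (p := fun σ : Cell A.cells p => σ.1 ⊆ (A.restrict N).support)
    fun σ _ h => hG σ h]
  symm
  refine Finset.sum_of_injOn signOf signOf_injective.injOn (fun σ hσ => ?_) (fun s hs hs' => ?_)
    fun σ hσ => (hFG σ (Finset.mem_filter.mp hσ).2).symm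
  · exact signOf_mem_homRegion_restrict.mpr (Finset.mem_filter.mp hσ).2
  · by_contra h0
    obtain ⟨σ, rfl⟩ := hF s hs h0
    exact hs' ⟨σ, by simpa using signOf_mem_homRegion_restrict.mp hs, rfl⟩

/-- Exactness of the part of the cellular chain complex supported on a convex union of cells,
given that the chain `u` is a cycle. -/
theorem exists_boundary_eq (hb : Bornology.IsBounded A.support) (N : Finset ι) {p : ℕ}
    [Fintype (Cell A.cells p)] [Fintype (Cell A.cells (p + 1))] (u : Cell A.cells p → k)
    (hu : ∀ σ, u σ ≠ 0 → σ.1 ⊆ (A.restrict N).support)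
    (hcyc : ∀ t ∈ (A.restrict N).homRegion,
      ∑ σ : Cell A.cells p, u σ * ((A.eps o (signOf σ) t : ℤ) : k) = 0) :
    ∃ w : Cell A.cells (p + 1) → k, (∀ ρ, w ρ ≠ 0 → ρ.1 ⊆ (A.restrict N).support) ∧
      ∀ σ : Cell A.cells p, ∑ ρ, w ρ * ((incidence o ρ σ : ℤ) : k) = u σ := by
  by_cases hN : (A.restrict N).support.Nonempty
  swap
  · refine ⟨fun _ => 0, fun _ h => absurd rfl h, fun σ => ?_⟩
    simp only [zero_mul, Finset.sum_const_zero]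
    by_contra h0
    obtain ⟨y, _, hy⟩ := exists_signOf_eq σ
    have h1 := hu σ (Ne.symm h0)
    rw [signOf_eq_iff.mp hy.symm] at h1
    exact hN ⟨y, h1 (A.mem_cell_self y)⟩
  have hne : A.support.Nonempty := hN.mono (restrict_support_subset N)
  -- The chain is extended by zero to all other dimensions and to the empty cell, since the
  -- exactness statement is ungraded.
  obtain ⟨b, hbd⟩ := exactOn_restrict (k := k) o hb hN (Function.extend signOf u 0)
    fun t ht => by
      rw [← hcyc t ht]
      refine sum_homRegion_eq (fun s hs h0 => ?_) (fun σ h0 => hu σ (left_ne_zero_of_mul h0))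
        fun σ _ => ?_
      · by_contra hc
        exact left_ne_zero_of_mul h0 (Function.extend_apply' _ _ _ hc)
      · rw [signOf_injective.extend_apply]
  -- The ungraded solution may have parts in every dimension, but only its part in dimension `p + 1`
  -- affects the `p`-cells.
  refine ⟨fun ρ => if ρ.1 ⊆ (A.restrict N).support then b (signOf ρ) else 0, fun ρ h => ?_,
    fun σ => ?_⟩
  · by_contra hc
    exact h (if_neg hc)
  · by_cases hσ : σ.1 ⊆ (A.restrict N).support
    · have h1 := hbd _ (signOf_mem_homRegion_restrict.mpr hσ)
      rw [signOf_injective.extend_apply] at h1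
      rw [← h1]
      symm
      refine sum_homRegion_eq (fun s hs h0 => ?_) (fun ρ h0 => ?_) fun ρ hρ => ?_
      · have h2 := ((isIncidence_eps o k hb hne).ne_zero_iff s (homRegion_restrict_subset N hs)
          (signOf σ) (homRegion_restrict_subset N (signOf_mem_homRegion_restrict.mpr hσ))).mp
            (right_ne_zero_of_mul h0)
        exact exists_signOf_of_rk hb hne (homRegion_restrict_subset N hs)
          (h2.2.trans (by rw [rk_signOf]))
      · by_contra hc
        exact left_ne_zero_of_mul h0 (if_neg hc)
      · beta_reduce
        rw [eps_signOf]
        exact congrArg (· * _) (if_pos hρ).symm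
    · have h0 : u σ = 0 := by
        by_contra h0
        exact hσ (hu σ h0)
      rw [h0]
      refine Finset.sum_eq_zero fun ρ _ => ?_
      by_cases hρ : ρ.1 ⊆ (A.restrict N).support
      · rw [incidence_eq_zero o ρ σ fun h => hσ (h.trans hρ), Int.cast_zero, mul_zero]
      · exact mul_eq_zero_of_left (if_neg hρ) _

theorem exists_boundary_eq_zero (hb : Bornology.IsBounded A.support) (N : Finset ι)
    [Fintype (Cell A.cells 0)] [Fintype (Cell A.cells 1)] (u : Cell A.cells 0 → k)
    (hu : ∀ σ, u σ ≠ 0 → σ.1 ⊆ (A.restrict N).support) (hcyc : ∑ σ, u σ = 0) :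
    ∃ w : Cell A.cells 1 → k, (∀ ρ, w ρ ≠ 0 → ρ.1 ⊆ (A.restrict N).support) ∧
      ∀ σ : Cell A.cells 0, ∑ ρ, w ρ * ((incidence o ρ σ : ℤ) : k) = u σ := by
  refine exists_boundary_eq o hb N u hu fun t ht => ?_
  by_cases ht0 : t = 0
  · simp only [ht0, eps_signOf_zero, if_true, Int.cast_one, mul_one, hcyc]
  · refine Finset.sum_eq_zero fun σ _ => ?_
    by_contra h0
    have hσ := hu σ (left_ne_zero_of_mul h0)
    have hne : A.support.Nonempty := by
      obtain ⟨y, hy, _⟩ := exists_signOf_eq σ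
      exact ⟨y, hy⟩
    have h2 := ((isIncidence_eps o k hb hne).ne_zero_iff _
      (homRegion_restrict_subset N (signOf_mem_homRegion_restrict.mpr hσ)) t
      (homRegion_restrict_subset N ht)).mp (right_ne_zero_of_mul h0)
    obtain ⟨y, _, rfl⟩ := exists_sgn_eq hb hne (homRegion_restrict_subset N ht) ht0
    rw [rk_signOf, rk_sgn] at h2
    omega

theorem exists_boundary_eq_succ (hb : Bornology.IsBounded A.support) (N : Finset ι) {p : ℕ}
    [Fintype (Cell A.cells (p + 1))] [Fintype (Cell A.cells (p + 2))]
    (u : Cell A.cells (p + 1) → k) (hu : ∀ σ, u σ ≠ 0 → σ.1 ⊆ (A.restrict N).support)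
    (hcyc : ∀ τ : Cell A.cells p, τ.1 ⊆ (A.restrict N).support →
      ∑ σ, u σ * ((incidence o σ τ : ℤ) : k) = 0) :
    ∃ w : Cell A.cells (p + 2) → k, (∀ ρ, w ρ ≠ 0 → ρ.1 ⊆ (A.restrict N).support) ∧
      ∀ σ : Cell A.cells (p + 1), ∑ ρ, w ρ * ((incidence o ρ σ : ℤ) : k) = u σ := by
  refine exists_boundary_eq o hb N u hu fun t ht => ?_
  by_cases ht0 : ∃ τ : Cell A.cells p, signOf τ = t
  · obtain ⟨τ, rfl⟩ := ht0
    simp only [eps_signOf]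
    exact hcyc τ (signOf_mem_homRegion_restrict.mp ht)
  · refine Finset.sum_eq_zero fun σ _ => ?_
    by_contra h0
    have hσ := hu σ (left_ne_zero_of_mul h0)
    have hne : A.support.Nonempty := by
      obtain ⟨y, hy, _⟩ := exists_signOf_eq σ
      exact ⟨y, hy⟩
    have h2 := ((isIncidence_eps o k hb hne).ne_zero_iff _
      (homRegion_restrict_subset N (signOf_mem_homRegion_restrict.mpr hσ)) t
      (homRegion_restrict_subset N ht)).mp (right_ne_zero_of_mul h0)
    rw [rk_signOf] at h2
    exact ht0 (exists_signOf_of_rk hb hne (homRegion_restrict_subset N ht) (by omega))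

/-- The boundary of a boundary vanishes. -/
theorem sum_incidence_mul_eps (hb : Bornology.IsBounded A.support) {p : ℕ}
    [Fintype (Cell A.cells p)] (ρ : Cell A.cells (p + 1)) {u : Option ι → SignType}
    (hu : u ∈ A.homRegion) :
    ∑ σ : Cell A.cells p, ((incidence o ρ σ : ℤ) : k) * ((A.eps o (signOf σ) u : ℤ) : k) = 0 := by
  obtain ⟨y, hy, hyρ⟩ := exists_signOf_eq ρ
  have hne : A.support.Nonempty := ⟨y, hy⟩
  have hρ : signOf ρ ∈ A.homRegion := hyρ ▸ sgn_mem_homRegion.mpr hy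
  have h := (isIncidence_eps o k hb hne).sqZero _ hρ u hu
  have hN : (A.restrict ∅).homRegion = A.homRegion := by rw [restrict_empty]
  have hN' : (A.restrict ∅).support = A.support := by rw [restrict_empty]
  rw [← h, ← hN]
  symm
  refine sum_homRegion_eq (fun s hs h0 => ?_) (fun σ _ => ?_) fun σ _ => by rw [eps_signOf]
  · rw [hN] at hs
    have h2 := ((isIncidence_eps o k hb hne).ne_zero_iff _ hρ s hs).mp (left_ne_zero_of_mul h0)
    rw [rk_signOf] at h2
    exact exists_signOf_of_rk hb hne hs (by omega)
  · obtain ⟨z, hz, hzσ⟩ := exists_signOf_eq σ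
    rw [hN', signOf_eq_iff.mp hzσ.symm]
    exact A.cell_subset_support hz

theorem sum_incidence (hb : Bornology.IsBounded A.support) [Fintype (Cell A.cells 0)]
    (ρ : Cell A.cells 1) : ∑ σ : Cell A.cells 0, ((incidence o ρ σ : ℤ) : k) = 0 := by
  have := sum_incidence_mul_eps (k := k) o hb ρ (u := 0) zero_mem_region
  simpa only [eps_signOf_zero, if_true, Int.cast_one, mul_one] using this

theorem sum_incidence_mul_incidence (hb : Bornology.IsBounded A.support) {p : ℕ}
    [Fintype (Cell A.cells (p + 1))] (ρ : Cell A.cells (p + 2)) (τ : Cell A.cells p) :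
    ∑ σ : Cell A.cells (p + 1), ((incidence o ρ σ : ℤ) : k) * ((incidence o σ τ : ℤ) : k) = 0 := by
  obtain ⟨z, hz, hzτ⟩ := exists_signOf_eq τ
  have := sum_incidence_mul_eps (k := k) o hb ρ (u := signOf τ) (hzτ ▸ sgn_mem_homRegion.mpr hz)
  simpa only [eps_signOf] using this

end Arrangement

/-! ### Multigraded maps between free modules -/

section Graded

variable {k V α β γ : Type*} [Field k] [Fintype α] [Fintype β]

open MvPolynomial

/-- The homogenization, with respect to multidegrees of the basis vectors, of a matrix over the
base field. -/
noncomputable def gradedMap (la : α → V →₀ ℕ) (lb : β → V →₀ ℕ) (e : α → β → k) :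
    (α →₀ MvPolynomial V k) →ₗ[MvPolynomial V k] (β →₀ MvPolynomial V k) :=
  Finsupp.linearCombination (MvPolynomial V k) fun a =>
    ∑ b, Finsupp.single b (monomial (la a - lb b) (e a b))

variable {la : α → V →₀ ℕ} {lb : β → V →₀ ℕ} {lc : γ → V →₀ ℕ} {e₁ : α → β → k}
  {e₂ : β → γ → k}

theorem gradedMap_apply (x : α →₀ MvPolynomial V k) (b : β) :
    gradedMap la lb e₁ x b = ∑ a, x a * monomial (la a - lb b) (e₁ a b) := by
  rw [gradedMap, Finsupp.linearCombination_apply, Finsupp.sum_fintype _ _ (by simp),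
    Finsupp.finsetSum_apply]
  refine Finset.sum_congr rfl fun a _ => ?_
  rw [Finsupp.smul_apply, Finsupp.finsetSum_apply, smul_eq_mul]
  congr 1
  rw [Finset.sum_eq_single b]
  · simp
  · intro b' _ hb'
    exact Finsupp.single_eq_of_ne hb'.symm
  · simp

theorem monomial_mul_monomial_sub {x y z : V →₀ ℕ} {r s : k} (h₁ : r ≠ 0 → y ≤ x)
    (h₂ : s ≠ 0 → z ≤ y) :
    monomial (x - y) r * monomial (y - z) s = monomial (x - z) (r * s) := by
  by_cases hr : r = 0
  · simp [hr]
  by_cases hs : s = 0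
  · simp [hs]
  rw [monomial_mul, tsub_add_tsub_cancel (h₁ hr) (h₂ hs)]

/-- The maps are homogeneous, so a kernel element is a finite sum of homogeneous ones, and in degree
`m` only the basis vectors of degree at most `m` take part, with scalar coefficients. -/
theorem exact_gradedMap [Fintype γ] (h₁ : ∀ a b, e₁ a b ≠ 0 → lb b ≤ la a)
    (h₂ : ∀ b c, e₂ b c ≠ 0 → lc c ≤ lb b) (hcomp : ∀ a c, ∑ b, e₁ a b * e₂ b c = 0)
    (hex : ∀ (m : V →₀ ℕ) (u : β → k), (∀ b, u b ≠ 0 → lb b ≤ m) →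
      (∀ c, lc c ≤ m → ∑ b, u b * e₂ b c = 0) →
        ∃ w : α → k, (∀ a, w a ≠ 0 → la a ≤ m) ∧ ∀ b, ∑ a, w a * e₁ a b = u b) :
    Function.Exact (gradedMap la lb e₁) (gradedMap lb lc e₂) := by
  intro y
  constructor
  · intro hy
    -- The component of `y` in total degree `m`; the case distinction guards against truncated
    -- subtraction.
    let u : (V →₀ ℕ) → β → k := fun m b => if lb b ≤ m then coeff (m - lb b) (y b) else 0
    have hu : ∀ m b, u m b ≠ 0 → lb b ≤ m := fun m b h => by
      by_contra hc
      exact h (if_neg hc)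
    have hcyc : ∀ m c, lc c ≤ m → ∑ b, u m b * e₂ b c = 0 := by
      intro m c hc
      have h0 : coeff (m - lc c) (gradedMap lb lc e₂ y c) = 0 := by rw [hy]; simp
      rw [gradedMap_apply, coeff_sum] at h0
      rw [← h0]
      refine Finset.sum_congr rfl fun b _ => ?_
      rw [coeff_mul_monomial']
      by_cases he : e₂ b c = 0
      · simp [he]
      have hcb := h₂ b c he
      by_cases hbm : lb b ≤ m
      · rw [if_pos (tsub_le_tsub_right hbm _), tsub_tsub_tsub_cancel_right hcb]
        exact congrArg (· * _) (if_pos hbm)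
      · rw [if_neg fun h => hbm ((tsub_le_tsub_iff_right hc).mp h)]
        exact mul_eq_zero_of_left (if_neg hbm) _
    choose w hw hwu using fun m => hex m (u m) (hu m) (hcyc m)
    -- All total degrees that occur in `y`.
    let M : Finset (V →₀ ℕ) := Finset.univ.biUnion fun b => (y b).support.image (· + lb b)
    refine ⟨Finsupp.equivFunOnFinite.symm fun a => ∑ m ∈ M, monomial (m - la a) (w m a), ?_⟩
    ext b t
    rw [gradedMap_apply]
    have h3 : ∑ a, (Finsupp.equivFunOnFinite.symm
        (fun a => ∑ m ∈ M, monomial (m - la a) (w m a)) : α →₀ MvPolynomial V k) a *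
          monomial (la a - lb b) (e₁ a b) = ∑ m ∈ M, monomial (m - lb b) (u m b) := by
      simp only [Finsupp.equivFunOnFinite_symm_apply_apply, Finset.sum_mul]
      rw [Finset.sum_comm]
      refine Finset.sum_congr rfl fun m _ => ?_
      rw [← hwu m b, map_sum]
      exact Finset.sum_congr rfl fun a _ => monomial_mul_monomial_sub (hw m a) (h₁ a b)
    rw [h3, coeff_sum]
    simp only [coeff_monomial]
    by_cases ht : t ∈ (y b).support
    · rw [Finset.sum_eq_single (t + lb b)]
      · simp [u]
      · intro m _ hm
        by_cases hbm : lb b ≤ m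
        · rw [if_neg]
          rintro rfl
          exact hm (tsub_add_cancel_of_le hbm).symm
        · simp [u, hbm]
      · intro hn
        exact absurd (Finset.mem_biUnion.mpr ⟨b, Finset.mem_univ _,
          Finset.mem_image.mpr ⟨t, ht, rfl⟩⟩) hn
    · rw [notMem_support_iff.mp ht]
      refine Finset.sum_eq_zero fun m _ => ?_
      split_ifs with h
      · by_cases hbm : lb b ≤ m
        · simp only [u, if_pos hbm, h]
          exact notMem_support_iff.mp ht
        · exact if_neg hbm
      · rfl
  · rintro ⟨x, rfl⟩
    ext c : 1
    rw [gradedMap_apply]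
    simp only [gradedMap_apply, Finset.sum_mul, mul_assoc]
    rw [Finset.sum_comm]
    refine Finset.sum_eq_zero fun a _ => ?_
    rw [← Finset.mul_sum, Finset.sum_congr rfl fun b _ =>
      monomial_mul_monomial_sub (h₁ a b) (h₂ b c), ← map_sum, hcomp, map_zero, mul_zero]

end Graded

/-! ### From exactness in each multidegree to the cellular resolution -/

namespace Arrangement

variable {n : ℕ} {ι : Type*} {A : Arrangement n ι}

theorem label_le_iff [Finite ι] (hb : Bornology.IsBounded A.support)
    (hlat : ∀ v : Fin n → ℝ, {v} ∈ A.cells → ∃ a : Fin n → ℕ, v = fun i => (a i : ℝ))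
    {σ : Set (Fin n → ℝ)} (hσ : σ ∈ A.cells) (b : Fin n →₀ ℕ) :
    label A.cells σ ≤ b ↔ ∀ y ∈ σ, ∀ i, y i ≤ b i := by
  have hne : {v | v ∈ σ ∧ {v} ∈ A.cells}.Nonempty := by
    rw [← convexHull_nonempty_iff (𝕜 := ℝ), A.convexHull_vertices hb hσ]
    obtain ⟨y, hy, rfl⟩ := hσ
    exact ⟨y, A.mem_cell_self y⟩
  have hfin : {v | v ∈ σ ∧ {v} ∈ A.cells}.Finite := A.finite_vertices.subset fun v hv => hv.2
  have hbdd : ∀ i, BddAbove {a : ℕ | ∃ v : Fin n → ℝ, v ∈ σ ∧ {v} ∈ A.cells ∧ v i = (a : ℝ)} := by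
    intro i
    refine Set.Finite.bddAbove ?_
    refine (hfin.image fun v => ⌊v i⌋₊).subset ?_
    rintro a ⟨v, h1, h2, h3⟩
    exact ⟨v, ⟨h1, h2⟩, by simp [h3]⟩
  have hsup : ∀ i, label A.cells σ i ≤ b i ↔ ∀ v ∈ σ, {v} ∈ A.cells → v i ≤ b i := by
    intro i
    constructor
    · intro h v hv hv'
      obtain ⟨a, rfl⟩ := hlat v hv'
      exact Nat.cast_le.mpr ((le_csSup (hbdd i) ⟨_, hv, hv', rfl⟩).trans h)
    · intro h
      refine csSup_le ?_ ?_
      · obtain ⟨v, hv, hv'⟩ := hne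
        obtain ⟨a, rfl⟩ := hlat v hv'
        exact ⟨_, _, hv, hv', rfl⟩
      · rintro a ⟨v, hv, hv', hva⟩
        have := h v hv hv'
        rw [hva] at this
        exact Nat.cast_le.mp this
  rw [Finsupp.le_def]
  constructor
  · intro h y hy
    have hconv : Convex ℝ {y : Fin n → ℝ | ∀ i, y i ≤ b i} := by
      have : {y : Fin n → ℝ | ∀ i, y i ≤ b i} = Set.Iic fun i => (b i : ℝ) := by
        ext y; exact Iff.rfl
      rw [this]
      exact convex_Iic _
    have hsub : {v | v ∈ σ ∧ {v} ∈ A.cells} ⊆ {y : Fin n → ℝ | ∀ i, y i ≤ b i} :=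
      fun v hv i => (hsup i).mp (h i) v hv.1 hv.2
    have := convexHull_min hsub hconv
    rw [A.convexHull_vertices hb hσ] at this
    exact this hy
  · exact fun h i => (hsup i).mpr fun v hv _ => h v hv i

theorem boundary_eq_gradedMap (k : Type*) [Field k] (o : CellOrientation A.cells) (p : ℕ)
    [Fintype (Cell A.cells p)] [Fintype (Cell A.cells (p + 1))] : boundary k o p =
      gradedMap (fun σ : Cell A.cells (p + 1) => label A.cells σ.1)
        (fun τ : Cell A.cells p => label A.cells τ.1) fun σ τ => ((incidence o σ τ : ℤ) : k) := by
  rw [boundary, gradedMap]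
  congr 1
  funext σ
  rw [finsum_eq_sum_of_fintype]

/-- The augmentation is itself a multigraded map, onto a free module whose one basis vector, of
degree zero, stands for the empty cell. -/
theorem augmentation_eq_zero_iff (k : Type*) [Field k] [Fintype (Cell A.cells 0)]
    (x : Cell A.cells 0 →₀ MvPolynomial (Fin n) k) : augmentation A.cells k x = 0 ↔
      gradedMap (fun σ : Cell A.cells 0 => label A.cells σ.1) (fun _ : Unit => 0)
        (fun _ _ => (1 : k)) x = 0 := by
  have h : augmentation A.cells k x =
      gradedMap (fun σ : Cell A.cells 0 => label A.cells σ.1) (fun _ : Unit => 0)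
        (fun _ _ => (1 : k)) x () := by
    rw [gradedMap_apply, augmentation, Finsupp.linearCombination_apply,
      Finsupp.sum_fintype _ _ (by simp)]
    simp
  rw [h]
  constructor
  · intro h0
    ext : 1
    exact h0
  · intro h0
    rw [h0]; rfl

variable [Fintype ι]

/-- A bounded polyhedron, subdivided by hyperplanes in such a way that all vertices are lattice
points and that the points bounded by a given lattice point form a subcomplex, supports a cellular
resolution of the ideal generated by its vertices. -/
theorem supportsCellularResolution {k : Type*} [Field k] (hb : Bornology.IsBounded A.support)
    (hlat : ∀ v : Fin n → ℝ, {v} ∈ A.cells → ∃ a : Fin n → ℕ, v = fun i => (a i : ℝ))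
    {I : Ideal (MvPolynomial (Fin n) k)} (hI : LinearMap.range (augmentation A.cells k) = I)
    (hlevel : ∀ b : Fin n →₀ ℕ, ∃ N : Finset ι, ∀ y ∈ A.support,
      y ∈ (A.restrict N).support ↔ ∀ i, y i ≤ b i) :
    SupportsCellularResolution A.cells I := by
  have hfin : ∀ p, Fintype (Cell A.cells p) := fun p =>
    have := finite_cell (A := A) p
    Fintype.ofFinite _
  choose N hN using hlevel
  have hle : ∀ {p} (σ : Cell A.cells p) b,
      label A.cells σ.1 ≤ b ↔ σ.1 ⊆ (A.restrict (N b)).support := by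
    intro p σ b
    have hsub : σ.1 ⊆ A.support := by
      obtain ⟨y, hy, h⟩ := σ.2.1
      rw [h]; exact A.cell_subset_support hy
    rw [label_le_iff hb hlat σ.2.1]
    exact forall₂_congr fun y hy => (hN b y (hsub hy)).symm
  have hinc : ∀ (o : CellOrientation A.cells) {p} (σ : Cell A.cells (p + 1)) (τ : Cell A.cells p),
      ((incidence o σ τ : ℤ) : k) ≠ 0 → label A.cells τ.1 ≤ label A.cells σ.1 := by
    intro o p σ τ h
    rw [hle]
    refine Set.Subset.trans ?_ ((hle σ _).mp le_rfl)
    by_contra hc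
    exact h (by rw [incidence_eq_zero o σ τ hc, Int.cast_zero])
  refine ⟨A.isPolyhedralComplex_cells hb, hlat, hI, fun o => ?_, fun o p => ?_⟩
  · have h := exact_gradedMap (la := fun σ : Cell A.cells 1 => label A.cells σ.1)
      (lb := fun σ : Cell A.cells 0 => label A.cells σ.1) (lc := fun _ : Unit => 0)
      (e₁ := fun σ τ => ((incidence o σ τ : ℤ) : k)) (e₂ := fun _ _ => (1 : k))
      (fun σ τ => hinc o σ τ) (fun _ _ _ => zero_le)
      (fun σ _ => by simpa only [mul_one] using sum_incidence o hb σ) fun m u hu hcyc => by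
        obtain ⟨w, hw, hwu⟩ := exists_boundary_eq_zero o hb (N m) u
          (fun σ h => (hle σ m).mp (hu σ h))
          (by simpa only [mul_one] using hcyc () (zero_le))
        exact ⟨w, fun ρ h => (hle ρ m).mpr (hw ρ h), hwu⟩
    intro x
    rw [augmentation_eq_zero_iff, boundary_eq_gradedMap]
    exact h x
  · rw [boundary_eq_gradedMap, boundary_eq_gradedMap]
    refine exact_gradedMap (fun σ τ => hinc o σ τ) (fun σ τ => hinc o σ τ)
      (fun ρ τ => sum_incidence_mul_incidence o hb ρ τ) fun m u hu hcyc => ?_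
    obtain ⟨w, hw, hwu⟩ := exists_boundary_eq_succ o hb (N m) u
      (fun σ h => (hle σ m).mp (hu σ h)) fun τ h => hcyc τ ((hle τ m).mpr h)
    exact ⟨w, fun ρ h => (hle ρ m).mpr (hw ρ h), hwu⟩

end Arrangement

/-! ### Powers of the edge ideal of a path -/

section PathIdeal

variable (n : ℕ)

/-- The exponent of the edge `{j, j + 1}`. -/
noncomputable def edgeVec (j : ℕ) : Fin n →₀ ℕ :=
  Finsupp.equivFunOnFinite.symm fun i => if (i : ℕ) = j ∨ (i : ℕ) = j + 1 then 1 else 0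

/-- The exponents of the products of `d` edges. -/
inductive PowExp : ℕ → (Fin n →₀ ℕ) → Prop
  | zero : PowExp 0 0
  | add (j d : ℕ) (g : Fin n →₀ ℕ) (hj : j + 1 < n) (hg : PowExp d g) :
      PowExp (d + 1) (edgeVec n j + g)

variable {n}

@[simp] theorem edgeVec_apply (j : ℕ) (i : Fin n) :
    edgeVec n j i = if (i : ℕ) = j ∨ (i : ℕ) = j + 1 then 1 else 0 := rfl

theorem edgeVec_eq_single {j : ℕ} (hj : j + 1 < n) : edgeVec n j =
    Finsupp.single (⟨j, by omega⟩ : Fin n) 1 + Finsupp.single (⟨j + 1, hj⟩ : Fin n) 1 := by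
  ext i
  simp only [edgeVec_apply, Finsupp.add_apply, Finsupp.single_apply, Fin.ext_iff]
  split_ifs <;> omega

theorem PowExp.add_pow {d e : ℕ} {g h : Fin n →₀ ℕ} (hg : PowExp n d g) (hh : PowExp n e h) :
    PowExp n (d + e) (g + h) := by
  induction hg with
  | zero => simpa using hh
  | add j d g hj _ ih =>
    rw [Nat.add_right_comm, add_assoc (edgeVec n j)]
    exact PowExp.add j _ _ hj ih

theorem PowExp.smul {j : ℕ} (hj : j + 1 < n) (c : ℕ) : PowExp n c (c • edgeVec n j) := by
  induction c with
  | zero => simpa using PowExp.zero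
  | succ c ih =>
    rw [succ_nsmul']
    exact PowExp.add j c _ hj ih

theorem PowExp.sum (a : ℕ → ℕ) {m : ℕ} (hm : m ≤ n - 1) :
    PowExp n (∑ j ∈ Finset.range m, a j) (∑ j ∈ Finset.range m, a j • edgeVec n j) := by
  induction m with
  | zero => simpa using PowExp.zero
  | succ m ih =>
    rw [Finset.sum_range_succ, Finset.sum_range_succ]
    exact (ih (by omega)).add_pow (PowExp.smul (by omega) _)

theorem PowExp.sum_eq {d : ℕ} {g : Fin n →₀ ℕ} (hg : PowExp n d g) : ∑ i, g i = 2 * d := by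
  induction hg with
  | zero => simp
  | add j d g hj _ ih =>
    simp only [Finsupp.add_apply, Finset.sum_add_distrib, ih, edgeVec_eq_single hj,
      Finsupp.single_apply, Finset.sum_ite_eq, Finset.mem_univ, if_true]
    ring

variable (k : Type*) [Field k]

theorem edgeIdeal_pathGraph : edgeIdeal k (SimpleGraph.pathGraph n) =
    Ideal.span ((fun g => MvPolynomial.monomial g (1 : k)) ''
      {g | ∃ j, j + 1 < n ∧ g = edgeVec n j}) := by
  have hX : ∀ u v : Fin n, (MvPolynomial.X u * MvPolynomial.X v : MvPolynomial (Fin n) k) =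
      MvPolynomial.monomial (Finsupp.single u 1 + Finsupp.single v 1) 1 := by
    intro u v
    simp [MvPolynomial.X, MvPolynomial.monomial_mul]
  rw [edgeIdeal]
  congr 1
  ext m
  simp only [Set.mem_image, Set.mem_ofPred_eq, SimpleGraph.pathGraph_adj]
  constructor
  · rintro ⟨u, v, h | h, rfl⟩
    · refine ⟨_, ⟨u, h ▸ v.2, rfl⟩, ?_⟩
      rw [edgeVec_eq_single (h ▸ v.2), hX]
      congr 3
      exact congrArg (fun v => Finsupp.single v 1) (Fin.ext h)
    · refine ⟨_, ⟨v, h ▸ u.2, rfl⟩, ?_⟩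
      rw [edgeVec_eq_single (h ▸ u.2), mul_comm, hX]
      congr 3
      exact congrArg (fun v => Finsupp.single v 1) (Fin.ext h)
  · rintro ⟨_, ⟨j, hj, rfl⟩, rfl⟩
    refine ⟨⟨j, by omega⟩, ⟨j + 1, hj⟩, Or.inl rfl, ?_⟩
    rw [hX, edgeVec_eq_single hj]

theorem edgeIdeal_pathGraph_pow (d : ℕ) : edgeIdeal k (SimpleGraph.pathGraph n) ^ d =
    Ideal.span ((fun g => MvPolynomial.monomial g (1 : k)) '' {g | PowExp n d g}) := by
  induction d with
  | zero =>
    have : {g | PowExp n 0 g} = {0} := by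
      ext g
      constructor
      · rintro ⟨⟩; rfl
      · rintro rfl; exact PowExp.zero
    rw [this, pow_zero, Set.image_singleton, Ideal.one_eq_top, eq_comm,
      Ideal.span_singleton_eq_top]
    exact isUnit_one
  | succ d ih =>
    rw [pow_succ', ih, edgeIdeal_pathGraph, Ideal.span_mul_span]
    congr 1
    ext m
    simp only [Set.mem_image, Set.mem_ofPred_eq]
    constructor
    · rintro ⟨_, ⟨_, ⟨j, hj, rfl⟩, rfl⟩, _, ⟨g, hg, rfl⟩, rfl⟩
      exact ⟨_, PowExp.add j d g hj hg, by simp [MvPolynomial.monomial_mul]⟩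
    · rintro ⟨_, ⟨⟩, rfl⟩
      rename_i j g hj hg
      exact ⟨_, ⟨_, ⟨j, hj, rfl⟩, rfl⟩, _, ⟨g, hg, rfl⟩, by simp [MvPolynomial.monomial_mul]⟩

theorem monomial_mem_edgeIdeal_pow {d : ℕ} {b : Fin n →₀ ℕ} :
    MvPolynomial.monomial b (1 : k) ∈ edgeIdeal k (SimpleGraph.pathGraph n) ^ d ↔
      ∃ g, PowExp n d g ∧ g ≤ b := by
  rw [edgeIdeal_pathGraph_pow, MvPolynomial.mem_ideal_span_monomial_image]
  rw [MvPolynomial.support_monomial, if_neg one_ne_zero]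
  simp

/-- All products of `d` edges have the same total degree `2 * d`, so none properly divides another.
-/
theorem minGenExponents_edgeIdeal_pow (d : ℕ) :
    minGenExponents (edgeIdeal k (SimpleGraph.pathGraph n) ^ d) = {g | PowExp n d g} := by
  ext b
  simp only [minGenExponents, monomial_mem_edgeIdeal_pow, Set.mem_ofPred_eq]
  constructor
  · rintro ⟨⟨g, hg, hgb⟩, hmin⟩
    rw [le_antisymm (hmin ⟨g, hg, le_rfl⟩ hgb) hgb]
    exact hg
  · intro hb
    refine ⟨⟨b, hb, le_rfl⟩, ?_⟩
    rintro c ⟨g, hg, hgc⟩ hcb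
    have h1 : ∀ i ∈ Finset.univ, g i ≤ b i := fun i _ => (hgc.trans hcb) i
    have h2 := (Finset.sum_eq_sum_iff_of_le h1).mp (hg.sum_eq.trans hb.sum_eq.symm)
    exact fun i => (h2 i (Finset.mem_univ i)).symm.le.trans (hgc i)

end PathIdeal

/-! ### The alternating sums of coordinates -/

section AltSum

variable {n : ℕ}

/-- The sum of the coordinates `y_m` with `m < j` and `m + 1 ≡ j` modulo `2`. -/
noncomputable def zForm (j : ℕ) : (Fin n → ℝ) →ₗ[ℝ] ℝ :=
  ∑ m ∈ Finset.univ.filter fun m : Fin n => (m : ℕ) < j ∧ (m : ℕ) % 2 ≠ j % 2, LinearMap.proj m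

theorem altForm_eq_zForm (i : Fin n) : altForm i = zForm (n := n) (i + 1) := by
  rw [altForm, zForm]
  refine Finset.sum_congr (Finset.filter_congr fun m _ => ?_) fun _ _ => rfl
  rw [Fin.le_def]
  omega

theorem zForm_zero : zForm (n := n) 0 = 0 := by
  rw [zForm, Finset.filter_false_of_mem fun m _ => by omega, Finset.sum_empty]

theorem zForm_succ (i : Fin n) (y : Fin n → ℝ) : zForm (i + 1) y = y i + zForm (i - 1) y := by
  have h : (Finset.univ.filter fun m : Fin n => (m : ℕ) < i + 1 ∧ (m : ℕ) % 2 ≠ (i + 1) % 2) =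
      insert i (Finset.univ.filter fun m : Fin n => (m : ℕ) < i - 1 ∧
        (m : ℕ) % 2 ≠ (i - 1) % 2) := by
    ext m
    simp only [Finset.mem_filter, Finset.mem_univ, true_and, Finset.mem_insert, Fin.ext_iff]
    omega
  rw [zForm, h, Finset.sum_insert (by simp)]
  rfl

/-- For `i = 0` the truncated index `i - 1` is `0`, where the form is zero, which is the right
boundary value. -/
theorem coord_eq (i : Fin n) (y : Fin n → ℝ) : y i = zForm (i + 1) y - zForm (i - 1) y := by
  rw [zForm_succ, add_sub_cancel_right]

theorem zForm_ext {x y : Fin n → ℝ} (h : ∀ t ≤ n, zForm t x = zForm t y) : x = y := by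
  funext i
  rw [coord_eq i x, coord_eq i y, h _ i.2, h _ (by omega)]

/-- The alternating sums can be prescribed arbitrarily. -/
theorem zForm_eq_of_coord {g : ℕ → ℝ} (hg : g 0 = 0) {y : Fin n → ℝ}
    (hy : ∀ i : Fin n, y i = g (i + 1) - g (i - 1)) : ∀ t ≤ n, zForm t y = g t := by
  intro t
  induction t using Nat.strong_induction_on with
  | _ t ih =>
    intro ht
    rcases t with _ | t
    · rw [zForm_zero, hg]; rfl
    · have h1 := zForm_succ ⟨t, ht⟩ y
      have h2 := hy ⟨t, ht⟩
      simp only at h1 h2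
      rw [h1, h2, ih (t - 1) (by omega) (by omega)]
      ring

/-- The point of `ℝ^n` with the given exponents as coordinates. -/
def toReal (g : Fin n →₀ ℕ) : Fin n → ℝ := fun i => (g i : ℝ)

/-- The two ends of an edge have opposite parity, so once both have index below `t` exactly one is
counted. In these coordinates edges become step functions and `zForm` a cumulative count of edges.
-/
theorem zForm_edgeVec (j : ℕ) : ∀ t ≤ n,
    zForm t (toReal (edgeVec n j)) = if j < t then 1 else 0 := by
  refine zForm_eq_of_coord (g := fun t => if j < t then 1 else 0) (by simp) fun i => ?_
  simp only [toReal, edgeVec_apply]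
  split_ifs <;> first | omega | norm_num

theorem toReal_add (g h : Fin n →₀ ℕ) : toReal (g + h) = toReal g + toReal h := by
  funext i; simp [toReal]

end AltSum

/-! ### The Newton polytope -/

section Newton

variable (n d : ℕ)

/-- The index set of the inequalities and hyperplanes that define `complexZ`. -/
abbrev PathIndex : Type := (Fin n × Fin (d + 1)) ⊕ (Fin n × Fin (d + 1)) ⊕ Fin n ⊕ Unit

/-- The Newton polytope of a power of the edge ideal of a path, with the hyperplanes that
subdivide it. -/
noncomputable def pathArrangement : Arrangement n (PathIndex n d) where
  form := Sum.elim (fun p => coordForm p.1) (Sum.elim (fun p => altForm p.1)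
    (Sum.elim (fun j => zForm (j + 1) - zForm j) fun _ => zForm n))
  const := Sum.elim (fun p => (p.2 : ℕ)) (Sum.elim (fun p => (p.2 : ℕ))
    (Sum.elim (fun _ => 0) fun _ => d))
  pos := Finset.univ.image fun j => Sum.inr (Sum.inr j)
  neg := insert (Sum.inr (Sum.inr (Sum.inr ())))
    ((Finset.univ.filter fun j : Fin n => (j : ℕ) + 1 = n).image fun j =>
      Sum.inr (Sum.inr (Sum.inl j)))

variable {n d}

/-- There are only `n - 1` edges, so the last increment, from `n - 1` to `n`, must vanish; this is
why that one inequality is imposed in both directions. -/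
theorem mem_pathArrangement_support {y : Fin n → ℝ} : y ∈ (pathArrangement n d).support ↔
    (∀ t < n, zForm t y ≤ zForm (t + 1) y) ∧ zForm (n - 1) y = zForm n y ∧ zForm n y = d := by
  have h : y ∈ (pathArrangement n d).support ↔ ((∀ j : Fin n, zForm j y ≤ zForm (j + 1) y) ∧
      (d : ℝ) ≤ zForm n y) ∧ zForm n y ≤ d ∧
        ∀ j : Fin n, (j : ℕ) + 1 = n → zForm (j + 1) y ≤ zForm j y := by
    simp [Arrangement.support, pathArrangement]
  rw [h]
  constructor
  · rintro ⟨⟨h1, h2⟩, h3, h4⟩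
    refine ⟨fun t ht => h1 ⟨t, ht⟩, ?_, le_antisymm h3 h2⟩
    rcases n with _ | n
    · rfl
    · exact le_antisymm (h1 (Fin.last n)) (h4 (Fin.last n) rfl)
  · rintro ⟨h1, h2, h3⟩
    refine ⟨⟨fun j => h1 j j.2, h3.ge⟩, h3.le, fun j hj => ?_⟩
    have e : n - 1 = j := by omega
    rw [e] at h2
    rw [hj, h2]

variable {y : Fin n → ℝ}

theorem zForm_mono (hy : y ∈ (pathArrangement n d).support) {s t : ℕ} (hst : s ≤ t) (ht : t ≤ n) :
    zForm s y ≤ zForm t y := by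
  induction t, hst using Nat.le_induction with
  | base => exact le_rfl
  | succ t _ ih =>
    exact (ih (by omega)).trans ((mem_pathArrangement_support.mp hy).1 t (by omega))

theorem zForm_mem_Icc (hy : y ∈ (pathArrangement n d).support) {t : ℕ} (ht : t ≤ n) :
    zForm t y ∈ Set.Icc (0 : ℝ) d := by
  constructor
  · have := zForm_mono hy (Nat.zero_le t) ht
    rwa [zForm_zero] at this
  · rw [← (mem_pathArrangement_support.mp hy).2.2]
    exact zForm_mono hy ht le_rfl

theorem coord_mem_Icc (hy : y ∈ (pathArrangement n d).support) (i : Fin n) :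
    y i ∈ Set.Icc (0 : ℝ) d := by
  have h1 := zForm_mono hy (show (i : ℕ) - 1 ≤ i + 1 by omega) i.2
  have h2 := zForm_mem_Icc hy (show (i : ℕ) - 1 ≤ n by omega)
  have h3 := zForm_mem_Icc hy (show (i : ℕ) + 1 ≤ n from i.2)
  rw [coord_eq i y]
  exact ⟨by linarith, by linarith [h2.1, h3.2]⟩

theorem isBounded_pathArrangement_support :
    Bornology.IsBounded (pathArrangement n d).support :=
  (Metric.isBounded_Icc (0 : Fin n → ℝ) fun _ => (d : ℝ)).subset fun _ hy =>
    ⟨fun i => (coord_mem_Icc hy i).1, fun i => (coord_mem_Icc hy i).2⟩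

theorem PowExp.mem_support {g : Fin n →₀ ℕ} (hg : PowExp n d g) :
    toReal g ∈ (pathArrangement n d).support := by
  rw [mem_pathArrangement_support]
  induction hg with
  | zero =>
    have : toReal (0 : Fin n →₀ ℕ) = 0 := by funext i; simp [toReal]
    simp [this]
  | add j d g hj _ ih =>
    obtain ⟨h1, h2, h3⟩ := ih
    have he := zForm_edgeVec (n := n) j
    rw [toReal_add]
    simp only [map_add]
    refine ⟨fun t ht => add_le_add ?_ (h1 t ht), ?_, ?_⟩
    · rw [he t ht.le, he (t + 1) ht]
      split_ifs <;> first | omega | norm_num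
    · rw [he (n - 1) (by omega), he n le_rfl, if_pos (by omega), if_pos (by omega), h2]
    · rw [he n le_rfl, if_pos (by omega), h3]
      push_cast
      ring

theorem sum_range_sub_eq (hy : y ∈ (pathArrangement n d).support) :
    ∑ j ∈ Finset.range (n - 1), (zForm (j + 1) y - zForm j y) = d := by
  obtain ⟨_, h2, h3⟩ := mem_pathArrangement_support.mp hy
  rw [Finset.sum_range_sub (fun j => zForm j y), h2, h3, zForm_zero]
  simp

/-- The coordinates of a point of the Newton polytope with respect to the edges. -/
theorem eq_sum_edgeVec (hy : y ∈ (pathArrangement n d).support) :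
    y = ∑ j ∈ Finset.range (n - 1), (zForm (j + 1) y - zForm j y) • toReal (edgeVec n j) := by
  obtain ⟨_, h2, _⟩ := mem_pathArrangement_support.mp hy
  refine zForm_ext fun t ht => ?_
  have h1 : zForm t y = zForm (min t (n - 1)) y := by
    rcases le_or_gt t (n - 1) with h | h
    · rw [min_eq_left h]
    · rw [min_eq_right h.le, h2]
      congr 2
      omega
  rw [map_sum, h1]
  have h4 : ∀ j ∈ Finset.range (n - 1), zForm t ((zForm (j + 1) y - zForm j y) •
      toReal (edgeVec n j)) = if j < t then zForm (j + 1) y - zForm j y else 0 := by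
    intro j _
    rw [map_smul, zForm_edgeVec j t ht, smul_eq_mul]
    split_ifs <;> simp
  rw [Finset.sum_congr rfl h4, ← Finset.sum_filter]
  have h5 : (Finset.range (n - 1)).filter (· < t) = Finset.range (min t (n - 1)) := by
    ext j
    simp only [Finset.mem_filter, Finset.mem_range]
    omega
  rw [h5, Finset.sum_range_sub (fun j => zForm j y), zForm_zero]
  simp

theorem toReal_injective : Function.Injective (toReal (n := n)) := fun g h e => by
  ext i
  exact Nat.cast_injective (R := ℝ) (congrFun e i)

/-- The increments of the alternating sums of a lattice point are nonnegative integers with sum `d`,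
and they are the multiplicities of the edges. -/
theorem powExp_of_toReal_mem {g : Fin n →₀ ℕ} (hg : toReal g ∈ (pathArrangement n d).support) :
    PowExp n d g := by
  have hz : ∀ t ≤ n, ∃ a : ℤ, zForm t (toReal g) = a := by
    intro t _
    refine ⟨∑ m ∈ Finset.univ.filter fun m : Fin n => (m : ℕ) < t ∧ (m : ℕ) % 2 ≠ t % 2,
      (g m : ℤ), ?_⟩
    simp [zForm, LinearMap.sum_apply, toReal]
  have ha : ∀ j, ∃ a : ℕ, j < n - 1 → zForm (j + 1) (toReal g) - zForm j (toReal g) = a := by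
    intro j
    by_cases hj : j < n - 1
    · obtain ⟨a, ha⟩ := hz j (by omega)
      obtain ⟨b, hb⟩ := hz (j + 1) (by omega)
      have h1 := zForm_mono hg (Nat.le_succ j) (by omega)
      rw [ha, Nat.succ_eq_add_one, hb, Int.cast_le] at h1
      refine ⟨(b - a).toNat, fun _ => ?_⟩
      rw [ha, hb, ← Int.cast_sub, ← Int.cast_natCast, Int.toNat_of_nonneg (by omega)]
    · exact ⟨0, fun h => absurd h hj⟩
  choose a ha using ha
  have h1 := sum_range_sub_eq hg
  have h2 := eq_sum_edgeVec hg
  rw [Finset.sum_congr rfl fun j hj => ha j (Finset.mem_range.mp hj)] at h1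
  rw [Finset.sum_congr rfl fun j hj => by rw [ha j (Finset.mem_range.mp hj)]] at h2
  have h3 : ∑ j ∈ Finset.range (n - 1), a j = d := by exact_mod_cast h1
  have h4 : g = ∑ j ∈ Finset.range (n - 1), a j • edgeVec n j := by
    refine toReal_injective (h2.trans ?_)
    funext i
    simp [toReal, Finset.sum_apply]
  rw [h4, ← h3]
  exact PowExp.sum a le_rfl

theorem convex_pathArrangement_support : Convex ℝ (pathArrangement n d).support := by
  intro x hx y hy r s hr hs hrs
  rw [mem_pathArrangement_support] at hx hy ⊢
  simp only [map_add, map_smul, smul_eq_mul]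
  refine ⟨fun t ht => ?_, ?_, ?_⟩
  · exact add_le_add (mul_le_mul_of_nonneg_left (hx.1 t ht) hr)
      (mul_le_mul_of_nonneg_left (hy.1 t ht) hs)
  · rw [hx.2.1, hy.2.1]
  · rw [hx.2.2, hy.2.2, ← add_mul, hrs, one_mul]

theorem newtonPolytope_eq_support (k : Type*) [Field k] :
    newtonPolytope (edgeIdeal k (SimpleGraph.pathGraph n) ^ d) =
      (pathArrangement n d).support := by
  rw [newtonPolytope, minGenExponents_edgeIdeal_pow]
  change convexHull ℝ (toReal '' {g | PowExp n d g}) = _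
  refine Set.Subset.antisymm (convexHull_min ?_ convex_pathArrangement_support) fun y hy => ?_
  · rintro _ ⟨g, hg, rfl⟩
    exact hg.mem_support
  · have h1 := sum_range_sub_eq hy
    have h2 := eq_sum_edgeVec hy
    have hnn : ∀ j ∈ Finset.range (n - 1), 0 ≤ zForm (j + 1) y - zForm j y := fun j hj => by
      rw [Finset.mem_range] at hj
      exact sub_nonneg.mpr (zForm_mono hy (Nat.le_succ j) (by omega))
    -- For `d > 0` the point is a convex combination of the vectors `d • edgeVec n j`, with the
    -- increments divided by `d` as weights; for `d = 0` only the origin remains.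
    rcases Nat.eq_zero_or_pos d with rfl | hd
    · rw [Nat.cast_zero, Finset.sum_eq_zero_iff_of_nonneg hnn] at h1
      rw [Finset.sum_eq_zero fun j hj => by rw [h1 j hj, zero_smul]] at h2
      refine subset_convexHull ℝ _ ⟨0, PowExp.zero, ?_⟩
      rw [h2]
      funext i
      simp [toReal]
    · have hd' : (d : ℝ) ≠ 0 := by exact_mod_cast hd.ne'
      have h3 : y = ∑ j ∈ Finset.range (n - 1),
          ((zForm (j + 1) y - zForm j y) / d) • toReal (d • edgeVec n j) := by
        conv_lhs => rw [h2]
        refine Finset.sum_congr rfl fun j _ => ?_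
        funext i
        simp only [Pi.smul_apply, smul_eq_mul, toReal, Finsupp.smul_apply, Nat.cast_mul]
        field_simp
      rw [h3]
      refine (convex_convexHull ℝ _).sum_mem (fun j hj => div_nonneg (hnn j hj) (Nat.cast_nonneg d))
        ?_ fun j hj => subset_convexHull ℝ _ ⟨_, PowExp.smul ?_ d, rfl⟩
      · rw [← Finset.sum_div, h1, div_self hd']
      · rw [Finset.mem_range] at hj; omega

/-- Coordinates and alternating sums take values in `[0, d]` on the polytope, so hyperplanes of
level above `d` miss it and a finite arrangement suffices. -/
theorem complexZ_eq_cells (k : Type*) [Field k] : complexZ k n d = (pathArrangement n d).cells := by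
  rw [complexZ, newtonPolytope_eq_support]
  refine (pathArrangement n d).subdivision_eq_cells _ _ ?_ ?_
  · rintro (⟨i, j⟩ | ⟨i, j⟩)
    · rcases Nat.lt_or_ge j (d + 1) with hj | hj
      · exact Or.inl ⟨Sum.inl (i, ⟨j, hj⟩), rfl, rfl⟩
      · refine Or.inr fun y hy => (coord_mem_Icc hy i).2.trans_lt ?_
        exact Nat.cast_lt.mpr hj
    · rcases Nat.lt_or_ge j (d + 1) with hj | hj
      · exact Or.inl ⟨Sum.inr (Sum.inl (i, ⟨j, hj⟩)), rfl, rfl⟩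
      · refine Or.inr fun y hy => ?_
        simp only [Sum.elim_inr]
        rw [altForm_eq_zForm]
        exact (zForm_mem_Icc hy i.2).2.trans_lt (Nat.cast_lt.mpr hj)
  · rintro (⟨i, j⟩ | ⟨i, j⟩ | j)
    · exact Or.inr (Or.inr ⟨Sum.inl (i, j), rfl, rfl⟩)
    · exact Or.inr (Or.inr ⟨Sum.inr (i, j), rfl, rfl⟩)
    · exact Or.inl (Finset.mem_image.mpr ⟨j, Finset.mem_univ _, rfl⟩)

end Newton

/-! ### Vertices, labels and level sets of the path complex -/

section PathVertices

variable {n d : ℕ}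

/-- The alternating sums of a vertex are integers. -/
theorem fract_zForm_of_singleton_mem {v : Fin n → ℝ} (hv : {v} ∈ (pathArrangement n d).cells)
    {t : ℕ} (ht : t ≤ n) : Int.fract (zForm t v) = 0 := by
  obtain ⟨y, hy, hvy⟩ := hv
  obtain rfl : y = v := by
    have := (pathArrangement n d).mem_cell_self y
    rwa [← hvy, Set.mem_singleton_iff] at this
  by_contra hne
  set θ := Int.fract (zForm t y) with hθ
  -- The motion that raises at equal speed all alternating sums with fractional part `θ`. An
  -- equation valid at `y` makes two of these sums differ by an integer, or one of them an integer,
  -- so the motion preserves it.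
  let g : ℕ → ℝ := fun s => if Int.fract (zForm s y) = θ then 1 else 0
  have hg : ∀ {s r : ℕ}, Int.fract (zForm s y) = Int.fract (zForm r y) → g s = g r := fun h => by
    simp only [g, h]
  have hg0 : ∀ {s : ℕ}, Int.fract (zForm s y) = 0 → g s = 0 := fun h =>
    if_neg fun h' => hne (h'.symm.trans h)
  have hz : ∀ s ≤ n, zForm s (fun i : Fin n => g (i + 1) - g (i - 1)) = g s :=
    zForm_eq_of_coord (hg0 (by simp [zForm_zero])) fun _ => rfl
  set w : Fin n → ℝ := fun i => g (i + 1) - g (i - 1) with hw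
  have hmem : w ∈ (pathArrangement n d).dir ((pathArrangement n d).sgn y) := by
    rw [Arrangement.mem_dir, mem_flat]
    rintro (_ | h) h0
    · rfl
    rw [Arrangement.sgn_eq_zero, Arrangement.hom_some, mul_one, sub_eq_zero] at h0
    rw [Arrangement.hom_some, mul_zero, sub_zero]
    rcases h with ⟨i, j⟩ | ⟨i, j⟩ | j | _
    · have h1 : y i = (j : ℕ) := h0
      change w i = 0
      rw [coord_eq i y, sub_eq_iff_eq_add'] at h1
      rw [coord_eq i w, hz _ i.2, hz _ (by omega), sub_eq_zero]
      exact hg (by rw [h1, Int.fract_add_natCast])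
    · have h1 : altForm i y = (j : ℕ) := h0
      change altForm i w = 0
      rw [altForm_eq_zForm] at h1 ⊢
      rw [hz _ i.2]
      exact hg0 (by rw [h1, Int.fract_natCast])
    · have h1 : zForm (j + 1) y - zForm j y = 0 := h0
      change zForm (j + 1) w - zForm j w = 0
      rw [hz _ j.2, hz _ j.2.le, sub_eq_zero]
      exact hg (by rw [sub_eq_zero.mp h1])
    · have h1 : zForm n y = d := h0
      change zForm n w = 0
      rw [hz n le_rfl]
      exact hg0 (by rw [h1, Int.fract_natCast])
  -- A vertex has no nonzero direction, whereas `zForm t w = 1`.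
  rw [← Arrangement.vectorSpan_cell, ← hvy, vectorSpan_singleton, Submodule.mem_bot] at hmem
  have h1 := hz t ht
  rw [hmem, map_zero] at h1
  simp [g, hθ] at h1

/-- The vertices are lattice points. -/
theorem exists_toReal_eq_of_singleton_mem {v : Fin n → ℝ}
    (hv : {v} ∈ (pathArrangement n d).cells) : ∃ g : Fin n →₀ ℕ, v = toReal g := by
  have hsupp : v ∈ (pathArrangement n d).support := by
    obtain ⟨y, hy, hvy⟩ := hv
    exact Arrangement.cell_subset_support _ hy (hvy ▸ Set.mem_singleton v)
  have h : ∀ i : Fin n, ∃ a : ℕ, v i = a := by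
    intro i
    have h1 := Int.fract_eq_zero_iff.mp (fract_zForm_of_singleton_mem hv i.2)
    have h2 := Int.fract_eq_zero_iff.mp
      (fract_zForm_of_singleton_mem hv (show (i : ℕ) - 1 ≤ n by omega))
    obtain ⟨a, ha⟩ := h1
    obtain ⟨b, hb⟩ := h2
    have h3 := (coord_mem_Icc hsupp i).1
    have h4 := coord_eq i v
    rw [← Nat.succ_eq_add_one, ← ha, ← hb, ← Int.cast_sub] at h4
    rw [h4, Int.cast_nonneg_iff] at h3
    exact ⟨(a - b).toNat, by rw [h4, ← Int.cast_natCast, Int.toNat_of_nonneg h3]⟩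
  choose a ha using h
  exact ⟨Finsupp.equivFunOnFinite.symm a, funext ha⟩

theorem exists_natCast_eq_of_singleton_mem (v : Fin n → ℝ)
    (hv : {v} ∈ (pathArrangement n d).cells) : ∃ a : Fin n → ℕ, v = fun i => (a i : ℝ) :=
  (exists_toReal_eq_of_singleton_mem hv).imp' _ fun _ h => h

/-- The lattice points of the polytope are vertices. -/
theorem cell_sgn_toReal {g : Fin n →₀ ℕ} (hg : toReal g ∈ (pathArrangement n d).support) :
    (pathArrangement n d).cell ((pathArrangement n d).sgn (toReal g)) = {toReal g} := by
  refine Set.eq_singleton_iff_unique_mem.mpr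
    ⟨Arrangement.mem_cell_self _ _, fun z hz => funext fun i => ?_⟩
  have hi : g i < d + 1 := Nat.lt_succ_of_le (Nat.cast_le.mp (coord_mem_Icc hg i).2)
  -- The coordinate hyperplane `y_i = g i` belongs to the arrangement, so it fixes the `i`-th
  -- coordinate on the cell.
  have h0 : (pathArrangement n d).sgn (toReal g) (some (Sum.inl (i, ⟨g i, hi⟩))) = 0 := by
    rw [Arrangement.sgn_eq_zero, Arrangement.hom_some, mul_one, sub_eq_zero]
    rfl
  have h1 := Conf.zero hz h0
  rwa [Arrangement.sgn_eq_zero, Arrangement.hom_some, mul_one, sub_eq_zero] at h1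

theorem label_singleton_toReal {g : Fin n →₀ ℕ}
    (hg : {toReal g} ∈ (pathArrangement n d).cells) :
    label (pathArrangement n d).cells {toReal g} = g := by
  have h : ∀ b, label (pathArrangement n d).cells {toReal g} ≤ b ↔ g ≤ b := fun b => by
    rw [Arrangement.label_le_iff isBounded_pathArrangement_support
      exists_natCast_eq_of_singleton_mem hg]
    simp [toReal, Finsupp.le_def]
  exact le_antisymm ((h g).mpr le_rfl) ((h _).mp le_rfl)

/-- Vertices of the complex, lattice points of the polytope and exponents of products of `d` edges
are the same points. -/
theorem range_augmentation_pathArrangement (k : Type*) [Field k] :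
    LinearMap.range (augmentation (pathArrangement n d).cells k) =
      edgeIdeal k (SimpleGraph.pathGraph n) ^ d := by
  rw [augmentation, Finsupp.range_linearCombination]
  refine le_antisymm (Submodule.span_le.mpr ?_) ?_
  · rintro _ ⟨⟨σ, hσ, hdim⟩, rfl⟩
    obtain ⟨y, hy, rfl⟩ := id hσ
    have h1 : (pathArrangement n d).cell ((pathArrangement n d).sgn y) = {y} := by
      have h2 := Submodule.finrank_eq_zero.mp hdim
      rw [vectorSpan_eq_bot_iff_subsingleton] at h2
      exact h2.eq_singleton_of_mem (Arrangement.mem_cell_self _ y)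
    have h3 : {y} ∈ (pathArrangement n d).cells := h1 ▸ hσ
    obtain ⟨g, rfl⟩ := exists_toReal_eq_of_singleton_mem h3
    simp only [SetLike.mem_coe]
    rw [h1, label_singleton_toReal h3, monomial_mem_edgeIdeal_pow]
    exact ⟨g, powExp_of_toReal_mem hy, le_rfl⟩
  · rw [edgeIdeal_pathGraph_pow]
    refine Submodule.span_mono ?_
    rintro _ ⟨g, hg, rfl⟩
    have h1 := PowExp.mem_support hg
    have h2 : {toReal g} ∈ (pathArrangement n d).cells :=
      cell_sgn_toReal h1 ▸ Arrangement.cell_mem_cells h1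
    refine ⟨⟨{toReal g}, h2, by rw [vectorSpan_singleton, finrank_bot]⟩, ?_⟩
    simp only [label_singleton_toReal h2]

theorem exists_restrict_support_iff (b : Fin n →₀ ℕ) : ∃ N : Finset (PathIndex n d),
    ∀ y ∈ (pathArrangement n d).support,
      y ∈ ((pathArrangement n d).restrict N).support ↔ ∀ i, y i ≤ b i := by
  -- The bound `y_i ≤ b i` is imposed through a hyperplane of the arrangement when `b i ≤ d`, and
  -- holds on the whole polytope otherwise.
  refine ⟨(Finset.univ.filter fun p : Fin n × Fin (d + 1) => (p.2 : ℕ) = b p.1).image Sum.inl,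
    fun y hy => ?_⟩
  rw [Arrangement.mem_restrict_support, Finset.forall_mem_image]
  constructor
  · rintro ⟨-, h⟩ i
    rcases Nat.lt_or_ge (b i) (d + 1) with hi | hi
    · exact h (x := (i, ⟨b i, hi⟩)) (by simp)
    · exact (coord_mem_Icc hy i).2.trans (Nat.cast_le.mpr (by omega))
  · rintro h
    refine ⟨hy, fun p hp => ?_⟩
    rw [Finset.mem_filter] at hp
    change y p.1 ≤ ((p.2 : ℕ) : ℝ)
    rw [hp.2]
    exact h p.1

end PathVertices

end CellRes

theorem mainTheorem7 (k : Type*) [Field k] (n d : ℕ) :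
    CellRes.SupportsCellularResolution (CellRes.complexZ k n d)
      (CellRes.edgeIdeal k (SimpleGraph.pathGraph n) ^ d) := by
  rw [CellRes.complexZ_eq_cells k]
  exact CellRes.Arrangement.supportsCellularResolution CellRes.isBounded_pathArrangement_support
    CellRes.exists_natCast_eq_of_singleton_mem (CellRes.range_augmentation_pathArrangement k)
    CellRes.exists_restrict_support_iff
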